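/- Let the model be either KG (spherically symmetric Klein–Gordon on $(1+3)$-dimensional AdS) with an integer $\delta\ge 2$, or WM (corotational wave maps from $(1+2)$-dimensional AdS) with an integer $\delta\ge 1$. On $(0,\pi/2)$ put $d\mu=w\,dx$ with $w=\sin^2x\cos^{2\delta-2}x$ (KG), $w=\sin^{2\delta+1}x\cos^3x$ (WM), and $(f|g)=\int_0^{\pi/2}fg\,d\mu$. Let $L\phi=-\frac1w(w\phi')'+c\,\phi$, with $c=\delta^2$ (KG), $c=(\delta+2)^2$ (WM), be the self-adjoint operator on $L^2(d\mu)$ generated by the form $\int\phi'\psi'\,d\mu+c\int\phi\psi\,d\mu$ on the space of all $\phi\in L^2(d\mu)$ with weak derivative in $L^2(d\mu)$. Let $$e_n(x)=N_nP_n^{(a,b)}(\cos 2x),\qquad \omega_n=2n+\delta\ \text{(KG)},\quad \omega_n=2n+\delta+2\ \text{(WM)},\qquad n\ge0,$$ be its $L^2(d\mu)$-orthonormal eigenfunctions and frequencies ($Le_n=\omega_n^2e_n$). Here $P_n^{(a,b)}$ are the Jacobi polynomials with $(a,b)=(\frac12,\delta-\frac32)$ (KG), $(a,b)=(\delta,1)$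 (WM), and $$N_n^2=\frac{2\,\Gamma(n+1)(2n+\delta)\Gamma(n+\delta)}{\Gamma(n+\frac32)\Gamma(n+\delta-\frac12)}\ \text{(KG)},\qquad N_n^2=\frac{2(\delta+n+1)(\delta+2n+2)}{n+1}\ \text{(WM)},\qquad N_n>0.$$ Write $\phi^{(m)}=(\phi|e_m)$, and for $r\ge2$ let $H^r$ be the space of $\phi\in\mathcal D(L)$ with norm $\|\phi\|_{H^r}^2=\sum_n\omega_n^{2r}|\phi^{(n)}|^2<\infty$. Let $W=\cos^{2\delta-2}x$ (KG), $W=\sin^{2\delta-2}x\cos^4x$ (WM), $f^{(3)}(\phi)=-W\phi^3$, $C_{ijkm}=\int_0^{\pi/2}We_ie_je_ke_m\,d\mu$, $\Phi^t\zeta=\sum_m\zeta^{(m)}\cos(\omega_mt)e_m$, and $$\mathcal M(\zeta)=L\zeta+\langle f^{(3)}\rangle(\zeta),\qquad \langle f^{(3)}\rangle(\zeta)=\frac1{2\pi}\int_0^{2\pi}\Phi^{-t}\big[f^{(3)}(\Phi^t\zeta)\big]\,dt .$$ Let $\kappa_0=\pm2\omega_0\sqrt{\frac{2}{3C_{0000}}}$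 (either sign) and $\xi=\kappa_0e_0$. Then, for every real $s\ge0$: for every $\zeta\in H^{s+2}$ the functions $f^{(3)}(\Phi^t\zeta)$, $t\in\mathbb R$, lie in $L^2(d\mu)$ and $t\mapsto\Phi^{-t}[f^{(3)}(\Phi^t\zeta)]$ is Bochner integrable on $[0,2\pi]$ with values in $L^2(d\mu)$, so that $\mathcal M:H^{s+2}\to L^2(d\mu)$ is well defined; $\xi\in H^{s+2}$; $\mathcal M$ is Fréchet differentiable at $\xi$; for all $h\in H^{s+2}$, $$\big(d\mathcal M(\xi)[h]\big)^{(0)}=-2\omega_0^2\,h^{(0)},\qquad \big(d\mathcal M(\xi)[h]\big)^{(m)}=\frac{\omega_0^2\omega_m^2}{C_{0000}}\Big(\frac{C_{0000}}{\omega_0^2}-2\frac{C_{00mm}}{\omega_m^2}\Big)h^{(m)}\quad(m\ge1);$$ and $$\ker\big(d\mathcal M(\xi)\big)=\{0\}.$$ -/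

import Mathlib

open MeasureTheory Set
open scoped ENNReal ContDiff

noncomputable section

namespace AdS

/-- The two models: the spherically symmetric Klein-Gordon field on the (1+3)-dimensional AdS space
(`KG`) and corotational wave maps from the (1+2)-dimensional AdS space (`WM`). -/
inductive Model where
  | KG : Model
  | WM : Model

/-- Admissible (integer) conformal masses. -/
def Admissible : Model → ℕ → Prop
  | Model.KG, δ => 2 ≤ δ
  | Model.WM, δ => 1 ≤ δ

/-- The Sturm-Liouville weight `w`. -/
def weight : Model → ℕ → ℝ → ℝ
  | Model.KG, δ, x => Real.sin x ^ 2 * Real.cos x ^ (2 * δ - 2)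
  | Model.WM, δ, x => Real.sin x ^ (2 * δ + 1) * Real.cos x ^ 3

/-- The coefficient `W` of the cubic nonlinearity. -/
def nlWeight : Model → ℕ → ℝ → ℝ
  | Model.KG, δ, x => Real.cos x ^ (2 * δ - 2)
  | Model.WM, δ, x => Real.sin x ^ (2 * δ - 2) * Real.cos x ^ 4

/-- The frequencies: `2 n + δ` for KG and `2 n + δ + 2` for WM. -/
def freq : Model → ℕ → ℕ → ℝ
  | Model.KG, δ, n => 2 * (n : ℝ) + (δ : ℝ)
  | Model.WM, δ, n => 2 * (n : ℝ) + (δ : ℝ) + 2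

/-- The zeroth order coefficient of `L = -(1/w) d/dx (w d/dx) + massSq`. -/
def massSq : Model → ℕ → ℝ
  | Model.KG, δ => (δ : ℝ) ^ 2
  | Model.WM, δ => ((δ : ℝ) + 2) ^ 2

/-- The Jacobi polynomial `P_n^{(a,b)}(y)`. -/
def jacobiP (n : ℕ) (a b y : ℝ) : ℝ :=
  ∑ k ∈ Finset.range (n + 1),
    (n.choose k : ℝ) * (ascPochhammer ℝ k).eval ((n : ℝ) + a + b + 1)
      * (ascPochhammer ℝ (n - k)).eval (a + (k : ℝ) + 1) / (n.factorial : ℝ)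
      * ((y - 1) / 2) ^ k

/-- The normalization constants of the eigenfunctions. -/
def normConst : Model → ℕ → ℕ → ℝ
  | Model.KG, δ, n => Real.sqrt (2 * Real.Gamma ((n : ℝ) + 1) / Real.Gamma ((n : ℝ) + 3 / 2)
      * ((2 * (n : ℝ) + (δ : ℝ)) * Real.Gamma ((n : ℝ) + (δ : ℝ))
        / Real.Gamma ((n : ℝ) + (δ : ℝ) - 1 / 2)))
  | Model.WM, δ, n => Real.sqrt (2 * ((δ : ℝ) + (n : ℝ) + 1) * ((δ : ℝ) + 2 * (n : ℝ) + 2)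
      / ((n : ℝ) + 1))

/-- The eigenfunctions `e_n`, as functions of `x`. -/
def eigenfun : Model → ℕ → ℕ → ℝ → ℝ
  | Model.KG, δ, n, x =>
      normConst Model.KG δ n * jacobiP n (1 / 2) ((δ : ℝ) - 3 / 2) (Real.cos (2 * x))
  | Model.WM, δ, n, x =>
      normConst Model.WM δ n * jacobiP n (δ : ℝ) 1 (Real.cos (2 * x))

/-- The measure `dμ = w dx` on the interval `(0, π/2)`. -/
def mu (M : Model) (δ : ℕ) : Measure ℝ :=
  (volume.restrict (Ioo 0 (Real.pi / 2))).withDensity (fun x => ENNReal.ofReal (weight M δ x))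

/-- The real Hilbert space `L²((0, π/2); dμ)`. -/
abbrev L2 (M : Model) (δ : ℕ) : Type := Lp ℝ 2 (mu M δ)

/-- The Fourier coefficients `C_{ijkm} = ∫ W e_i e_j e_k e_m dμ`. -/
def fourierC (M : Model) (δ i j k m : ℕ) : ℝ :=
  ∫ x, nlWeight M δ x * eigenfun M δ i x * eigenfun M δ j x * eigenfun M δ k x
    * eigenfun M δ m x ∂(mu M δ)

theorem continuous_weight (M : Model) (δ : ℕ) : Continuous (weight M δ) := by
  cases M <;> unfold weight <;> fun_prop

theorem weight_pos (M : Model) (δ : ℕ) {x : ℝ} (hx : x ∈ Ioo 0 (Real.pi / 2)) :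
    0 < weight M δ x := by
  have h1 : 0 < Real.sin x := Real.sin_pos_of_pos_of_lt_pi hx.1 (by linarith [hx.2, Real.pi_pos])
  have h2 : 0 < Real.cos x :=
    Real.cos_pos_of_mem_Ioo ⟨by linarith [hx.1, Real.pi_pos], hx.2⟩
  cases M <;> unfold weight <;> positivity

theorem weight_le_one (M : Model) (δ : ℕ) {x : ℝ} (hx : x ∈ Ioo 0 (Real.pi / 2)) :
    weight M δ x ≤ 1 := by
  have h1 : 0 < Real.sin x := Real.sin_pos_of_pos_of_lt_pi hx.1 (by linarith [hx.2, Real.pi_pos])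
  have h2 : 0 < Real.cos x :=
    Real.cos_pos_of_mem_Ioo ⟨by linarith [hx.1, Real.pi_pos], hx.2⟩
  cases M <;> unfold weight <;>
    exact mul_le_one₀ (pow_le_one₀ h1.le (Real.sin_le_one x)) (by positivity)
      (pow_le_one₀ h2.le (Real.cos_le_one x))

instance isFiniteMeasure_mu (M : Model) (δ : ℕ) : IsFiniteMeasure (mu M δ) := by
  refine isFiniteMeasure_withDensity (ne_of_lt ?_)
  calc ∫⁻ x in Ioo 0 (Real.pi / 2), ENNReal.ofReal (weight M δ x)
      ≤ ∫⁻ _ in Ioo 0 (Real.pi / 2), 1 := by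
        refine setLIntegral_mono measurable_const (fun x hx => ?_)
        simpa using ENNReal.ofReal_le_ofReal (weight_le_one M δ hx)
    _ < ⊤ := by simp

theorem restrict_absolutelyContinuous_mu (M : Model) (δ : ℕ) :
    volume.restrict (Ioo 0 (Real.pi / 2)) ≪ mu M δ := by
  refine withDensity_absolutelyContinuous' ?_ ?_
  · exact (continuous_weight M δ).measurable.ennreal_ofReal.aemeasurable
  · refine (ae_restrict_iff' measurableSet_Ioo).2 (Filter.Eventually.of_forall fun x hx => ?_)
    simpa using weight_pos M δ hx

theorem continuous_eigenfun (M : Model) (δ n : ℕ) : Continuous (eigenfun M δ n) := by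
  cases M <;> unfold eigenfun jacobiP <;> fun_prop

theorem memLp_eigenfun (M : Model) (δ n : ℕ) : MemLp (eigenfun M δ n) 2 (mu M δ) := by
  obtain ⟨C, hC⟩ := isCompact_Icc.exists_bound_of_continuousOn
    (s := Icc 0 (Real.pi / 2)) (continuous_eigenfun M δ n).continuousOn
  refine MemLp.of_bound (continuous_eigenfun M δ n).aestronglyMeasurable C ?_
  refine (withDensity_absolutelyContinuous _ _) ?_
  exact (ae_restrict_iff' measurableSet_Ioo).2
    (Filter.Eventually.of_forall fun x hx => hC x (Ioo_subset_Icc_self hx))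

/-- The eigenfunction `e_n` as an element of `L²((0, π/2); dμ)`. -/
def eigenmode (M : Model) (δ n : ℕ) : L2 M δ := (memLp_eigenfun M δ n).toLp (eigenfun M δ n)

/-- The coefficient `φ^{(n)} = (φ | e_n)`. -/
def coeff {M : Model} {δ : ℕ} (n : ℕ) (φ : L2 M δ) : ℝ := inner ℝ (eigenmode M δ n) φ

/-- Smooth functions with compact support in `(0, π/2)`. -/
def IsTest (η : ℝ → ℝ) : Prop :=
  ContDiff ℝ ∞ η ∧ HasCompactSupport η ∧ tsupport η ⊆ Ioo 0 (Real.pi / 2)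

/-- `φ' = ψ` in the sense of distributions on `(0, π/2)`, where `φ, ψ ∈ L²((0, π/2); dμ)`. The
energy space `H¹((0, π/2); dμ)` is the set of all `φ` that have such a `ψ`. -/
def HasWeakDeriv {M : Model} {δ : ℕ} (φ ψ : L2 M δ) : Prop :=
  ∀ η : ℝ → ℝ, IsTest η →
    ∫ x in Ioo 0 (Real.pi / 2), φ x * deriv η x = - ∫ x in Ioo 0 (Real.pi / 2), ψ x * η x

/-- `φ ∈ D(L)` and `L φ = g`, where `L` is the operator generated by the form
`α(φ, ψ) = ∫ φ' ψ' dμ + massSq ∫ φ ψ dμ` on `H¹((0, π/2); dμ)`. -/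
def IsL {M : Model} {δ : ℕ} (φ g : L2 M δ) : Prop :=
  ∃ φ' : L2 M δ, HasWeakDeriv φ φ' ∧ ∀ ψ ψ' : L2 M δ, HasWeakDeriv ψ ψ' →
    inner ℝ φ' ψ' + massSq M δ * inner ℝ φ ψ = inner ℝ g ψ

theorem integrableOn_mul_of_bdd {M : Model} {δ : ℕ} (φ : L2 M δ) {ρ : ℝ → ℝ} (hm : Measurable ρ)
    {C : ℝ} (hC : ∀ x, ‖ρ x / weight M δ x‖ ≤ C) :
    IntegrableOn (fun x => φ x * ρ x) (Ioo 0 (Real.pi / 2)) := by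
  have hφ : Integrable φ (mu M δ) := (Lp.memLp φ).integrable (by norm_num)
  have h1 : Integrable (fun x => (ρ x / weight M δ x) * φ x) (mu M δ) :=
    hφ.bdd_mul (c := C) ((hm.div (continuous_weight M δ).measurable).aestronglyMeasurable)
      (Filter.Eventually.of_forall hC)
  unfold mu at h1
  rw [integrable_withDensity_iff (continuous_weight M δ).measurable.ennreal_ofReal
    (Filter.Eventually.of_forall fun x => ENNReal.ofReal_lt_top)] at h1
  refine h1.congr ?_
  refine (ae_restrict_iff' measurableSet_Ioo).2 (Filter.Eventually.of_forall fun x hx => ?_)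
  have hw := weight_pos M δ hx
  change ρ x / weight M δ x * φ x * (ENNReal.ofReal (weight M δ x)).toReal = φ x * ρ x
  rw [ENNReal.toReal_ofReal hw.le, mul_right_comm, div_mul_cancel₀ _ hw.ne', mul_comm]

theorem integrableOn_mul_test {M : Model} {δ : ℕ} (φ : L2 M δ) {η : ℝ → ℝ} (hc : Continuous η)
    (hs : HasCompactSupport η) (hsub : tsupport η ⊆ Ioo 0 (Real.pi / 2)) :
    IntegrableOn (fun x => φ x * η x) (Ioo 0 (Real.pi / 2)) := by
  obtain ⟨C, hC⟩ := hs.isCompact.exists_bound_of_continuousOn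
    (f := fun x => η x / weight M δ x)
    (hc.continuousOn.div (continuous_weight M δ).continuousOn
      (fun x hx => (weight_pos M δ (hsub hx)).ne'))
  refine integrableOn_mul_of_bdd φ hc.measurable (C := max C 0) fun x => ?_
  by_cases hx : x ∈ tsupport η
  · exact (hC x hx).trans (le_max_left _ _)
  · simp [image_eq_zero_of_notMem_tsupport hx]

theorem IsTest.integrable {M : Model} {δ : ℕ} (φ : L2 M δ) {η : ℝ → ℝ} (h : IsTest η) :
    IntegrableOn (fun x => φ x * η x) (Ioo 0 (Real.pi / 2)) :=
  integrableOn_mul_test φ h.1.continuous h.2.1 h.2.2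

theorem IsTest.integrable_deriv {M : Model} {δ : ℕ} (φ : L2 M δ) {η : ℝ → ℝ} (h : IsTest η) :
    IntegrableOn (fun x => φ x * deriv η x) (Ioo 0 (Real.pi / 2)) :=
  integrableOn_mul_test φ (h.1.continuous_deriv (by simp)) h.2.1.deriv
    ((tsupport_deriv_subset).trans h.2.2)

theorem HasWeakDeriv.add {M : Model} {δ : ℕ} {φ₁ ψ₁ φ₂ ψ₂ : L2 M δ} (h₁ : HasWeakDeriv φ₁ ψ₁)
    (h₂ : HasWeakDeriv φ₂ ψ₂) : HasWeakDeriv (φ₁ + φ₂) (ψ₁ + ψ₂) := by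
  intro η hη
  have e : ∀ (f g : L2 M δ) (ρ : ℝ → ℝ),
      ∫ x in Ioo 0 (Real.pi / 2), (f + g : L2 M δ) x * ρ x
        = ∫ x in Ioo 0 (Real.pi / 2), (f x * ρ x + g x * ρ x) := by
    intro f g ρ
    refine integral_congr_ae ?_
    filter_upwards [restrict_absolutelyContinuous_mu M δ (Lp.coeFn_add f g)] with x hx
    rw [hx, Pi.add_apply, add_mul]
  rw [e, e, integral_add (hη.integrable_deriv φ₁) (hη.integrable_deriv φ₂),
    integral_add (hη.integrable ψ₁) (hη.integrable ψ₂), h₁ η hη, h₂ η hη]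
  ring

theorem HasWeakDeriv.smul {M : Model} {δ : ℕ} {φ ψ : L2 M δ} (c : ℝ) (h : HasWeakDeriv φ ψ) :
    HasWeakDeriv (c • φ) (c • ψ) := by
  intro η hη
  have e : ∀ (f : L2 M δ) (ρ : ℝ → ℝ),
      ∫ x in Ioo 0 (Real.pi / 2), (c • f : L2 M δ) x * ρ x
        = c * ∫ x in Ioo 0 (Real.pi / 2), f x * ρ x := by
    intro f ρ
    rw [← integral_const_mul]
    refine integral_congr_ae ?_
    filter_upwards [restrict_absolutelyContinuous_mu M δ (Lp.coeFn_smul c f)] with x hx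
    rw [hx, Pi.smul_apply, smul_eq_mul, mul_assoc]
  rw [e, e, h η hη, mul_neg]

theorem ae_eq_zero_of_test {f : ℝ → ℝ} (hloc : LocallyIntegrableOn f (Ioo 0 (Real.pi / 2)))
    (h0 : ∀ η : ℝ → ℝ, IsTest η → ∫ x in Ioo 0 (Real.pi / 2), f x * η x = 0) :
    f =ᵐ[volume.restrict (Ioo 0 (Real.pi / 2))] 0 := by
  refine (ae_restrict_iff' measurableSet_Ioo).2
    (isOpen_Ioo.ae_eq_zero_of_integral_contDiff_smul_eq_zero hloc fun η h1 h2 h3 => ?_)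
  rw [← h0 η ⟨h1, h2, h3⟩, ← integral_indicator measurableSet_Ioo]
  refine integral_congr_ae (Filter.Eventually.of_forall fun x => ?_)
  by_cases hx : x ∈ Ioo 0 (Real.pi / 2)
  · simp only [indicator_of_mem hx, smul_eq_mul, mul_comm]
  · have : η x = 0 := image_eq_zero_of_notMem_tsupport (fun h => hx (h3 h))
    simp only [indicator_of_notMem hx, this, zero_smul]

theorem L2_eq_zero_of_ae {M : Model} {δ : ℕ} {φ : L2 M δ}
    (h : φ =ᵐ[volume.restrict (Ioo 0 (Real.pi / 2))] 0) : φ = 0 := by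
  refine Lp.ext ?_
  have h' : φ =ᵐ[mu M δ] 0 := withDensity_absolutelyContinuous _ _ h
  exact h'.trans (Lp.coeFn_zero ℝ 2 (mu M δ)).symm

/-- Weak derivatives are unique. -/
theorem HasWeakDeriv.unique {M : Model} {δ : ℕ} {φ ψ₁ ψ₂ : L2 M δ} (h₁ : HasWeakDeriv φ ψ₁)
    (h₂ : HasWeakDeriv φ ψ₂) : ψ₁ = ψ₂ := by
  have h : HasWeakDeriv (0 : L2 M δ) (ψ₁ - ψ₂) := by
    have := h₁.add (h₂.smul (-1))
    rwa [neg_one_smul, neg_one_smul, ← sub_eq_add_neg, ← sub_eq_add_neg, sub_self] at this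
  refine sub_eq_zero.1 (L2_eq_zero_of_ae (ae_eq_zero_of_test ?_ fun η hη => ?_))
  · refine (locallyIntegrableOn_iff isOpen_Ioo.isLocallyClosed).2 fun K hK hKc => ?_
    obtain ⟨C, hC⟩ := hKc.exists_bound_of_continuousOn (f := fun x => 1 / weight M δ x)
      (continuousOn_const.div (continuous_weight M δ).continuousOn
        (fun x hx => (weight_pos M δ (hK hx)).ne'))
    have := integrableOn_mul_of_bdd (ψ₁ - ψ₂) (ρ := K.indicator 1)
      (measurable_one.indicator hKc.measurableSet) (C := max C 0) fun x => by
        by_cases hx : x ∈ K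
        · simpa [hx] using Or.inl (hC x hx)
        · simp [hx]
    refine (this.mono_set hK).congr_fun (fun x hx => ?_) hKc.measurableSet
    simp [hx]
  · have e := h η hη
    have z : ∫ x in Ioo 0 (Real.pi / 2), (0 : L2 M δ) x * deriv η x = 0 := by
      refine integral_eq_zero_of_ae ?_
      filter_upwards [restrict_absolutelyContinuous_mu M δ (Lp.coeFn_zero ℝ 2 (mu M δ))] with x hx
      rw [hx]
      exact zero_mul _
    rw [z] at e
    linarith

theorem memLp_test (M : Model) (δ : ℕ) {η : ℝ → ℝ} (hc : Continuous η)
    (hs : HasCompactSupport η) : MemLp η 2 (mu M δ) := by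
  obtain ⟨C, hC⟩ := hs.exists_bound_of_continuous hc
  exact MemLp.of_bound hc.aestronglyMeasurable C (Filter.Eventually.of_forall hC)

/-- The value `L φ` is unique. -/
theorem IsL.unique {M : Model} {δ : ℕ} {φ g₁ g₂ : L2 M δ} (h₁ : IsL φ g₁) (h₂ : IsL φ g₂) :
    g₁ = g₂ := by
  obtain ⟨d₁, hd₁, k₁⟩ := h₁
  obtain ⟨d₂, hd₂, k₂⟩ := h₂
  obtain rfl := hd₁.unique hd₂
  have key : ∀ ψ ψ' : L2 M δ, HasWeakDeriv ψ ψ' → inner ℝ (g₁ - g₂) ψ = 0 := by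
    intro ψ ψ' h
    rw [inner_sub_left, ← k₁ ψ ψ' h, ← k₂ ψ ψ' h, sub_self]
  have hint : IntegrableOn (fun x => (g₁ - g₂ : L2 M δ) x * weight M δ x)
      (Ioo 0 (Real.pi / 2)) := by
    refine integrableOn_mul_of_bdd _ (continuous_weight M δ).measurable (C := 1) fun x => ?_
    by_cases hx : weight M δ x = 0
    · simp [hx]
    · simp [hx]
  have hz := ae_eq_zero_of_test hint.locallyIntegrableOn (fun η hη => by
    have m₀ := memLp_test M δ hη.1.continuous hη.2.1
    have m₁ := memLp_test M δ (hη.1.continuous_deriv (by simp)) hη.2.1.deriv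
    have hw : HasWeakDeriv (m₀.toLp η) (m₁.toLp (deriv η)) := by
      intro ρ hρ
      have e₀ : ∫ x in Ioo 0 (Real.pi / 2), (m₀.toLp η) x * deriv ρ x
          = ∫ x, η x * deriv ρ x := by
        have : ∫ x in Ioo 0 (Real.pi / 2), (m₀.toLp η) x * deriv ρ x
            = ∫ x in Ioo 0 (Real.pi / 2), η x * deriv ρ x := by
          refine integral_congr_ae ?_
          filter_upwards [restrict_absolutelyContinuous_mu M δ m₀.coeFn_toLp] with x hx
          rw [hx]
        rw [this]
        refine setIntegral_eq_integral_of_forall_compl_eq_zero fun x hx => ?_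
        rw [image_eq_zero_of_notMem_tsupport (fun h => hx (hη.2.2 h)), zero_mul]
      have e₁ : ∫ x in Ioo 0 (Real.pi / 2), (m₁.toLp (deriv η)) x * ρ x
          = ∫ x, deriv η x * ρ x := by
        have : ∫ x in Ioo 0 (Real.pi / 2), (m₁.toLp (deriv η)) x * ρ x
            = ∫ x in Ioo 0 (Real.pi / 2), deriv η x * ρ x := by
          refine integral_congr_ae ?_
          filter_upwards [restrict_absolutelyContinuous_mu M δ m₁.coeFn_toLp] with x hx
          rw [hx]
        rw [this]
        refine setIntegral_eq_integral_of_forall_compl_eq_zero fun x hx => ?_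
        rw [image_eq_zero_of_notMem_tsupport (fun h => hx (hρ.2.2 h)), mul_zero]
      rw [e₀, e₁]
      have cη := hη.1.continuous
      have cρ := hρ.1.continuous
      have cη' : Continuous (deriv η) := hη.1.continuous_deriv (by simp)
      have cρ' : Continuous (deriv ρ) := hρ.1.continuous_deriv (by simp)
      exact integral_mul_deriv_eq_deriv_mul_of_integrable
        (fun x _ => (hη.1.differentiable (by simp) x).hasDerivAt)
        (fun x _ => (hρ.1.differentiable (by simp) x).hasDerivAt)
        ((cη.mul cρ').integrable_of_hasCompactSupport hη.2.1.mul_right)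
        ((cη'.mul cρ).integrable_of_hasCompactSupport hρ.2.1.mul_left)
        ((cη.mul cρ).integrable_of_hasCompactSupport hη.2.1.mul_right)
    have e := key _ _ hw
    rw [L2.inner_def] at e
    unfold mu at e
    rw [integral_withDensity_eq_integral_toReal_smul
      (continuous_weight M δ).measurable.ennreal_ofReal
      (Filter.Eventually.of_forall fun x => ENNReal.ofReal_lt_top)] at e
    refine Eq.trans (integral_congr_ae ?_) e
    filter_upwards [restrict_absolutelyContinuous_mu M δ m₀.coeFn_toLp,
      ae_restrict_mem measurableSet_Ioo] with x hx hxI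
    change _ = (ENNReal.ofReal (weight M δ x)).toReal * (inner ℝ ((g₁ - g₂ : L2 M δ) x)
      (m₀.toLp η x))
    rw [hx, ENNReal.toReal_ofReal (weight_pos M δ hxI).le]
    simp only [RCLike.inner_apply, conj_trivial]
    ring)
  refine sub_eq_zero.1 (L2_eq_zero_of_ae ?_)
  filter_upwards [hz, ae_restrict_mem measurableSet_Ioo] with x hx hxI
  exact (mul_eq_zero.1 hx).resolve_right (weight_pos M δ hxI).ne'

/-- The domain `D(L)` of the linearized operator. -/
def domL (M : Model) (δ : ℕ) : Submodule ℝ (L2 M δ) where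
  carrier := {φ | ∃ g, IsL φ g}
  add_mem' := by
    rintro φ₁ φ₂ ⟨g₁, d₁, hd₁, h₁⟩ ⟨g₂, d₂, hd₂, h₂⟩
    refine ⟨g₁ + g₂, d₁ + d₂, hd₁.add hd₂, fun ψ ψ' hψ => ?_⟩
    rw [inner_add_left, inner_add_left, inner_add_left, ← h₁ ψ ψ' hψ, ← h₂ ψ ψ' hψ]
    ring
  zero_mem' := by
    have h0 : HasWeakDeriv (0 : L2 M δ) 0 := by
      intro η _
      have e : ∀ ρ : ℝ → ℝ, ∫ x in Ioo 0 (Real.pi / 2), (0 : L2 M δ) x * ρ x = 0 := by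
        intro ρ
        refine integral_eq_zero_of_ae ?_
        filter_upwards [restrict_absolutelyContinuous_mu M δ (Lp.coeFn_zero ℝ 2 (mu M δ))] with x hx
        rw [hx]
        exact zero_mul _
      rw [e, e, neg_zero]
    exact ⟨0, 0, h0, fun ψ ψ' _ => by simp⟩
  smul_mem' := by
    rintro c φ ⟨g, d, hd, h⟩
    refine ⟨c • g, c • d, hd.smul c, fun ψ ψ' hψ => ?_⟩
    rw [real_inner_smul_left, real_inner_smul_left, real_inner_smul_left, ← h ψ ψ' hψ]
    ring

/-- The linearized operator `L : D(L) → L²((0, π/2); dμ)`. -/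
def opL {M : Model} {δ : ℕ} (φ : domL M δ) : L2 M δ := Classical.choose φ.2

theorem isL_iff {M : Model} {δ : ℕ} (φ : domL M δ) (g : L2 M δ) :
    IsL (φ : L2 M δ) g ↔ opL φ = g := by
  have h : IsL (φ : L2 M δ) (opL φ) := Classical.choose_spec φ.2
  exact ⟨fun k => h.unique k, fun k => k ▸ h⟩

/-- The `φ ∈ D(L)` with `∑ ω_n^{2r} (φ | e_n)² < ∞`. -/
def sobolevSubmodule (M : Model) (δ : ℕ) (r : ℝ) : Submodule ℝ (L2 M δ) where
  carrier := {φ | φ ∈ domL M δ ∧ Memℓp (fun n : ℕ => freq M δ n ^ r * coeff n φ) 2}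
  add_mem' := by
    rintro φ₁ φ₂ ⟨h₁, k₁⟩ ⟨h₂, k₂⟩
    refine ⟨(domL M δ).add_mem h₁ h₂, ?_⟩
    convert k₁.add k₂ using 1
    funext n
    simp [coeff, inner_add_right, mul_add]
  zero_mem' := by
    refine ⟨(domL M δ).zero_mem, ?_⟩
    convert zero_memℓp (E := fun _ : ℕ => ℝ) (p := 2) using 1
    funext n
    simp [coeff]
  smul_mem' := by
    rintro c φ ⟨h, k⟩
    refine ⟨(domL M δ).smul_mem c h, ?_⟩
    convert k.const_smul c using 1
    funext n
    simp [coeff, real_inner_smul_right]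
    ring

/-- The Sobolev space `H^r((0, π/2); dμ)`, for `r ≥ 2`. -/
def Sobolev (M : Model) (δ : ℕ) (r : ℝ) : Type := sobolevSubmodule M δ r

instance (M : Model) (δ : ℕ) (r : ℝ) : AddCommGroup (Sobolev M δ r) :=
  inferInstanceAs (AddCommGroup (sobolevSubmodule M δ r))

instance (M : Model) (δ : ℕ) (r : ℝ) : Module ℝ (Sobolev M δ r) :=
  inferInstanceAs (Module ℝ (sobolevSubmodule M δ r))

/-- The inclusion `H^r ⊆ L²`. -/
def Sobolev.toL2 {M : Model} {δ : ℕ} {r : ℝ} (φ : Sobolev M δ r) : L2 M δ := φ.1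

/-- The inclusion `H^r ⊆ D(L)`. -/
def Sobolev.toDom {M : Model} {δ : ℕ} {r : ℝ} (φ : Sobolev M δ r) : domL M δ := ⟨φ.1, φ.2.1⟩

/-- The weighted coefficient sequence `ω_n^r (φ | e_n)`. -/
def Sobolev.toSeq (M : Model) (δ : ℕ) (r : ℝ) :
    Sobolev M δ r →ₗ[ℝ] lp (fun _ : ℕ => ℝ) 2 where
  toFun φ := ⟨fun n : ℕ => freq M δ n ^ r * coeff n φ.toL2, φ.2.2⟩
  map_add' φ ψ := by
    ext n
    change freq M δ n ^ r * coeff n (φ.toL2 + ψ.toL2)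
      = freq M δ n ^ r * coeff n φ.toL2 + freq M δ n ^ r * coeff n ψ.toL2
    simp [coeff, inner_add_right, mul_add]
  map_smul' c φ := by
    ext n
    change freq M δ n ^ r * coeff n (c • φ.toL2) = c * (freq M δ n ^ r * coeff n φ.toL2)
    simp [coeff, real_inner_smul_right]
    ring

/-- The norm of `H^r` is `‖φ‖ = (∑ ω_n^{2r} (φ | e_n)²)^{1/2}`. -/
instance (M : Model) (δ : ℕ) (r : ℝ) : SeminormedAddCommGroup (Sobolev M δ r) :=
  SeminormedAddCommGroup.induced _ _ (Sobolev.toSeq M δ r)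

instance (M : Model) (δ : ℕ) (r : ℝ) : NormedSpace ℝ (Sobolev M δ r) :=
  NormedSpace.induced ℝ _ _ (Sobolev.toSeq M δ r)

/-- The linear flow `Φ^t φ = ∑ (φ | e_n) cos (ω_n t) e_n`. -/
def linFlow {M : Model} {δ : ℕ} (t : ℝ) (φ : L2 M δ) : L2 M δ :=
  ∑' n : ℕ, (coeff n φ * Real.cos (freq M δ n * t)) • eigenmode M δ n

open Classical in
/-- The cubic nonlinearity `f⁽³⁾(φ) = -W φ³`, for those `φ` for which it is in `L²`. -/
def cubic {M : Model} {δ : ℕ} (φ : L2 M δ) : L2 M δ :=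
  if h : MemLp (fun x => -(nlWeight M δ x * φ x ^ 3)) 2 (mu M δ) then h.toLp _ else 0

/-- The averaged nonlinearity `⟨f⁽³⁾⟩`. -/
def avgCubic {M : Model} {δ : ℕ} (φ : L2 M δ) : L2 M δ :=
  (1 / (2 * Real.pi)) • ∫ t in (0 : ℝ)..(2 * Real.pi), linFlow (-t) (cubic (linFlow t φ))

/-- The operator `𝓜(ζ) = L ζ + ⟨f⁽³⁾⟩(ζ)`. -/
def opM {M : Model} {δ : ℕ} {r : ℝ} (ζ : Sobolev M δ r) : L2 M δ :=
  opL ζ.toDom + avgCubic ζ.toL2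

/-- The number `2 ω_0 (2 / (3 C_{0000}))^{1/2}`. -/
def kappa (M : Model) (δ : ℕ) : ℝ :=
  2 * freq M δ 0 * Real.sqrt (2 / (3 * fourierC M δ 0 0 0 0))

end AdS

end

/-! In the variable z = sin² x the modes e_n are multiples of Jacobi polynomials of degree n; in
particular e_0 is constant, and W is a polynomial in z too. Linearizing -Wφ³ along κ cos(ω_0 t) e_0
gives multiplication by -3κ² cos²(ω_0 t) W e_0². Conjugating with the flow and averaging in time
leaves a diagonal operator, for two reasons. The degree of W is smaller than ω_0, so the matrix of W
e_0² in the basis e_n vanishes for |m - n| ≥ ω_0 (`potMatrix_eq_zero`); and for |m - n| < ω_0 the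
time average of cos(ω_m t) cos²(ω_0 t) cos(ω_n t) vanishes unless m = n, where it is 3/8 for m = 0
and 1/4 otherwise (`integral_cos_sq_mul_cos_mul_cos`). Hence d𝓜(ξ) acts on the m-th coefficient as
ω_m² - 3κ² C_{00mm} times 3/8 or 1/4, and κ² = 8ω_0²/(3C_{0000}) gives the stated formulas.

For this to make sense on H^{s+2}, the cube must map D(L) to L². Cauchy-Schwarz for the flux wφ'
bounds φ pointwise by ‖Lφ‖ times a power function `growth` with W · growth³ = w^(-1/2), which lies
in L² (`exists_abs_invL_le`, `abs_triple_le`). All cubic estimates follow from this, and the Taylor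
remainder is quadratic (`norm_cubic_remainder_le`). Differentiation is carried out in the variable g
= Lζ ∈ L². Completeness of the modes (`modeBasis`) and the action of L on coefficients (`coeff_opL`)
are derived from the weak definitions.

The kernel is trivial once ω_m² C_{0000} ≠ 2ω_0² C_{00mm} for all m ≥ 1 (`nonresonance`). The
integrals of z^i (1-z)^j P² are handled by exact differentials (`betaInt_pearson`): the Jacobi
equation yields a three-term virial recurrence for the moments of P² (`virial_succ`). For KG, after
reflection, one parameter is 1/2 and the recurrence has an explicit solution, a sum of terms
decreasing in ω_m² (`momentSum_anti`); this reduces m ≥ 2 to a strict inequality at m = 2. At m = 1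
the two sides change order as δ grows, and it is an integrality argument that excludes equality
(`kg_nonresonance`). For WM the strict inequality 2ω_0² C_{00mm} < ω_m² C_{0000} holds throughout: δ
= 1 and m = 1 are explicit, and for the rest C_{00mm} is split into moments controlled by a ladder
relation and the virial recurrence, plus a remainder bounded by a supremum (`betaInt_wm_nl_le`). -/

noncomputable section

namespace AdS

open Polynomial

/-! ### Jacobi polynomials in the variable `z = (1 - y) / 2` -/

/-- The coefficients of the Jacobi polynomial `P_n^{(a,b)}` in powers of `z = (1 - y) / 2`. -/
def jacobiCoeff (n : ℕ) (a b : ℝ) (k : ℕ) : ℝ :=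
  (-1) ^ k * ((n.choose k : ℝ) * (ascPochhammer ℝ k).eval ((n : ℝ) + a + b + 1)
    * (ascPochhammer ℝ (n - k)).eval (a + (k : ℝ) + 1) / (n.factorial : ℝ))

/-- The Jacobi polynomial `P_n^{(a,b)}` as a polynomial in `z = (1 - y) / 2`. -/
def jacobiPoly (n : ℕ) (a b : ℝ) : ℝ[X] :=
  ∑ k ∈ Finset.range (n + 1), C (jacobiCoeff n a b k) * X ^ k

theorem jacobiP_eq_eval (n : ℕ) (a b y : ℝ) :
    jacobiP n a b y = (jacobiPoly n a b).eval ((1 - y) / 2) := by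
  simp only [jacobiP, jacobiPoly, eval_finsetSum, eval_mul, eval_C, eval_pow, eval_X, jacobiCoeff]
  refine Finset.sum_congr rfl fun k _ => ?_
  rw [show (y - 1) / 2 = -1 * ((1 - y) / 2) by ring, mul_pow]
  ring

theorem jacobiCoeff_eq_zero {n k : ℕ} (h : n < k) (a b : ℝ) : jacobiCoeff n a b k = 0 := by
  simp [jacobiCoeff, Nat.choose_eq_zero_of_lt h]

theorem coeff_jacobiPoly (n : ℕ) (a b : ℝ) (k : ℕ) :
    (jacobiPoly n a b).coeff k = jacobiCoeff n a b k := by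
  simp only [jacobiPoly, finsetSum_coeff, coeff_C_mul, coeff_X_pow, mul_ite, mul_one, mul_zero]
  rw [Finset.sum_ite_eq]
  split_ifs with h
  · rfl
  · rw [jacobiCoeff_eq_zero (by simpa using h)]

theorem ascPochhammer_eval_succ_left (k : ℕ) (x : ℝ) :
    (ascPochhammer ℝ (k + 1)).eval x = x * (ascPochhammer ℝ k).eval (x + 1) := by
  simp [ascPochhammer_succ_left, eval_comp]

/-- The hypergeometric two-term recurrence, which is the Jacobi equation read off coefficientwise.
In cross-multiplied form it needs no condition on a and persists past the degree: the factor k - n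
vanishes at k = n, and both coefficients vanish beyond. -/
theorem jacobiCoeff_succ (n : ℕ) (a b : ℝ) (k : ℕ) :
    ((k : ℝ) + 1) * (a + k + 1) * jacobiCoeff n a b (k + 1)
      = ((k : ℝ) - n) * (n + a + b + 1 + k) * jacobiCoeff n a b k := by
  rcases lt_trichotomy k n with h | h | h
  · obtain ⟨l, rfl⟩ := Nat.exists_eq_add_of_lt h
    have h1 : k + l + 1 - k = l + 1 := by omega
    have h2 : k + l + 1 - (k + 1) = l := by omega
    have h3 := Nat.choose_succ_right_eq (k + l + 1) k
    have h4 : ((k + l + 1).choose (k + 1) : ℝ) * (k + 1)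
        = (k + l + 1).choose k * ((l : ℝ) + 1) := by
      rw [h1] at h3
      exact_mod_cast h3
    simp only [jacobiCoeff, h1, h2, ascPochhammer_succ_eval k, ascPochhammer_eval_succ_left l]
    have h5 : a + ((k + 1 : ℕ) : ℝ) + 1 = a + k + 1 + 1 := by push_cast; ring
    rw [h5, pow_succ]
    push_cast
    linear_combination (-1) ^ k * (-1) * (a + k + 1)
      * ((ascPochhammer ℝ k).eval ((k : ℝ) + l + 1 + a + b + 1) * ((k : ℝ) + l + 1 + a + b + 1 + k))
      * (ascPochhammer ℝ l).eval (a + k + 1 + 1) / ((k + l + 1).factorial : ℝ) * h4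
  · subst h
    rw [jacobiCoeff_eq_zero (Nat.lt_succ_self k)]
    ring
  · rw [jacobiCoeff_eq_zero h, jacobiCoeff_eq_zero (h.trans (Nat.lt_succ_self k))]
    ring

/-- The Jacobi differential equation, as a property of a polynomial. -/
def SolvesJacobi (a b l : ℝ) (P : ℝ[X]) : Prop :=
  X * (1 - X) * derivative (derivative P) + (C (a + 1) - C (a + b + 2) * X) * derivative P
    + C l * P = 0

theorem solvesJacobi_jacobiPoly (n : ℕ) (a b : ℝ) :
    SolvesJacobi a b (n * (n + a + b + 1)) (jacobiPoly n a b) := by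
  unfold SolvesJacobi
  have e : X * (1 - X) * derivative (derivative (jacobiPoly n a b))
      + (C (a + 1) - C (a + b + 2) * X) * derivative (jacobiPoly n a b)
      + C (n * (n + a + b + 1)) * jacobiPoly n a b
      = X * derivative (derivative (jacobiPoly n a b))
        - X * (X * derivative (derivative (jacobiPoly n a b)))
        + C (a + 1) * derivative (jacobiPoly n a b)
        - C (a + b + 2) * (X * derivative (jacobiPoly n a b))
        + C (n * (n + a + b + 1)) * jacobiPoly n a b := by ring
  rw [e]
  ext k
  have hk := jacobiCoeff_succ n a b k
  rcases k with _ | _ | k <;>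
    simp only [coeff_add, coeff_sub, coeff_X_mul, coeff_X_mul_zero, coeff_C_mul, coeff_derivative,
      coeff_jacobiPoly, coeff_zero] <;> push_cast at hk ⊢ <;>
    linear_combination hk

theorem derivative_jacobiPoly (n : ℕ) (a b : ℝ) :
    derivative (jacobiPoly (n + 1) a b) = C (-(n + a + b + 2)) * jacobiPoly n (a + 1) (b + 1) := by
  ext k
  rw [coeff_derivative, coeff_C_mul, coeff_jacobiPoly, coeff_jacobiPoly]
  simp only [jacobiCoeff]
  rw [ascPochhammer_eval_succ_left, Nat.succ_sub_succ, Nat.factorial_succ]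
  have h1 : ((n + 1).choose (k + 1) : ℝ) * (k + 1) = (n + 1) * n.choose k := by
    exact_mod_cast (Nat.add_one_mul_choose_eq n k).symm
  have h2 : ((n + 1 : ℕ) : ℝ) + a + b + 1 + 1 = n + (a + 1) + (b + 1) + 1 := by push_cast; ring
  have h3 : a + ((k + 1 : ℕ) : ℝ) + 1 = a + 1 + k + 1 := by push_cast; ring
  rw [h2, h3]
  have hf : (n.factorial : ℝ) ≠ 0 := by positivity
  push_cast
  field_simp
  rw [pow_succ]
  linear_combination (-1) ^ k * (-1) * (n + a + b + 2)
    * (ascPochhammer ℝ k).eval (n + (a + 1) + (b + 1) + 1)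
    * (ascPochhammer ℝ (n - k)).eval (a + 1 + k + 1) * h1

/-- A contiguous relation, lowering a and raising b. On the coefficient of z^k it is multiplication
by k + a, which is absorbed by the rising factorial of a. It is one half of the first-order system
behind the wave map ladder. -/
theorem X_mul_derivative_jacobiPoly (n : ℕ) (a b : ℝ) :
    X * derivative (jacobiPoly n a b) + C a * jacobiPoly n a b
      = C (n + a) * jacobiPoly n (a - 1) (b + 1) := by
  have key : ∀ k : ℕ, ((k : ℝ) + a) * jacobiCoeff n a b k
      = (n + a) * jacobiCoeff n (a - 1) (b + 1) k := by
    intro k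
    rcases lt_or_ge n k with h | h
    · simp [jacobiCoeff_eq_zero h]
    · obtain ⟨l, rfl⟩ := Nat.exists_eq_add_of_le h
      have h1 : k + l - k = l := by omega
      simp only [jacobiCoeff, h1]
      have h2 := ascPochhammer_eval_succ_left l (a + k)
      rw [ascPochhammer_succ_eval] at h2
      have h3 : a - 1 + (k : ℝ) + 1 = a + k := by ring
      have h4 : ((k + l : ℕ) : ℝ) + (a - 1) + (b + 1) + 1 = (k + l : ℕ) + a + b + 1 := by ring
      rw [h3, h4]
      push_cast
      linear_combination (-1) ^ k * (((k + l).choose k : ℝ)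
        * (ascPochhammer ℝ k).eval ((k : ℝ) + l + a + b + 1) / ((k + l).factorial : ℝ)) * (-h2)
  ext k
  have hk := key k
  rcases k with _ | k <;>
    simp only [coeff_add, coeff_X_mul, coeff_X_mul_zero, coeff_C_mul, coeff_derivative,
      coeff_jacobiPoly] <;> push_cast at hk ⊢ <;> linear_combination hk

theorem natDegree_jacobiPoly_le (n : ℕ) (a b : ℝ) : (jacobiPoly n a b).natDegree ≤ n := by
  refine natDegree_le_iff_coeff_eq_zero.2 fun k hk => ?_
  rw [coeff_jacobiPoly, jacobiCoeff_eq_zero hk]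

theorem coeff_self_jacobiPoly_ne_zero (n : ℕ) {a b : ℝ} (h : 0 < a + b + 1) :
    (jacobiPoly n a b).coeff n ≠ 0 := by
  have := ascPochhammer_pos n ((n : ℝ) + a + b + 1)
    (by have := Nat.cast_nonneg (α := ℝ) n; linarith)
  rw [coeff_jacobiPoly]
  simp [jacobiCoeff, this.ne', Nat.factorial_ne_zero]

theorem natDegree_jacobiPoly (n : ℕ) {a b : ℝ} (h : 0 < a + b + 1) :
    (jacobiPoly n a b).natDegree = n :=
  le_antisymm (natDegree_jacobiPoly_le n a b)
    (le_natDegree_of_ne_zero (coeff_self_jacobiPoly_ne_zero n h))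

@[simp] theorem jacobiPoly_zero (a b : ℝ) : jacobiPoly 0 a b = 1 := by
  simp [jacobiPoly, jacobiCoeff]

theorem jacobiPoly_one (a b : ℝ) : jacobiPoly 1 a b = C (a + 1) - C (a + b + 2) * X := by
  simp [jacobiPoly, jacobiCoeff, Finset.sum_range_succ]
  rw [show (C 2 : ℝ[X]) = 2 from rfl]
  ring

/-- The substitution z ↦ 1 - z exchanges the two endpoints. In the Klein-Gordon model it turns
powers of cos² into powers of z and moves the parameter 1/2 to the second place. -/
theorem SolvesJacobi.comp_one_sub {a b l : ℝ} {P : ℝ[X]} (h : SolvesJacobi a b l P) :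
    SolvesJacobi b a l (P.comp (1 - X)) := by
  have h' := congrArg (fun Q : ℝ[X] => Q.comp (1 - X)) h
  simp only [add_comp, mul_comp, X_comp, sub_comp, one_comp, C_comp, zero_comp] at h'
  unfold SolvesJacobi
  simp only [derivative_comp, derivative_sub, derivative_one, derivative_X, derivative_mul,
    derivative_neg, zero_sub]
  simp only [C_add, map_one, map_ofNat] at h' ⊢
  linear_combination h'

/-! ### Moment functionals -/

theorem continuous_betaIntegrand (A B : ℕ) (P : ℝ[X]) :
    Continuous fun x : ℝ => Real.sin x ^ A * Real.cos x ^ B * P.eval (Real.sin x ^ 2) := by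
  fun_prop

/-- The functional `P ↦ ∫_0^{π/2} sin^A x cos^B x P(sin² x) dx`. -/
def betaInt (A B : ℕ) : ℝ[X] →ₗ[ℝ] ℝ where
  toFun P := ∫ x in (0 : ℝ)..(Real.pi / 2),
    Real.sin x ^ A * Real.cos x ^ B * P.eval (Real.sin x ^ 2)
  map_add' P Q := by
    rw [← intervalIntegral.integral_add ((continuous_betaIntegrand A B P).intervalIntegrable _ _)
      ((continuous_betaIntegrand A B Q).intervalIntegrable _ _)]
    simp only [eval_add, mul_add]
  map_smul' c P := by
    simp only [RingHom.id_apply, smul_eq_mul]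
    rw [← intervalIntegral.integral_const_mul]
    simp only [eval_smul, smul_eq_mul]
    congr 1
    funext x
    ring

theorem betaInt_apply (A B : ℕ) (P : ℝ[X]) : betaInt A B P = ∫ x in (0 : ℝ)..(Real.pi / 2),
    Real.sin x ^ A * Real.cos x ^ B * P.eval (Real.sin x ^ 2) := rfl

theorem betaInt_C_mul (A B : ℕ) (c : ℝ) (P : ℝ[X]) : betaInt A B (C c * P) = c * betaInt A B P := by
  rw [← smul_eq_C_mul, map_smul, smul_eq_mul]

theorem betaInt_X_mul (A B : ℕ) (P : ℝ[X]) : betaInt A B (X * P) = betaInt (A + 2) B P := by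
  simp only [betaInt_apply, eval_mul, eval_X]
  congr 1
  funext x
  ring

theorem betaInt_X_pow_mul (A B k : ℕ) (P : ℝ[X]) :
    betaInt A B (X ^ k * P) = betaInt (A + 2 * k) B P := by
  simp only [betaInt_apply, eval_mul, eval_pow, eval_X]
  congr 1
  funext x
  ring

theorem betaInt_one_sub_X_mul (A B : ℕ) (P : ℝ[X]) :
    betaInt A B ((1 - X) * P) = betaInt A (B + 2) P := by
  simp only [betaInt_apply, eval_mul, eval_X, eval_sub, eval_one]
  congr 1
  funext x
  rw [← Real.cos_sq']
  ring

theorem betaInt_one_sub_X_pow_mul (A B k : ℕ) (P : ℝ[X]) :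
    betaInt A B ((1 - X) ^ k * P) = betaInt A (B + 2 * k) P := by
  simp only [betaInt_apply, eval_mul, eval_pow, eval_X, eval_sub, eval_one]
  congr 1
  funext x
  rw [← Real.cos_sq']
  ring

theorem betaInt_comp_one_sub (A B : ℕ) (P : ℝ[X]) :
    betaInt A B (P.comp (1 - X)) = betaInt B A P := by
  simp only [betaInt_apply, eval_comp, eval_sub, eval_one, eval_X]
  have h := intervalIntegral.integral_comp_sub_left (a := 0) (b := Real.pi / 2)
    (fun x => Real.sin x ^ B * Real.cos x ^ A * P.eval (Real.sin x ^ 2)) (Real.pi / 2)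
  rw [sub_self, sub_zero] at h
  rw [← h]
  congr 1
  funext x
  rw [Real.sin_pi_div_two_sub, Real.cos_pi_div_two_sub, ← Real.cos_sq']
  ring

theorem betaInt_mono (A B : ℕ) {P Q : ℝ[X]}
    (h : ∀ z : ℝ, 0 ≤ z → z ≤ 1 → P.eval z ≤ Q.eval z) : betaInt A B P ≤ betaInt A B Q := by
  refine intervalIntegral.integral_mono_on (by positivity)
    ((continuous_betaIntegrand A B P).intervalIntegrable _ _)
    ((continuous_betaIntegrand A B Q).intervalIntegrable _ _) fun x hx => ?_
  have h1 : 0 ≤ Real.sin x := Real.sin_nonneg_of_nonneg_of_le_pi hx.1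
    (by linarith [hx.2, Real.pi_pos])
  have h2 : 0 ≤ Real.cos x := Real.cos_nonneg_of_neg_pi_div_two_le_of_le
    (by linarith [hx.1, Real.pi_pos]) hx.2
  exact mul_le_mul_of_nonneg_left (h _ (sq_nonneg _) (Real.sin_sq_le_one x)) (by positivity)

theorem betaInt_nonneg (A B : ℕ) {P : ℝ[X]} (h : ∀ z : ℝ, 0 ≤ z → z ≤ 1 → 0 ≤ P.eval z) :
    0 ≤ betaInt A B P := by
  have := betaInt_mono A B (P := 0) (Q := P) (by simpa using h)
  simpa using this

/-- One extra power of sin and of cos makes the primitive vanish at both endpoints while its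
derivative is again the weight times a polynomial in sin². Every integral identity below comes from
a choice of G. -/
theorem hasDerivAt_sin_cos_eval (A B : ℕ) (G : ℝ[X]) (x : ℝ) : HasDerivAt
    (fun x : ℝ => Real.sin x ^ (A + 1) * Real.cos x ^ (B + 1) * G.eval (Real.sin x ^ 2))
    (Real.sin x ^ A * Real.cos x ^ B * ((C ((A : ℝ) + 1) * (1 - X) - C ((B : ℝ) + 1) * X) * G
      + 2 * X * (1 - X) * derivative G).eval (Real.sin x ^ 2)) x := by
  have h1 := (Real.hasDerivAt_sin x).pow (A + 1)
  have h2 := (Real.hasDerivAt_cos x).pow (B + 1)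
  have h3 := (G.hasDerivAt (Real.sin x ^ 2)).comp x ((Real.hasDerivAt_sin x).pow 2)
  refine ((h1.mul h2).mul h3).congr_deriv ?_
  simp only [eval_add, eval_mul, eval_sub, eval_C, eval_one, eval_X, eval_ofNat, ← Real.cos_sq',
    Pi.mul_apply, Pi.pow_apply, Function.comp_apply, add_tsub_cancel_right]
  push_cast
  ring

/-- The Pearson relation of the weight `sin^A cos^B`. -/
theorem betaInt_pearson (A B : ℕ) (G : ℝ[X]) :
    betaInt A B ((C ((A : ℝ) + 1) * (1 - X) - C ((B : ℝ) + 1) * X) * G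
      + 2 * X * (1 - X) * derivative G) = 0 := by
  rw [betaInt_apply, intervalIntegral.integral_eq_sub_of_hasDerivAt
    (fun x _ => hasDerivAt_sin_cos_eval A B G x)
    ((continuous_betaIntegrand A B _).intervalIntegrable _ _)]
  simp

theorem betaInt_one_recurrence (A B : ℕ) :
    ((A : ℝ) + B + 2) * betaInt (A + 2) B 1 = (A + 1) * betaInt A B 1 := by
  have h := betaInt_pearson A B 1
  rw [show (C ((A : ℝ) + 1) * (1 - X) - C ((B : ℝ) + 1) * X) * 1 + 2 * X * (1 - X) * derivative 1
    = C ((A : ℝ) + 1) * 1 - C ((A : ℝ) + B + 2) * (X * (1 : ℝ[X])) by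
      simp only [derivative_one, C_add, map_ofNat, map_one]; ring,
    map_sub, betaInt_C_mul, betaInt_C_mul, betaInt_X_mul] at h
  linarith

theorem betaInt_one_symm (A B : ℕ) : betaInt A B 1 = betaInt B A 1 := by
  simpa using betaInt_comp_one_sub A B 1

/-- The Beta integral. The Pearson recurrence raises an exponent by two, the reflection exchanges
the exponents, and four base cases with exponents 0 or 1 remain. -/
theorem betaInt_one (A B : ℕ) : betaInt A B 1
    = Real.Gamma (((A : ℝ) + 1) / 2) * Real.Gamma (((B : ℝ) + 1) / 2)
      / (2 * Real.Gamma (((A : ℝ) + B) / 2 + 1)) := by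
  have hg := Real.Gamma_one_half_eq
  have hp := Real.sqrt_pos.2 Real.pi_pos
  have hg' : Real.Gamma (1 / 2 + 1) = 1 / 2 * Real.sqrt Real.pi := by
    rw [Real.Gamma_add_one (by norm_num), hg]
  have step : ∀ A B : ℕ, betaInt A B 1
      = Real.Gamma (((A : ℝ) + 1) / 2) * Real.Gamma (((B : ℝ) + 1) / 2)
        / (2 * Real.Gamma (((A : ℝ) + B) / 2 + 1)) →
      betaInt (A + 2) B 1
      = Real.Gamma ((((A + 2 : ℕ) : ℝ) + 1) / 2) * Real.Gamma (((B : ℝ) + 1) / 2)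
        / (2 * Real.Gamma ((((A + 2 : ℕ) : ℝ) + B) / 2 + 1)) := by
    intro A B h
    have h1 := betaInt_one_recurrence A B
    rw [h] at h1
    have e1 : (((A + 2 : ℕ) : ℝ) + 1) / 2 = ((A : ℝ) + 1) / 2 + 1 := by push_cast; ring
    have e2 : (((A + 2 : ℕ) : ℝ) + B) / 2 + 1 = (((A : ℝ) + B) / 2 + 1) + 1 := by push_cast; ring
    have p1 : (0 : ℝ) < ((A : ℝ) + 1) / 2 := by positivity
    have p2 : (0 : ℝ) < ((A : ℝ) + B) / 2 + 1 := by positivity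
    have p3 := Real.Gamma_pos_of_pos p2
    rw [e1, e2, Real.Gamma_add_one p1.ne', Real.Gamma_add_one p2.ne']
    have p4 : (0 : ℝ) < (A : ℝ) + B + 2 := by positivity
    field_simp
    field_simp at h1
    linear_combination h1
  have base : ∀ A B : ℕ, A ≤ 1 → B ≤ 1 → betaInt A B 1
      = Real.Gamma (((A : ℝ) + 1) / 2) * Real.Gamma (((B : ℝ) + 1) / 2)
        / (2 * Real.Gamma (((A : ℝ) + B) / 2 + 1)) := by
    intro A B hA hB
    interval_cases A <;> interval_cases B <;> simp only [betaInt_apply, eval_one, mul_one, pow_zero,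
      pow_one, one_mul, Nat.cast_zero, Nat.cast_one, zero_add, add_zero]
    · rw [hg, zero_div, zero_add, Real.Gamma_one]
      simp [← pow_two, Real.sq_sqrt Real.pi_pos.le]
    · rw [hg, hg', show ((1 : ℝ) + 1) / 2 = 1 by norm_num, Real.Gamma_one]
      simp
      field_simp
    · rw [hg, hg', show ((1 : ℝ) + 1) / 2 = 1 by norm_num, Real.Gamma_one]
      simp
      field_simp
    · rw [show ((1 : ℝ) + 1) / 2 = 1 by norm_num, show (1 : ℝ) + 1 = 2 by norm_num,
        Real.Gamma_two, Real.Gamma_one, integral_sin_mul_cos₁]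
      simp
  have main : ∀ k A B : ℕ, A + B ≤ k → betaInt A B 1
      = Real.Gamma (((A : ℝ) + 1) / 2) * Real.Gamma (((B : ℝ) + 1) / 2)
        / (2 * Real.Gamma (((A : ℝ) + B) / 2 + 1)) := by
    intro k
    induction k with
    | zero => intro A B h; exact base A B (by omega) (by omega)
    | succ k ih =>
      intro A B h
      by_cases hA : 2 ≤ A
      · obtain ⟨A, rfl⟩ := Nat.exists_eq_add_of_le' hA
        exact step A B (ih A B (by omega))
      · by_cases hB : 2 ≤ B
        · obtain ⟨B, rfl⟩ := Nat.exists_eq_add_of_le' hB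
          have := step B A (ih B A (by omega))
          rw [betaInt_one_symm, this, add_comm (A : ℝ) ((B + 2 : ℕ) : ℝ)]
          ring
        · exact base A B (by omega) (by omega)
  exact main _ A B le_rfl

/-! ### Consequences of the Jacobi differential equation -/

section ODE

variable {A B : ℕ} {a b : ℝ} (hA : (A : ℝ) = 2 * a + 1) (hB : (B : ℝ) = 2 * b + 1)
include hA hB

/-- The usual Wronskian argument: the exact differential built from P'Q - PQ' equals a multiple of
(l' - l)PQ. -/
theorem betaInt_mul_eq_zero {l l' : ℝ} {P Q : ℝ[X]} (hP : SolvesJacobi a b l P)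
    (hQ : SolvesJacobi a b l' Q) (hl : l ≠ l') : betaInt A B (P * Q) = 0 := by
  have h := betaInt_pearson A B (derivative P * Q - P * derivative Q)
  unfold SolvesJacobi at hP hQ
  have e : (C ((A : ℝ) + 1) * (1 - X) - C ((B : ℝ) + 1) * X) * (derivative P * Q - P * derivative Q)
      + 2 * X * (1 - X) * derivative (derivative P * Q - P * derivative Q)
      = C (2 * (l' - l)) * (P * Q) := by
    simp only [hA, hB, derivative_sub, derivative_mul, C_add, C_mul, C_sub, map_ofNat, map_one]
      at hP hQ ⊢
    linear_combination 2 * Q * hP - 2 * P * hQ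
  rw [e, betaInt_C_mul] at h
  exact (mul_eq_zero.1 h).resolve_left (mul_ne_zero two_ne_zero (sub_ne_zero.2 hl.symm))

theorem betaInt_derivative_sq {l : ℝ} {P : ℝ[X]} (hP : SolvesJacobi a b l P) :
    betaInt (A + 2) (B + 2) (derivative P * derivative P) = l * betaInt A B (P * P) := by
  have h := betaInt_pearson A B (P * derivative P)
  unfold SolvesJacobi at hP
  have e : (C ((A : ℝ) + 1) * (1 - X) - C ((B : ℝ) + 1) * X) * (P * derivative P)
      + 2 * X * (1 - X) * derivative (P * derivative P)
      = C 2 * (X * ((1 - X) * (derivative P * derivative P))) - C (2 * l) * (P * P) := by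
    simp only [hA, hB, derivative_mul, C_add, C_mul, map_ofNat, map_one] at hP ⊢
    linear_combination 2 * P * hP
  rw [e, map_sub, betaInt_C_mul, betaInt_C_mul, betaInt_X_mul, betaInt_one_sub_X_mul] at h
  linarith

/-- The virial identity for the first moment of the square of a solution. -/
theorem virial_zero {l : ℝ} {P : ℝ[X]} (hP : SolvesJacobi a b l P) {E : ℝ}
    (hE : E = 4 * l + (a + b + 1) ^ 2) :
    2 * (E - 1) * betaInt A B (X * (P * P)) = (E - 1 + a ^ 2 - b ^ 2) * betaInt A B (P * P) := by
  -- The quadratic form in P and P' is chosen so that, once P'' is eliminated by the Jacobi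
  -- equation, the terms PP' and P'² cancel and only moments of P² survive.
  have h := betaInt_pearson A B (C (8 * l + 4 * (a + b)) * (P * P)
    + 2 * (C (4 * a) - C (4 * (a + b)) * X) * (P * derivative P)
    + 8 * X * (1 - X) * (derivative P * derivative P))
  unfold SolvesJacobi at hP
  have e : (C ((A : ℝ) + 1) * (1 - X) - C ((B : ℝ) + 1) * X) * (C (8 * l + 4 * (a + b)) * (P * P)
    + 2 * (C (4 * a) - C (4 * (a + b)) * X) * (P * derivative P)
    + 8 * X * (1 - X) * (derivative P * derivative P))
      + 2 * X * (1 - X) * derivative (C (8 * l + 4 * (a + b)) * (P * P)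
    + 2 * (C (4 * a) - C (4 * (a + b)) * X) * (P * derivative P)
    + 8 * X * (1 - X) * (derivative P * derivative P))
      = C (4 * (E - 1 + a ^ 2 - b ^ 2)) * (P * P) - C (8 * (E - 1)) * (X * (P * P)) := by
    rw [hE]
    simp only [hA, hB, derivative_mul, derivative_add, derivative_sub, derivative_C, derivative_X,
      derivative_one, derivative_ofNat, C_add, C_mul, C_sub, C_pow, map_ofNat, map_one] at hP ⊢
    linear_combination (4 * (4 * C a - 4 * (C a + C b) * X) * P + 32 * X * (1 - X) * derivative P) * hP
  rw [e, map_sub, betaInt_C_mul, betaInt_C_mul] at h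
  linarith

/-- The virial recurrence for the moments of the square of a solution. -/
theorem virial_succ {l : ℝ} {P : ℝ[X]} (hP : SolvesJacobi a b l P) {E : ℝ}
    (hE : E = 4 * l + (a + b + 1) ^ 2) (J : ℕ) :
    2 * ((J : ℝ) + 2) * (E - (J + 2) ^ 2) * betaInt A B (X ^ (J + 2) * (P * P))
      = (2 * J + 3) * (E - (J + 1) ^ 2 - (J + 2) ^ 2 + a ^ 2 - b ^ 2)
          * betaInt A B (X ^ (J + 1) * (P * P))
        - 2 * (J + 1) * (a ^ 2 - (J + 1) ^ 2) * betaInt A B (X ^ J * (P * P)) := by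
  set s : ℝ := a + b - (J + 1) with hs
  -- Same principle as in `virial_zero`, now with a factor z^J in front: the coefficients are those
  -- for which PP' and P'² drop out.
  set G : ℝ[X] := (C (4 * (J + 1) * (J + 1 - a)) + C (8 * l + 4 * (J + 2) * s) * X) * (P * P)
    + 2 * X * (C (4 * (a - (J + 1))) - C (4 * s) * X) * (P * derivative P)
    + 8 * X ^ 2 * (1 - X) * (derivative P * derivative P) with hG
  have h := betaInt_pearson A B (X ^ J * G)
  -- Differentiating z^J only shifts the exponent A to A + 2J. The case J = 0 is separate because of
  -- the exponent J - 1.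
  have e1 : (C ((A : ℝ) + 1) * (1 - X) - C ((B : ℝ) + 1) * X) * (X ^ J * G)
      + 2 * X * (1 - X) * derivative (X ^ J * G)
      = X ^ J * ((C ((A : ℝ) + 1 + 2 * J) * (1 - X) - C ((B : ℝ) + 1) * X) * G
        + 2 * X * (1 - X) * derivative G) := by
    rw [derivative_mul, derivative_X_pow]
    rcases J with _ | J
    · simp
    · simp only [Nat.add_sub_cancel, C_add, C_mul, map_ofNat, map_natCast]
      ring
  have e2 : (C ((A : ℝ) + 1 + 2 * J) * (1 - X) - C ((B : ℝ) + 1) * X) * G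
        + 2 * X * (1 - X) * derivative G
      = C (8 * (J + 1) * ((J + 1) ^ 2 - a ^ 2)) * (P * P)
        + C (4 * (2 * J + 3) * (E - (J + 1) ^ 2 - (J + 2) ^ 2 + a ^ 2 - b ^ 2)) * (X * (P * P))
        - C (8 * (J + 2) * (E - (J + 2) ^ 2)) * (X ^ 2 * (P * P)) := by
    unfold SolvesJacobi at hP
    rw [hE, hG, hs]
    simp only [hA, hB, derivative_mul, derivative_add, derivative_sub, derivative_C, derivative_X,
      derivative_one, derivative_ofNat, derivative_X_pow, C_add, C_mul, C_sub, C_pow, map_ofNat,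
      map_one, map_natCast, derivative_natCast] at hP ⊢
    push_cast
    linear_combination (4 * X * (4 * (C a - ((J : ℝ[X]) + 1))
      - 4 * (C a + C b - ((J : ℝ[X]) + 1)) * X) * P + 32 * X ^ 2 * (1 - X) * derivative P) * hP
  rw [e1, e2] at h
  have e3 : X ^ J * (C (8 * ((J : ℝ) + 1) * ((J + 1) ^ 2 - a ^ 2)) * (P * P)
        + C (4 * (2 * (J : ℝ) + 3) * (E - (J + 1) ^ 2 - (J + 2) ^ 2 + a ^ 2 - b ^ 2)) * (X * (P * P))
        - C (8 * ((J : ℝ) + 2) * (E - (J + 2) ^ 2)) * (X ^ 2 * (P * P)))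
      = C (8 * ((J : ℝ) + 1) * ((J + 1) ^ 2 - a ^ 2)) * (X ^ J * (P * P))
        + C (4 * (2 * (J : ℝ) + 3) * (E - (J + 1) ^ 2 - (J + 2) ^ 2 + a ^ 2 - b ^ 2))
          * (X ^ (J + 1) * (P * P))
        - C (8 * ((J : ℝ) + 2) * (E - (J + 2) ^ 2)) * (X ^ (J + 2) * (P * P)) := by
    ring
  rw [e3, map_sub, map_add, betaInt_C_mul, betaInt_C_mul, betaInt_C_mul] at h
  linarith

end ODE

/-- Induction on the degree: P_{n+1}' is a multiple of the polynomial of degree n with both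
parameters raised by one, and `betaInt_derivative_sq` relates the two norms. Since A + B = 2(a + b +
1), the assumption on A + B makes the division by n + a + b + 1 legitimate at n = 0. -/
theorem betaInt_jacobiPoly_sq (n A B : ℕ) {a b : ℝ} (hA : (A : ℝ) = 2 * a + 1)
    (hB : (B : ℝ) = 2 * b + 1) (hAB : 0 < A + B) :
    betaInt A B (jacobiPoly n a b * jacobiPoly n a b)
      = Real.Gamma (n + a + 1) * Real.Gamma (n + b + 1)
        / (2 * n.factorial * (2 * n + a + b + 1) * Real.Gamma (n + a + b + 1)) := by
  induction n generalizing A B a b with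
  | zero =>
    have hp : 0 < a + b + 1 := by
      have : (0 : ℝ) < A + B := by exact_mod_cast hAB
      linarith
    rw [jacobiPoly_zero, mul_one, betaInt_one, show ((A : ℝ) + 1) / 2 = a + 1 by rw [hA]; ring,
      show ((B : ℝ) + 1) / 2 = b + 1 by rw [hB]; ring,
      show ((A : ℝ) + B) / 2 + 1 = (a + b + 1) + 1 by rw [hA, hB]; ring,
      Real.Gamma_add_one hp.ne']
    simp
    ring_nf
  | succ n ih =>
    have hp : 0 < a + b + 1 := by
      have : (0 : ℝ) < A + B := by exact_mod_cast hAB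
      linarith
    have h := betaInt_derivative_sq hA hB (solvesJacobi_jacobiPoly (n + 1) a b)
    rw [derivative_jacobiPoly, mul_mul_mul_comm, ← C_mul, betaInt_C_mul,
      ih (A + 2) (B + 2) (a := a + 1) (b := b + 1) (by push_cast; linarith)
        (by push_cast; linarith) (by omega)] at h
    have hn : (0 : ℝ) ≤ n := n.cast_nonneg
    have q1 : (n : ℝ) + (a + 1) + (b + 1) + 1 = (n + a + b + 2) + 1 := by ring
    rw [q1, Real.Gamma_add_one (s := (n : ℝ) + a + b + 2) (by linarith)] at h
    have q2 : ((n + 1 : ℕ) : ℝ) + a + b + 1 = n + a + b + 2 := by push_cast; ring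
    have q3 : ((n + 1 : ℕ) : ℝ) + a + 1 = n + (a + 1) + 1 := by push_cast; ring
    have q4 : ((n + 1 : ℕ) : ℝ) + b + 1 = n + (b + 1) + 1 := by push_cast; ring
    have q5 : 2 * ((n + 1 : ℕ) : ℝ) + a + b + 1 = 2 * n + (a + 1) + (b + 1) + 1 := by
      push_cast; ring
    rw [q2, q3, q4, q5, Nat.factorial_succ]
    rw [q2] at h
    have g1 : 0 < Real.Gamma (n + a + b + 2) := Real.Gamma_pos_of_pos (by linarith)
    have g2 : (0 : ℝ) < n + a + b + 2 := by linarith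
    have g3 : (0 : ℝ) < 2 * n + (a + 1) + (b + 1) + 1 := by linarith
    have g4 : (0 : ℝ) < n.factorial := by positivity
    push_cast at h ⊢
    generalize betaInt A B (jacobiPoly (n + 1) a b * jacobiPoly (n + 1) a b) = T at h ⊢
    generalize Real.Gamma ((n : ℝ) + (a + 1) + 1) = u at h ⊢
    generalize Real.Gamma ((n : ℝ) + (b + 1) + 1) = v at h ⊢
    generalize Real.Gamma ((n : ℝ) + a + b + 2) = w at h g1 ⊢
    generalize hd : 2 * (n : ℝ) + (a + 1) + (b + 1) + 1 = d at h g3 ⊢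
    generalize hc : (n : ℝ) + a + b + 2 = c at h g2
    have h' : c * (u * v) = 2 * n.factorial * d * w * ((n + 1) * c * T) := by
      rw [← h]
      field_simp
    rw [eq_div_iff (by positivity)]
    refine mul_left_cancel₀ g2.ne' ?_
    linear_combination -h'

/-! ### Moments of squares for `b = 1/2` -/

/-- The normalized central binomial coefficients `(2k choose k) / 4^k`. -/
def centralCoeff (k : ℕ) : ℝ := (k.centralBinom : ℝ) / 4 ^ k

theorem centralCoeff_pos (k : ℕ) : 0 < centralCoeff k := by
  have := Nat.centralBinom_pos k
  unfold centralCoeff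
  positivity

theorem centralCoeff_zero : centralCoeff 0 = 1 := by simp [centralCoeff]

theorem centralCoeff_succ (k : ℕ) :
    centralCoeff (k + 1) = (2 * k + 1) / (2 * k + 2) * centralCoeff k := by
  have h : ((k : ℝ) + 1) * (k + 1).centralBinom = 2 * (2 * k + 1) * k.centralBinom := by
    exact_mod_cast Nat.succ_mul_centralBinom_succ k
  have h1 : (k : ℝ) + 1 ≠ 0 := by positivity
  unfold centralCoeff
  rw [pow_succ]
  field_simp
  linear_combination 2 * h

/-- The basic decreasing functions of `E` in terms of which the moments are expanded. -/
def momentFactor (a E : ℝ) (k : ℕ) : ℝ :=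
  ∏ i ∈ Finset.range k, (a ^ 2 - (i + 1 / 2) ^ 2) / (E - (i + 1) ^ 2)

/-- The expansion of the normalized moment of order `J`. -/
def momentSum (a E : ℝ) (J : ℕ) : ℝ :=
  ∑ k ∈ Finset.range (J + 1), centralCoeff k * centralCoeff (J - k) * momentFactor a E k

/-- The coefficients of `momentSum`, extended by zero. -/
def momentCoeff (J k : ℕ) : ℝ := if k ≤ J then centralCoeff k * centralCoeff (J - k) else 0

theorem momentSum_eq (a E : ℝ) {J N : ℕ} (h : J < N) :
    momentSum a E J = ∑ k ∈ Finset.range N, momentCoeff J k * momentFactor a E k := by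
  unfold momentSum
  rw [← Finset.sum_subset (Finset.range_subset_range.2 h)]
  · refine Finset.sum_congr rfl fun k hk => ?_
    rw [momentCoeff, if_pos (Nat.lt_succ_iff.1 (Finset.mem_range.1 hk))]
  · intro k _ hk
    rw [momentCoeff, if_neg (fun h' => hk (Finset.mem_range.2 (Nat.lt_succ_iff.2 h'))), zero_mul]

/-- The coefficient of `momentFactor a E k` in the virial recurrence for b = 1/2, after E has been
eliminated. For k ≤ J all central coefficients reduce to two of them by `centralCoeff_succ`; at k =
J + 1 and k = J + 2 some of the terms are absent. -/
theorem momentCoeff_identity (a : ℝ) (J k : ℕ) (hk : k < J + 3) :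
    (2 * ((J : ℝ) + 2) * momentCoeff (J + 2) k - (2 * J + 3) * momentCoeff (J + 1) k) * k ^ 2
    + (2 * ((J : ℝ) + 2) * momentCoeff (J + 2) (k + 1) - (2 * J + 3) * momentCoeff (J + 1) (k + 1))
      * (a ^ 2 - (k + 1 / 2) ^ 2)
    - 2 * ((J : ℝ) + 2) * (J + 2) ^ 2 * momentCoeff (J + 2) k
    + (2 * (J : ℝ) + 3) * ((J + 1) ^ 2 + (J + 2) ^ 2 - a ^ 2 + (1 / 2) ^ 2) * momentCoeff (J + 1) k
    + 2 * ((J : ℝ) + 1) * (a ^ 2 - (J + 1) ^ 2) * momentCoeff J k = 0 := by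
  unfold momentCoeff
  have h1 : (k : ℝ) + 1 ≠ 0 := by positivity
  rcases Nat.lt_or_ge J k with h | h
  · rcases Nat.lt_or_ge (J + 1) k with h' | h'
    · obtain rfl : k = J + 2 := by omega
      rw [if_pos le_rfl, if_neg (by omega), if_neg (by omega), if_neg (by omega), if_neg (by omega)]
      push_cast
      ring
    · obtain rfl : k = J + 1 := by omega
      rw [if_pos (by omega), if_pos le_rfl, if_pos le_rfl, if_neg (by omega), if_neg (by omega),
        show J + 2 - (J + 1) = 1 by omega, Nat.sub_self, show J + 2 - (J + 1 + 1) = 0 by omega,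
        show J + 1 + 1 = (J + 1) + 1 from rfl, centralCoeff_succ (J + 1), centralCoeff_succ 0,
        centralCoeff_zero]
      push_cast at h1 ⊢
      have h2 : (J : ℝ) + 2 ≠ 0 := by positivity
      have h3 : (J : ℝ) + 1 + 1 ≠ 0 := by positivity
      field_simp
      ring
  · obtain ⟨l, rfl⟩ := Nat.exists_eq_add_of_le h
    rw [if_pos (by omega), if_pos (by omega), if_pos (by omega), if_pos (by omega),
      if_pos (by omega), show k + l + 2 - k = l + 2 by omega, show k + l + 1 - k = l + 1 by omega,
      show k + l + 2 - (k + 1) = l + 1 by omega, show k + l + 1 - (k + 1) = l by omega,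
      show k + l - k = l by omega, centralCoeff_succ k, centralCoeff_succ (l + 1),
      centralCoeff_succ l]
    have h2 : (l : ℝ) + 1 ≠ 0 := by positivity
    have h3 : (l : ℝ) + 1 + 1 ≠ 0 := by positivity
    push_cast
    field_simp
    ring

/-- The explicit sum satisfies the recurrence of `virial_succ` with b = 1/2, which identifies it
with the normalized moments. The condition on E keeps the denominators of the factors nonzero. -/
theorem momentSum_recurrence (a E : ℝ) (J : ℕ) (hE : ∀ i ≤ J + 1, E ≠ ((i : ℝ) + 1) ^ 2) :
    2 * ((J : ℝ) + 2) * (E - (J + 2) ^ 2) * momentSum a E (J + 2)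
      = (2 * J + 3) * (E - (J + 1) ^ 2 - (J + 2) ^ 2 + a ^ 2 - (1 / 2) ^ 2) * momentSum a E (J + 1)
        - 2 * (J + 1) * (a ^ 2 - (J + 1) ^ 2) * momentSum a E J := by
  -- Multiplication by E acts on the basic factors as a two-term shift; this removes the explicit E
  -- from the recurrence.
  have hX : ∀ k ≤ J + 1, E * momentFactor a E (k + 1)
      = (k + 1) ^ 2 * momentFactor a E (k + 1)
        + (a ^ 2 - (k + 1 / 2) ^ 2) * momentFactor a E k := by
    intro k hk
    have h := sub_ne_zero.2 (hE k hk)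
    rw [momentFactor, Finset.prod_range_succ, ← momentFactor]
    field_simp
    ring
  -- The coefficient of E · `momentFactor a E k` in the recurrence. It vanishes at k = 0 and at k =
  -- J + 3, so the index shift produces no boundary terms.
  set e : ℕ → ℝ := fun k => 2 * ((J : ℝ) + 2) * momentCoeff (J + 2) k
    - (2 * J + 3) * momentCoeff (J + 1) k with he
  have e0 : e 0 = 0 := by
    simp only [he, momentCoeff, Nat.zero_le, if_true, Nat.sub_zero]
    rw [centralCoeff_succ (J + 1)]
    push_cast
    have h3 : (J : ℝ) + 1 + 1 ≠ 0 := by positivity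
    field_simp
    ring
  have eN : e (J + 3) = 0 := by
    simp [he, momentCoeff]
  have hS : ∑ k ∈ Finset.range (J + 3), e k * (E * momentFactor a E k)
      = ∑ k ∈ Finset.range (J + 3), (e k * k ^ 2 + e (k + 1) * (a ^ 2 - (k + 1 / 2) ^ 2))
          * momentFactor a E k := by
    simp only [add_mul, Finset.sum_add_distrib]
    rw [Finset.sum_range_succ' _ (J + 2), e0, zero_mul, add_zero,
      Finset.sum_range_succ' (fun k => e k * (k : ℝ) ^ 2 * momentFactor a E k) (J + 2),
      Finset.sum_range_succ (fun k => e (k + 1) * (a ^ 2 - ((k : ℝ) + 1 / 2) ^ 2)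
        * momentFactor a E k) (J + 2), eN]
    simp only [e0, zero_mul, add_zero]
    rw [← Finset.sum_add_distrib]
    refine Finset.sum_congr rfl fun k hk => ?_
    rw [hX k (by have := Finset.mem_range.1 hk; omega)]
    push_cast
    ring
  have hz : ∑ k ∈ Finset.range (J + 3), ((e k * k ^ 2 + e (k + 1) * (a ^ 2 - (k + 1 / 2) ^ 2))
      - 2 * ((J : ℝ) + 2) * (J + 2) ^ 2 * momentCoeff (J + 2) k
      + (2 * (J : ℝ) + 3) * ((J + 1) ^ 2 + (J + 2) ^ 2 - a ^ 2 + (1 / 2) ^ 2) * momentCoeff (J + 1) k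
      + 2 * ((J : ℝ) + 1) * (a ^ 2 - (J + 1) ^ 2) * momentCoeff J k) * momentFactor a E k = 0 := by
    refine Finset.sum_eq_zero fun k hk => ?_
    rw [momentCoeff_identity a J k (Finset.mem_range.1 hk), zero_mul]
  rw [momentSum_eq a E (show J + 2 < J + 3 by omega), momentSum_eq a E (show J + 1 < J + 3 by omega),
    momentSum_eq a E (show J < J + 3 by omega), ← sub_eq_zero]
  have hS' := sub_eq_zero.2 hS
  rw [← Finset.sum_sub_distrib] at hS'
  have hsum := congrArg₂ (· + ·) hS' hz
  simp only [add_zero] at hsum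
  rw [← Finset.sum_add_distrib] at hsum
  rw [← hsum]
  simp only [Finset.mul_sum, ← Finset.sum_sub_distrib]
  refine Finset.sum_congr rfl fun k _ => ?_
  simp only [he]
  ring

theorem momentSum_zero (a E : ℝ) : momentSum a E 0 = 1 := by
  simp [momentSum, centralCoeff_zero, momentFactor]

theorem momentSum_one (a E : ℝ) :
    momentSum a E 1 = 1 / 2 + 1 / 2 * ((a ^ 2 - (1 / 2) ^ 2) / (E - 1)) := by
  simp [momentSum, Finset.sum_range_succ, centralCoeff_succ, centralCoeff_zero, momentFactor]

/-- The moments and `momentSum` obey the same three-term recurrence with the same two initial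
values; E ≠ (i + 1)² allows division by its leading coefficient. -/
theorem betaInt_X_pow_mul_sq {A B : ℕ} {a : ℝ} (hA : (A : ℝ) = 2 * a + 1)
    (hB : (B : ℝ) = 2 * (1 / 2 : ℝ) + 1) {l : ℝ} {P : ℝ[X]} (hP : SolvesJacobi a (1 / 2) l P)
    {E : ℝ} (hE : E = 4 * l + (a + 1 / 2 + 1) ^ 2) (J : ℕ)
    (hJ : ∀ i < J, E ≠ ((i : ℝ) + 1) ^ 2) :
    betaInt A B (X ^ J * (P * P)) = momentSum a E J * betaInt A B (P * P) := by
  induction J using Nat.twoStepInduction with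
  | zero => simp [momentSum_zero]
  | one =>
    have h := virial_zero hA hB hP hE
    have h1 := sub_ne_zero.2 (hJ 0 one_pos)
    simp only [Nat.cast_zero, zero_add, one_pow] at h1
    rw [pow_one, momentSum_one]
    refine mul_left_cancel₀ (mul_ne_zero two_ne_zero h1) ?_
    rw [h]
    field_simp
    ring
  | more J ih0 ih1 =>
    have h := virial_succ hA hB hP hE J
    have h1 := sub_ne_zero.2 (hJ (J + 1) (by omega))
    have h2 := momentSum_recurrence a E J (fun i hi => hJ i (by omega))
    rw [ih0 (fun i hi => hJ i (by omega)), ih1 (fun i hi => hJ i (by omega))] at h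
    have h3 : 2 * ((J : ℝ) + 2) * (E - (J + 2) ^ 2) ≠ 0 := by
      refine mul_ne_zero (by positivity) ?_
      convert h1 using 3
      push_cast
      ring
    refine mul_left_cancel₀ h3 ?_
    rw [h]
    linear_combination -betaInt A B (P * P) * h2

/-- For i < k one has i + 1/2 ≤ k - 1/2 ≤ a, so all numerators are nonnegative, while the positive
denominators increase with E. -/
theorem momentFactor_anti {a E E' : ℝ} {k : ℕ} (hk : (k : ℝ) ≤ a + 1 / 2) (hE : (k : ℝ) ^ 2 < E)
    (hEE : E ≤ E') : 0 ≤ momentFactor a E' k ∧ momentFactor a E' k ≤ momentFactor a E k := by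
  have hi : ∀ i ∈ Finset.range k, 0 ≤ a ^ 2 - ((i : ℝ) + 1 / 2) ^ 2 ∧ 0 < E - (i + 1) ^ 2 := by
    intro i hi
    have h1 : (i : ℝ) + 1 ≤ k := by exact_mod_cast Finset.mem_range.1 hi
    have h2 : (0 : ℝ) ≤ i := i.cast_nonneg
    constructor <;> nlinarith
  refine ⟨Finset.prod_nonneg fun i h => ?_, Finset.prod_le_prod (fun i h => ?_) fun i h => ?_⟩
  · have := hi i h
    exact div_nonneg this.1 (by linarith)
  · have := hi i h
    exact div_nonneg this.1 (by linarith)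
  · have := hi i h
    exact div_le_div_of_nonneg_left this.1 this.2 (by linarith)

/-- The expansion has positive coefficients. With E = ω_m² this makes the normalized Klein-Gordon
coefficients nonincreasing in m. -/
theorem momentSum_anti {a E E' : ℝ} {J : ℕ} (hJ : (J : ℝ) ≤ a + 1 / 2) (hE : (J : ℝ) ^ 2 < E)
    (hEE : E ≤ E') : momentSum a E' J ≤ momentSum a E J := by
  refine Finset.sum_le_sum fun k hk => ?_
  have h1 : (k : ℝ) ≤ J := by exact_mod_cast Nat.lt_succ_iff.1 (Finset.mem_range.1 hk)
  have h2 : (0 : ℝ) ≤ k := k.cast_nonneg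
  have h3 := centralCoeff_pos k
  have h4 := centralCoeff_pos (J - k)
  exact mul_le_mul_of_nonneg_left
    (momentFactor_anti (h1.trans hJ) (by nlinarith) hEE).2 (by positivity)

theorem betaInt_one_pos (A B : ℕ) : 0 < betaInt A B 1 := by
  rw [betaInt_one]
  have h1 := Real.Gamma_pos_of_pos (show (0 : ℝ) < ((A : ℝ) + 1) / 2 by positivity)
  have h2 := Real.Gamma_pos_of_pos (show (0 : ℝ) < ((B : ℝ) + 1) / 2 by positivity)
  have h3 := Real.Gamma_pos_of_pos (show (0 : ℝ) < ((A : ℝ) + B) / 2 + 1 by positivity)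
  positivity

theorem betaInt_jacobiPoly_sq_pos (n A B : ℕ) {a b : ℝ} (hA : (A : ℝ) = 2 * a + 1)
    (hB : (B : ℝ) = 2 * b + 1) (hAB : 0 < A + B) :
    0 < betaInt A B (jacobiPoly n a b * jacobiPoly n a b) := by
  have hp : 0 < a + b + 1 := by
    have : (0 : ℝ) < A + B := by exact_mod_cast hAB
    linarith
  have hA0 : (0 : ℝ) ≤ A := A.cast_nonneg
  have hB0 : (0 : ℝ) ≤ B := B.cast_nonneg
  have hn : (0 : ℝ) ≤ n := n.cast_nonneg
  rw [betaInt_jacobiPoly_sq n A B hA hB hAB]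
  have g1 := Real.Gamma_pos_of_pos (show 0 < (n : ℝ) + a + 1 by linarith)
  have g2 := Real.Gamma_pos_of_pos (show 0 < (n : ℝ) + b + 1 by linarith)
  have g3 := Real.Gamma_pos_of_pos (show 0 < (n : ℝ) + a + b + 1 by linarith)
  have g4 : (0 : ℝ) < 2 * n + a + b + 1 := by linarith
  positivity

theorem betaInt_X_pow_one (A B k : ℕ) :
    betaInt A B (X ^ (k + 1)) = ((A : ℝ) + 2 * k + 1) / (A + B + 2 * k + 2) * betaInt A B (X ^ k) := by
  have h := betaInt_one_recurrence (A + 2 * k) B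
  have h1 := betaInt_X_pow_mul A B (k + 1) 1
  have h2 := betaInt_X_pow_mul A B k 1
  rw [mul_one] at h1 h2
  rw [h1, h2, show A + 2 * (k + 1) = A + 2 * k + 2 by ring]
  push_cast at h
  field_simp
  linarith

theorem betaInt_linear_sq (A B : ℕ) (c₀ c₁ : ℝ) :
    betaInt A B ((C c₀ + C c₁ * X) * (C c₀ + C c₁ * X)) = betaInt A B 1 *
      (c₀ ^ 2 + ((A : ℝ) + 1) / (A + B + 2) * (2 * c₀ * c₁ + (A + 3) / (A + B + 4) * c₁ ^ 2)) := by
  have e : (C c₀ + C c₁ * X) * (C c₀ + C c₁ * X) = C (c₀ ^ 2) * (X : ℝ[X]) ^ 0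
      + C (2 * c₀ * c₁) * X ^ 1 + C (c₁ ^ 2) * X ^ 2 := by
    simp only [C_mul, C_pow, map_ofNat]
    ring
  rw [e, map_add, map_add, betaInt_C_mul, betaInt_C_mul, betaInt_C_mul, betaInt_X_pow_one A B 1,
    betaInt_X_pow_one A B 0, pow_zero]
  push_cast
  field_simp
  ring

theorem betaInt_quadratic_sq (A B : ℕ) (c₀ c₁ c₂ : ℝ) :
    betaInt A B ((C c₀ + C c₁ * X + C c₂ * X ^ 2) * (C c₀ + C c₁ * X + C c₂ * X ^ 2))
      = betaInt A B 1 * (c₀ ^ 2 + ((A : ℝ) + 1) / (A + B + 2) * (2 * c₀ * c₁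
        + (A + 3) / (A + B + 4) * (c₁ ^ 2 + 2 * c₀ * c₂ + (A + 5) / (A + B + 6) * (2 * c₁ * c₂
          + (A + 7) / (A + B + 8) * c₂ ^ 2)))) := by
  have e : (C c₀ + C c₁ * X + C c₂ * X ^ 2) * (C c₀ + C c₁ * X + C c₂ * X ^ 2)
      = C (c₀ ^ 2) * (X : ℝ[X]) ^ 0
      + C (2 * c₀ * c₁) * X ^ 1 + C (c₁ ^ 2 + 2 * c₀ * c₂) * X ^ 2 + C (2 * c₁ * c₂) * X ^ 3
      + C (c₂ ^ 2) * X ^ 4 := by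
    simp only [C_mul, C_pow, map_ofNat, C_add]
    ring
  rw [e, map_add, map_add, map_add, map_add, betaInt_C_mul, betaInt_C_mul, betaInt_C_mul,
    betaInt_C_mul, betaInt_C_mul, betaInt_X_pow_one A B 3, betaInt_X_pow_one A B 2,
    betaInt_X_pow_one A B 1, betaInt_X_pow_one A B 0, pow_zero]
  push_cast
  field_simp
  ring

theorem jacobiPoly_two (a b : ℝ) : jacobiPoly 2 a b = C ((a + 1) * (a + 2) / 2)
    + C (-((a + b + 3) * (a + 2))) * X + C ((a + b + 3) * (a + b + 4) / 2) * X ^ 2 := by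
  simp only [jacobiPoly, Finset.sum_range_succ, Finset.sum_range_zero, zero_add, pow_zero, mul_one,
    pow_one]
  have h0 : jacobiCoeff 2 a b 0 = (a + 1) * (a + 2) / 2 := by
    simp [jacobiCoeff, ascPochhammer_succ_eval]
    left
    ring
  have h1 : jacobiCoeff 2 a b 1 = -((a + b + 3) * (a + 2)) := by
    simp [jacobiCoeff]
    ring
  have h2 : jacobiCoeff 2 a b 2 = (a + b + 3) * (a + b + 4) / 2 := by
    simp [jacobiCoeff, ascPochhammer_succ_eval]
    ring
  rw [h0, h1, h2]

/-! ### The Klein-Gordon case -/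

/-- With δ = d + 1 the nonlinearity contributes the extra factor cos^{2d}. After reflection this is
the moment z^d for the parameters (d - 1/2, 1/2), with E = ω_m². The factor `momentSum` is thus
C_{00mm} divided by the square of e_0. -/
theorem betaInt_kg_sq (d m : ℕ) : betaInt 2 (4 * d)
      (jacobiPoly m (1 / 2) (d - 1 / 2) * jacobiPoly m (1 / 2) (d - 1 / 2))
    = momentSum (d - 1 / 2) ((2 * m + d + 1) ^ 2) d * betaInt 2 (2 * d)
      (jacobiPoly m (1 / 2) (d - 1 / 2) * jacobiPoly m (1 / 2) (d - 1 / 2)) := by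
  have hs := (solvesJacobi_jacobiPoly m (1 / 2) ((d : ℝ) - 1 / 2)).comp_one_sub
  have h := betaInt_X_pow_mul_sq (A := 2 * d) (B := 2) (by push_cast; ring) (by norm_num) hs
    (E := (2 * m + d + 1) ^ 2) (by ring) d (fun i hi => by
      have h1 : (i : ℝ) + 1 ≤ d := by exact_mod_cast hi
      have h2 : (0 : ℝ) ≤ i := i.cast_nonneg
      have h3 : (0 : ℝ) ≤ m := m.cast_nonneg
      refine ne_of_gt ?_
      gcongr
      linarith)
  rw [← mul_comp, betaInt_comp_one_sub, betaInt_X_pow_mul, ← betaInt_comp_one_sub, comp_assoc] at h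
  simp only [sub_comp, one_comp, X_comp, sub_sub_cancel, comp_X] at h
  rw [← h]
  congr 2
  ring

/-- Evaluating both integrals of the squared polynomial of degree one, for the exponents 4d and 2d
of cos, gives the exact ratio of the first two normalized coefficients. -/
theorem kg_momentSum_one (d : ℕ) :
    2 * ((d : ℝ) + 1) * (2 * d + 1) * (2 * d + 3)
        * momentSum (d - 1 / 2) ((2 * (1 : ℕ) + d + 1) ^ 2) d
      = (5 * d ^ 2 + 8 * d + 2) * (d + 3)
        * momentSum (d - 1 / 2) ((2 * (0 : ℕ) + d + 1) ^ 2) d := by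
  have h0 := betaInt_kg_sq d 0
  have h1 := betaInt_kg_sq d 1
  rw [jacobiPoly_zero, mul_one] at h0
  have e : jacobiPoly 1 (1 / 2) ((d : ℝ) - 1 / 2) = C (3 / 2) + C (-((d : ℝ) + 2)) * X := by
    rw [jacobiPoly_one, C_neg]
    ring_nf
  rw [e, betaInt_linear_sq, betaInt_linear_sq, h0] at h1
  have p1 := betaInt_one_pos 2 (2 * d)
  generalize momentSum (d - 1 / 2) ((2 * (0 : ℕ) + d + 1) ^ 2) d = s0 at h1 ⊢
  generalize momentSum (d - 1 / 2) ((2 * (1 : ℕ) + d + 1) ^ 2) d = s1 at h1 ⊢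
  have u : (3 / 2 : ℝ) ^ 2 + (((2 : ℕ) : ℝ) + 1) / (((2 : ℕ) : ℝ) + ((4 * d : ℕ) : ℝ) + 2)
      * (2 * (3 / 2) * -((d : ℝ) + 2) + (((2 : ℕ) : ℝ) + 3) / (((2 : ℕ) : ℝ) + ((4 * d : ℕ) : ℝ) + 4)
        * (-((d : ℝ) + 2)) ^ 2)
      = 3 * (5 * d ^ 2 + 8 * d + 2) / (8 * (d + 1) * (2 * d + 3)) := by
    push_cast
    field_simp
    ring
  have v : (3 / 2 : ℝ) ^ 2 + (((2 : ℕ) : ℝ) + 1) / (((2 : ℕ) : ℝ) + ((2 * d : ℕ) : ℝ) + 2)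
      * (2 * (3 / 2) * -((d : ℝ) + 2) + (((2 : ℕ) : ℝ) + 3) / (((2 : ℕ) : ℝ) + ((2 * d : ℕ) : ℝ) + 4)
        * (-((d : ℝ) + 2)) ^ 2) = 3 * (2 * d + 1) / (4 * (d + 3)) := by
    push_cast
    field_simp
    ring
  rw [u, v] at h1
  have h2 : s0 * (3 * (5 * d ^ 2 + 8 * d + 2) / (8 * (d + 1) * (2 * d + 3)))
      = s1 * (3 * (2 * (d : ℝ) + 1) / (4 * (d + 3))) :=
    mul_left_cancel₀ p1.ne' (by linear_combination h1)
  field_simp at h2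
  linear_combination -h2/4

theorem kg_momentSum_two (d : ℕ) :
    4 * ((d : ℝ) + 1) * (2 * d + 1) * (2 * d + 3) ^ 2 * (2 * d + 5)
        * momentSum (d - 1 / 2) ((2 * (2 : ℕ) + d + 1) ^ 2) d * 2
      = (63 * d ^ 4 + 322 * d ^ 3 + 559 * d ^ 2 + 384 * d + 72) * (d + 5)
        * momentSum (d - 1 / 2) ((2 * (0 : ℕ) + d + 1) ^ 2) d := by
  have h0 := betaInt_kg_sq d 0
  have h1 := betaInt_kg_sq d 2
  rw [jacobiPoly_zero, mul_one] at h0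
  have e : jacobiPoly 2 (1 / 2) ((d : ℝ) - 1 / 2) = C (15 / 8) + C (-(5 / 2) * ((d : ℝ) + 3)) * X
      + C (((d : ℝ) + 3) * (d + 4) / 2) * X ^ 2 := by
    rw [jacobiPoly_two]
    ring_nf
  rw [e, betaInt_quadratic_sq, betaInt_quadratic_sq, h0] at h1
  have p1 := betaInt_one_pos 2 (2 * d)
  generalize momentSum (d - 1 / 2) ((2 * (0 : ℕ) + d + 1) ^ 2) d = s0 at h1 ⊢
  generalize momentSum (d - 1 / 2) ((2 * (2 : ℕ) + d + 1) ^ 2) d = s1 at h1 ⊢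
  set u : ℝ → ℝ := fun B => (15 / 8 : ℝ) ^ 2 + (((2 : ℕ) : ℝ) + 1) / (((2 : ℕ) : ℝ) + B + 2)
    * (2 * (15 / 8) * (-(5 / 2) * ((d : ℝ) + 3)) + (((2 : ℕ) : ℝ) + 3) / (((2 : ℕ) : ℝ) + B + 4)
      * ((-(5 / 2) * ((d : ℝ) + 3)) ^ 2 + 2 * (15 / 8) * (((d : ℝ) + 3) * (d + 4) / 2)
        + (((2 : ℕ) : ℝ) + 5) / (((2 : ℕ) : ℝ) + B + 6)
        * (2 * (-(5 / 2) * ((d : ℝ) + 3)) * (((d : ℝ) + 3) * (d + 4) / 2)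
          + (((2 : ℕ) : ℝ) + 7) / (((2 : ℕ) : ℝ) + B + 8) * (((d : ℝ) + 3) * (d + 4) / 2) ^ 2))) with hu
  have u4 : u ((4 * d : ℕ) : ℝ) = 15 * (63 * d ^ 4 + 322 * d ^ 3 + 559 * d ^ 2 + 384 * d + 72)
      / (256 * (d + 1) * (2 * d + 3) * (d + 2) * (2 * d + 5)) := by
    simp only [hu]
    push_cast
    field_simp
    ring
  have u2 : u ((2 * d : ℕ) : ℝ) = 15 * ((2 * d + 1) * (2 * d + 3)) / (32 * (d + 2) * (d + 5)) := by
    simp only [hu]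
    push_cast
    field_simp
    ring
  have h2 : s0 * u ((4 * d : ℕ) : ℝ) = s1 * u ((2 * d : ℕ) : ℝ) :=
    mul_left_cancel₀ p1.ne' (by linear_combination h1)
  rw [u4, u2] at h2
  field_simp at h2
  linear_combination -h2/32

/-- The nonresonance condition for the Klein-Gordon model, `δ = d + 1`. -/
theorem kg_nonresonance (d m : ℕ) (hd : 1 ≤ d) (hm : 1 ≤ m) :
    2 * ((d : ℝ) + 1) ^ 2 * momentSum (d - 1 / 2) ((2 * m + d + 1) ^ 2) d
      ≠ (2 * m + d + 1) ^ 2 * momentSum (d - 1 / 2) ((2 * (0 : ℕ) + d + 1) ^ 2) d := by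
  have s0 : 0 < momentSum (d - 1 / 2) ((2 * (0 : ℕ) + d + 1) ^ 2) d := by
    have h0 := betaInt_kg_sq d 0
    rw [jacobiPoly_zero, mul_one] at h0
    have p1 := betaInt_one_pos 2 (2 * d)
    have p2 := betaInt_one_pos 2 (4 * d)
    exact pos_of_mul_pos_left (h0 ▸ p2) p1.le
  have hd1 : (1 : ℝ) ≤ d := by exact_mod_cast hd
  rcases hm.eq_or_lt with rfl | hm
  · intro h
    have h1 := kg_momentSum_one d
    generalize momentSum (d - 1 / 2) ((2 * (1 : ℕ) + d + 1) ^ 2) d = s1 at h h1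
    generalize momentSum (d - 1 / 2) ((2 * (0 : ℕ) + d + 1) ^ 2) d = s at h h1 s0
    -- A resonance at m = 1 amounts to d³ - 7d² - 17d - 7 = 0. This cubic changes sign between d = 8
    -- and d = 9, so no inequality valid for all d is available; what is used is that d is an
    -- integer.
    have h2 : ((d : ℝ) + 1) * (5 * d ^ 2 + 8 * d + 2) = (d + 3) * (2 * d + 1) * (2 * d + 3) := by
      refine mul_left_cancel₀ (mul_ne_zero s0.ne' (show (d : ℝ) + 3 ≠ 0 by positivity)) ?_
      push_cast at h
      linear_combination -(d + 1) * h1 + (2 * (d : ℝ) + 1) * (2 * d + 3) * h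
    have h3 : (d + 1) * (5 * d ^ 2 + 8 * d + 2) = (d + 3) * (2 * d + 1) * (2 * d + 3) := by
      exact_mod_cast h2
    rcases Nat.lt_or_ge d 9 with h9 | h9
    · interval_cases d <;> omega
    · obtain ⟨k, rfl⟩ := Nat.exists_eq_add_of_le h9
      ring_nf at h3
      nlinarith [h3]
  · refine ne_of_lt ?_
    have h1 := kg_momentSum_two d
    have hm2 : (2 : ℝ) ≤ m := by exact_mod_cast hm
    -- Monotonicity in E reduces all m ≥ 2 to m = 2, while ω_m only grows.
    have h2 : momentSum (d - 1 / 2) ((2 * m + d + 1) ^ 2) d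
        ≤ momentSum (d - 1 / 2) ((2 * (2 : ℕ) + d + 1) ^ 2) d := by
      refine momentSum_anti (by linarith) ?_ ?_
      · push_cast
        gcongr
        linarith
      · push_cast
        gcongr
    generalize momentSum (d - 1 / 2) ((2 * m + d + 1) ^ 2) d = sm at h2 ⊢
    generalize momentSum (d - 1 / 2) ((2 * (2 : ℕ) + d + 1) ^ 2) d = s2 at h1 h2
    generalize momentSum (d - 1 / 2) ((2 * (0 : ℕ) + d + 1) ^ 2) d = s at h1 s0 ⊢
    calc 2 * ((d : ℝ) + 1) ^ 2 * sm ≤ 2 * ((d : ℝ) + 1) ^ 2 * s2 := by gcongr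
      _ < (d + 5) ^ 2 * s := by
        have hq : 0 < 4 * (2 * (d : ℝ) + 1) * (2 * d + 3) ^ 2 * (2 * d + 5) := by positivity
        refine lt_of_mul_lt_mul_left ?_ hq.le
        have e1 : 4 * (2 * (d : ℝ) + 1) * (2 * d + 3) ^ 2 * (2 * d + 5) * (2 * ((d : ℝ) + 1) ^ 2 * s2)
            = (d + 1) * ((63 * d ^ 4 + 322 * d ^ 3 + 559 * d ^ 2 + 384 * d + 72) * (d + 5) * s) := by
          rw [← h1]
          ring
        rw [e1, ← sub_pos]
        -- The bracket is a polynomial in d with positive coefficients; the leading ones compare as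
        -- 64 against 63.
        have e2 : 4 * (2 * (d : ℝ) + 1) * (2 * d + 3) ^ 2 * (2 * d + 5) * ((d + 5) ^ 2 * s)
            - (d + 1) * ((63 * d ^ 4 + 322 * d ^ 3 + 559 * d ^ 2 + 384 * d + 72) * (d + 5) * s)
            = (d + 5) * s * (4 * (d + 5) * (2 * (d : ℝ) + 1) * (2 * d + 3) ^ 2 * (2 * d + 5)
              - (d + 1) * (63 * d ^ 4 + 322 * d ^ 3 + 559 * d ^ 2 + 384 * d + 72)) := by ring
        rw [e2]
        refine mul_pos (by positivity) ?_
        ring_nf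
        positivity
      _ ≤ (2 * m + d + 1) ^ 2 * s := by
        have : (d : ℝ) + 5 ≤ 2 * m + d + 1 := by linarith
        gcongr

/-! ### The wave map case -/

/-- The companion of `X_mul_derivative_jacobiPoly` in the opposite direction: differentiate that
relation, insert the Jacobi equation, and cancel m + a. -/
theorem one_sub_X_mul_derivative_jacobiPoly (m : ℕ) {a b : ℝ} (hma : (m : ℝ) + a ≠ 0) :
    (1 - X) * derivative (jacobiPoly m (a - 1) (b + 1))
      = C (b + 1) * jacobiPoly m (a - 1) (b + 1) - C (m + b + 1) * jacobiPoly m a b := by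
  have h1 := X_mul_derivative_jacobiPoly m a b
  have h2 := solvesJacobi_jacobiPoly m a b
  have h3 := congrArg derivative h1
  unfold SolvesJacobi at h2
  simp only [derivative_add, derivative_mul, derivative_X, derivative_C, zero_mul, zero_add,
    one_mul] at h3
  refine mul_left_cancel₀ (C_ne_zero.2 hma) ?_
  simp only [C_add, C_mul, map_natCast, map_one, map_ofNat] at h1 h2 h3 ⊢
  linear_combination (-(1 - X)) * h3 + h2 + (C b + 1) * h1

/-- The ladder for `∫ z^(2a) (1 - z)^b (P_m^{(a,b)})² dz`. -/
theorem betaInt_ladder (m k b : ℕ) :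
    ((k : ℝ) + 1) * (2 * m + b + 1) * (2 * m + b + 1 + 2 * (k + 1))
        * betaInt 1 (2 * b + 1) ((X ^ (k + 1) * jacobiPoly m (k + 1) b) ^ 2)
      = 2 * (2 * k + 1) * (m + k + 1) ^ 2
        * betaInt 1 (2 * (b + 1) + 1) ((X ^ k * jacobiPoly m k (b + 1)) ^ 2) := by
  have hma : (m : ℝ) + (k + 1) ≠ 0 := by positivity
  set P := jacobiPoly m ((k : ℝ) + 1) b with hP
  set p := jacobiPoly m (k : ℝ) ((b : ℝ) + 1) with hp
  have h1 := X_mul_derivative_jacobiPoly m ((k : ℝ) + 1) b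
  have h2 := one_sub_X_mul_derivative_jacobiPoly m (b := b) hma
  rw [add_sub_cancel_right, ← hp, ← hP] at h1 h2
  -- With zR = z^{k+1}P and y = z^k p the two contiguous relations become a closed first-order
  -- system, `d1` and `d2`.
  set R := (X : ℝ[X]) ^ k * P with hR
  set y := (X : ℝ[X]) ^ k * p with hy
  have e0 : (X : ℝ[X]) ^ (k + 1) * P = X * R := by rw [hR]; ring
  have ek : X * derivative ((X : ℝ[X]) ^ k) = C (k : ℝ) * X ^ k := by
    cases k with
    | zero => simp
    | succ k => rw [derivative_X_pow]; simp; ring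
  have d1 : R + X * derivative R = C ((m : ℝ) + (k + 1)) * y := by
    rw [hR, hy, derivative_mul]
    simp only [C_add, map_natCast, map_one] at h1 ek ⊢
    linear_combination P * ek + X ^ k * h1
  have d2 : X * (1 - X) * derivative y = (C (k : ℝ) + C ((b : ℝ) + 1 - k) * X) * y
      - C ((m : ℝ) + b + 1) * (X * R) := by
    rw [hR, hy, derivative_mul]
    simp only [C_add, C_sub, map_natCast, map_one] at h2 ek ⊢
    linear_combination p * (1 - X) * ek + X ^ (k + 1) * h2
  -- Three exact differentials give three linear relations among four integrals: the squares of zR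
  -- and of y, the mixed one K, and D1. Eliminating K and D1 relates the two squares.
  have q1 := betaInt_pearson 1 (2 * b + 1) (X * R * R)
  have q2 := betaInt_pearson 1 (2 * b + 1) ((1 - X) * y * y)
  have q3 := betaInt_pearson 1 (2 * b + 1) (X * R * y)
  have r1 : (C (((1 : ℕ) : ℝ) + 1) * (1 - X) - C (((2 * b + 1 : ℕ) : ℝ) + 1) * X) * (X * R * R)
      + 2 * X * (1 - X) * derivative (X * R * R)
      = C (4 * ((m : ℝ) + (k + 1))) * ((1 - X) * (X * R * y)) - C (2 * ((b : ℝ) + 1)) * (X * R) ^ 2 := by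
    simp only [derivative_mul, derivative_X, C_add, C_mul, map_natCast, map_one, map_ofNat,
      Nat.cast_add, Nat.cast_mul, Nat.cast_one, Nat.cast_ofNat] at d1 ⊢
    linear_combination 4 * X * (1 - X) * R * d1
  have r2 : (C (((1 : ℕ) : ℝ) + 1) * (1 - X) - C (((2 * b + 1 : ℕ) : ℝ) + 1) * X) * ((1 - X) * y * y)
      + 2 * X * (1 - X) * derivative ((1 - X) * y * y)
      = C (2 * (2 * (k : ℝ) + 1)) * ((1 - X) * y ^ 2)
        + C (2 * ((b : ℝ) - 1 - 2 * k)) * ((1 - X) * (X * y ^ 2))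
        - C (4 * ((m : ℝ) + b + 1)) * ((1 - X) * (X * R * y)) := by
    simp only [derivative_mul, derivative_sub, derivative_one, derivative_X, C_add, C_sub, C_mul,
      map_natCast, map_one, map_ofNat, Nat.cast_add, Nat.cast_mul, Nat.cast_one, Nat.cast_ofNat]
      at d2 ⊢
    linear_combination 4 * (1 - X) * y * d2
  have r3 : (C (((1 : ℕ) : ℝ) + 1) * (1 - X) - C (((2 * b + 1 : ℕ) : ℝ) + 1) * X) * (X * R * y)
      + 2 * X * (1 - X) * derivative (X * R * y)
      = C (2 * ((m : ℝ) + (k + 1))) * ((1 - X) * (X * y ^ 2))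
        + C (2 * ((k : ℝ) + 1)) * ((1 - X) * (X * R * y))
        - C (2 * ((m : ℝ) + b + 1)) * (X * R) ^ 2 := by
    simp only [derivative_mul, derivative_X, C_add, C_sub, C_mul, map_natCast, map_one, map_ofNat,
      Nat.cast_add, Nat.cast_mul, Nat.cast_one, Nat.cast_ofNat] at d1 d2 ⊢
    linear_combination 2 * X * R * d2 + 2 * X * (1 - X) * y * d1
  rw [r1, map_sub, betaInt_C_mul, betaInt_C_mul] at q1
  rw [r2, map_sub, map_add, betaInt_C_mul, betaInt_C_mul, betaInt_C_mul] at q2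
  rw [r3, map_sub, map_add, betaInt_C_mul, betaInt_C_mul, betaInt_C_mul] at q3
  rw [e0, show 2 * (b + 1) + 1 = 2 * b + 1 + 2 by ring, ← betaInt_one_sub_X_mul]
  generalize betaInt 1 (2 * b + 1) ((1 - X) * (X * R * y)) = K at q1 q2 q3
  generalize betaInt 1 (2 * b + 1) ((X * R) ^ 2) = I at q1 q2 q3 ⊢
  generalize betaInt 1 (2 * b + 1) ((1 - X) * (X * y ^ 2)) = D1 at q1 q2 q3
  generalize betaInt 1 (2 * b + 1) ((1 - X) * y ^ 2) = D0 at q1 q2 q3 ⊢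
  linear_combination (-(m + k + 1) ^ 2) * q2 + (m + k + 1) * (b - 1 - 2 * k) * q3
    + (-(m + b + 1) * (m + k + 1) - (k + 1) * (b - 1 - 2 * k) / 2) * q1

theorem betaInt_ladder_ratio (m k b : ℕ) :
    ((m : ℝ) + 1) ^ 2 * (2 * m + 2 * k + b + 2) * (2 * m + 2 * k + b + 3)
        * betaInt 1 (2 * b + 1) ((X ^ k * jacobiPoly (m + 1) k b) ^ 2)
      = (m + 1 + k) ^ 2 * (2 * m + b + 1) * (2 * m + b + 2)
        * betaInt 1 (2 * b + 1) ((X ^ k * jacobiPoly m k b) ^ 2) := by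
  induction k generalizing b with
  | zero =>
    have h : ∀ m : ℕ, betaInt 1 (2 * b + 1) ((X ^ 0 * jacobiPoly m (0 : ℕ) b) ^ 2)
        = 1 / (2 * (2 * m + b + 1)) := by
      intro m
      rw [pow_zero, one_mul, sq, betaInt_jacobiPoly_sq m 1 (2 * b + 1) (by simp) (by push_cast; ring)
        (by omega)]
      have h1 := Real.Gamma_pos_of_pos (show (0 : ℝ) < m + b + 1 by positivity)
      have h2 : Real.Gamma ((m : ℝ) + 1) = m.factorial := Real.Gamma_nat_eq_factorial m
      have h3 : (0 : ℝ) < m.factorial := by exact_mod_cast m.factorial_pos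
      rw [Nat.cast_zero, add_zero, h2]
      field_simp
      ring
    rw [h, h]
    push_cast
    field_simp
    ring
  | succ k ih =>
    have h1 := betaInt_ladder m k b
    have h2 := betaInt_ladder (m + 1) k b
    have h3 := ih (b + 1)
    push_cast at h1 h2 h3 ⊢
    generalize betaInt 1 (2 * b + 1) ((X ^ (k + 1) * jacobiPoly m (k + 1) b) ^ 2) = I at h1 h2 h3 ⊢
    generalize betaInt 1 (2 * b + 1) ((X ^ (k + 1) * jacobiPoly (m + 1) (k + 1) b) ^ 2) = I'
      at h1 h2 h3 ⊢
    generalize betaInt 1 (2 * (b + 1) + 1) ((X ^ k * jacobiPoly m k (b + 1)) ^ 2) = D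
      at h1 h2 h3 ⊢
    generalize betaInt 1 (2 * (b + 1) + 1) ((X ^ k * jacobiPoly (m + 1) k (b + 1)) ^ 2) = D'
      at h1 h2 h3 ⊢
    have c : ((k : ℝ) + 1) * (2 * m + b + 3) * (2 * m + 2 * k + b + 3) ≠ 0 := by positivity
    refine mul_left_cancel₀ c ?_
    linear_combination (m + 1) ^ 2 * (2 * m + 2 * k + b + 3) * (2 * m + 2 * k + b + 4) * h2
      + 2 * (2 * (k : ℝ) + 1) * (m + k + 2) ^ 2 * h3
      - (m + k + 2) ^ 2 * (2 * m + b + 2) * (2 * m + b + 3) * h1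

/-- The value on the right is the maximum, attained at z = p/(p + q). Applying x ≤ c·exp(x/c - 1) to
both factors at their maximizing values makes the exponentials cancel. -/
theorem pow_mul_one_sub_pow_le {p q : ℕ} (hp : 0 < p) (hq : 0 < q) {z : ℝ} (h0 : 0 ≤ z)
    (h1 : z ≤ 1) : z ^ p * (1 - z) ^ q ≤ ((p : ℝ) / (p + q)) ^ p * (q / (p + q)) ^ q := by
  have hp' : (0 : ℝ) < p := by exact_mod_cast hp
  have hq' : (0 : ℝ) < q := by exact_mod_cast hq
  have key : ∀ c x : ℝ, 0 < c → x ≤ c * Real.exp (x / c - 1) := by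
    intro c x hc
    have := Real.add_one_le_exp (x / c - 1)
    calc x = c * (x / c - 1 + 1) := by field_simp; ring
      _ ≤ _ := by gcongr
  have a1 := key (p / (p + q)) z (by positivity)
  have a2 := key (q / (p + q)) (1 - z) (by positivity)
  calc z ^ p * (1 - z) ^ q
      ≤ ((p / (p + q)) * Real.exp (z / (p / (p + q)) - 1)) ^ p
        * ((q / (p + q)) * Real.exp ((1 - z) / (q / (p + q)) - 1)) ^ q := by
        have : 0 ≤ 1 - z := by linarith
        gcongr
    _ = ((p : ℝ) / (p + q)) ^ p * (q / (p + q)) ^ q := by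
        rw [mul_pow, mul_pow, ← Real.exp_nat_mul, ← Real.exp_nat_mul, mul_mul_mul_comm,
          ← Real.exp_add]
        have : (p : ℝ) * (z / (p / (p + q)) - 1) + q * ((1 - z) / (q / (p + q)) - 1) = 0 := by
          field_simp
          ring
        rw [this, Real.exp_zero, mul_one]

/-- Bernoulli's inequality with exponent p/2 ≥ 1 gives (1 + 4/p)^{p/2} ≥ 3; squaring and inverting
gives 1/9. -/
theorem div_add_four_pow_le {p : ℕ} (hp : 2 ≤ p) : ((p : ℝ) / (p + 4)) ^ p ≤ 1 / 9 := by
  have hp' : (2 : ℝ) ≤ p := by exact_mod_cast hp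
  have h := one_add_mul_self_le_rpow_one_add (s := 4 / (p : ℝ)) (p := p / 2)
    (by linarith [show (0 : ℝ) ≤ 4 / p by positivity]) (by linarith)
  have e : (1 : ℝ) + p / 2 * (4 / p) = 3 := by
    field_simp
    norm_num
  rw [e] at h
  have h9 : (9 : ℝ) ≤ (1 + 4 / (p : ℝ)) ^ p := by
    have e2 : (1 + 4 / (p : ℝ)) ^ p = ((1 + 4 / (p : ℝ)) ^ ((p : ℝ) / 2)) ^ 2 := by
      rw [← Real.rpow_natCast, ← Real.rpow_natCast, ← Real.rpow_mul (by positivity)]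
      congr 1
      push_cast
      ring
    rw [e2]
    nlinarith
  have e3 : (p : ℝ) / (p + 4) = (1 + 4 / (p : ℝ))⁻¹ := by
    field_simp
  rw [e3, inv_pow, one_div]
  exact inv_anti₀ (by norm_num) h9

theorem betaInt_wm_norm (d m : ℕ) :
    betaInt (2 * d + 3) 3 (jacobiPoly m (d + 1) 1 * jacobiPoly m (d + 1) 1)
      = (m + 1) / (2 * (2 * m + d + 3) * (m + d + 2)) := by
  rw [betaInt_jacobiPoly_sq m (2 * d + 3) 3 (by push_cast; ring) (by norm_num) (by omega)]
  have e1 : Real.Gamma ((m : ℝ) + (d + 1) + 1 + 1)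
      = ((m : ℝ) + d + 2) * Real.Gamma ((m : ℝ) + (d + 1) + 1) := by
    rw [Real.Gamma_add_one (by positivity)]
    ring
  have e2 : Real.Gamma ((m : ℝ) + 1 + 1) = (m + 1) * m.factorial := by
    rw [Real.Gamma_add_one (by positivity), Real.Gamma_nat_eq_factorial]
  have h1 := Real.Gamma_pos_of_pos (show (0 : ℝ) < m + (d + 1) + 1 by positivity)
  have h3 : (0 : ℝ) < m.factorial := by exact_mod_cast m.factorial_pos
  rw [e1, e2]
  field_simp
  ring

/-- The quotient of the moment by the squared norm is nonincreasing in m, since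
`betaInt_ladder_ratio` gives an explicit growth factor for the moment, to be compared with the one
of the norm. The constant is the value at m = 2. -/
theorem betaInt_wm_moment_le (d m : ℕ) (hm : 2 ≤ m) :
    4 * (2 * (d : ℝ) + 3) * (2 * d + 5) * (2 * d + 7)
        * betaInt (2 * d + 3) 3 (X ^ (d + 1) * (jacobiPoly m (d + 1) 1 * jacobiPoly m (d + 1) 1))
      ≤ 5 * (d + 2) * (d + 3) * (d + 7)
        * betaInt (2 * d + 3) 3 (jacobiPoly m (d + 1) 1 * jacobiPoly m (d + 1) 1) := by
  set S : ℕ → ℝ := fun m => betaInt (2 * d + 3) 3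
    (X ^ (d + 1) * (jacobiPoly m (d + 1) 1 * jacobiPoly m (d + 1) 1)) with hS
  -- The ladder applies with k = d + 1 and b = 1, because z^{2(d+1)} against the weight sin cos³ is
  -- z^{d+1} against sin^{2d+3} cos³.
  have hr : ∀ m : ℕ, ((m : ℝ) + 1) * (2 * m + 2 * d + 5) * (m + d + 3) * S (m + 1)
      = (m + d + 2) ^ 2 * (2 * m + 3) * S m := by
    intro m
    have h := betaInt_ladder_ratio m (d + 1) 1
    have e : ∀ m : ℕ, betaInt 1 (2 * 1 + 1) ((X ^ (d + 1) * jacobiPoly m ((d + 1 : ℕ) : ℝ) (1 : ℕ)) ^ 2)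
        = S m := by
      intro m
      rw [hS, show (X ^ (d + 1) * jacobiPoly m ((d + 1 : ℕ) : ℝ) (1 : ℕ)) ^ 2
        = X ^ (d + 1) * (X ^ (d + 1) * (jacobiPoly m ((d : ℝ) + 1) 1 * jacobiPoly m ((d : ℝ) + 1) 1)) by
          push_cast; ring, betaInt_X_pow_mul]
      congr 2
      ring
    rw [e, e] at h
    push_cast at h
    have c : 2 * ((m : ℝ) + 1) ≠ 0 := by positivity
    refine mul_left_cancel₀ c ?_
    linear_combination h
  have h0 : S 0 = 1 / (4 * (2 * d + 3) * (d + 2)) := by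
    simp only [hS, jacobiPoly_zero, mul_one]
    have := betaInt_X_pow_mul (2 * d + 3) 3 (d + 1) 1
    rw [mul_one] at this
    rw [this]
    have := betaInt_jacobiPoly_sq 0 (2 * d + 3 + 2 * (d + 1)) 3 (a := 2 * d + 2) (b := 1)
      (by push_cast; ring) (by norm_num) (by omega)
    rw [jacobiPoly_zero, mul_one] at this
    rw [this]
    have h1 := Real.Gamma_pos_of_pos (show (0 : ℝ) < 2 * d + 3 by positivity)
    rw [show ((0 : ℕ) : ℝ) + (2 * d + 2) + 1 + 1 = 2 * d + 3 + 1 by push_cast; ring,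
      Real.Gamma_add_one (s := 2 * d + 3) (by positivity),
      show ((0 : ℕ) : ℝ) + (2 * d + 2) + 1 = 2 * d + 3 by
        push_cast; ring, show ((0 : ℕ) : ℝ) + 1 + 1 = 1 + 1 by push_cast; ring,
      Real.Gamma_add_one one_ne_zero, Real.Gamma_one]
    simp only [Nat.factorial_zero]
    push_cast
    field_simp
    ring
  have hS0 : ∀ m, 0 ≤ S m := fun m => betaInt_nonneg _ _ fun z h0 _ => by
    simp only [eval_mul, eval_pow, eval_X]
    exact mul_nonneg (pow_nonneg h0 _) (mul_self_nonneg _)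
  rw [betaInt_wm_norm]
  change _ * S m ≤ _
  clear_value S
  clear hS
  induction m, hm using Nat.le_induction with
  | base =>
    have h1 := hr 0
    have h2 := hr 1
    rw [h0] at h1
    norm_num at h1 h2
    have e1 : S 1 = 3 * (d + 2) / (4 * (2 * d + 3) * (2 * d + 5) * (d + 3)) := by
      field_simp at h1 ⊢
      linear_combination h1
    rw [e1] at h2
    have e2 : S 2 = 15 * (d + 2) * (d + 3) / (8 * (2 * d + 3) * (2 * d + 5) * (2 * d + 7) * (d + 4)) := by
      rw [eq_div_iff (by positivity)]
      refine mul_left_cancel₀ (show (d : ℝ) + 3 ≠ 0 by positivity) ?_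
      field_simp at h2
      linear_combination h2
    rw [e2]
    push_cast
    refine le_of_eq ?_
    field_simp
    ring
  | succ m hm ih =>
    have hm0 : (0 : ℝ) ≤ m := m.cast_nonneg
    have hd0 : (0 : ℝ) ≤ d := d.cast_nonneg
    have e : S (m + 1) = (m + d + 2) ^ 2 * (2 * m + 3) * S m
        / (((m : ℝ) + 1) * (2 * m + 2 * d + 5) * (m + d + 3)) := by
      rw [eq_div_iff (by positivity)]
      linear_combination hr m
    have e' : (((m + 1 : ℕ) : ℝ) + 1) / (2 * (2 * ((m + 1 : ℕ) : ℝ) + d + 3) * (((m + 1 : ℕ) : ℝ) + d + 2))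
        = ((m : ℝ) + 1) / (2 * (2 * m + d + 3) * (m + d + 2))
          * ((m + 2) * (2 * m + d + 3) * (m + d + 2) / ((m + 1) * (2 * m + d + 5) * (m + d + 3))) := by
      push_cast
      field_simp
      ring
    rw [e, e']
    have k : ((m : ℝ) + d + 2) ^ 2 * (2 * m + 3) / (((m : ℝ) + 1) * (2 * m + 2 * d + 5) * (m + d + 3))
        ≤ (m + 2) * (2 * m + d + 3) * (m + d + 2) / ((m + 1) * (2 * m + d + 5) * (m + d + 3)) := by
      rw [div_le_div_iff₀ (by positivity) (by positivity), ← sub_nonneg]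
      have : ((m : ℝ) + 2) * (2 * m + d + 3) * (m + d + 2) * ((m + 1) * (2 * m + 2 * d + 5) * (m + d + 3))
          - (m + d + 2) ^ 2 * (2 * m + 3) * ((m + 1) * (2 * m + d + 5) * (m + d + 3))
          = (m + d + 2) * (m + 1) * (m + d + 3) * ((d + 1) * d) := by
        ring
      -- The difference of the cross products is a positive multiple of d(d + 1).
      rw [this]
      positivity
    have hS1 : 0 ≤ 4 * (2 * (d : ℝ) + 3) * (2 * d + 5) * (2 * d + 7) * S m := by
      have := hS0 m
      positivity
    calc 4 * (2 * (d : ℝ) + 3) * (2 * d + 5) * (2 * d + 7) * ((m + d + 2) ^ 2 * (2 * m + 3) * S m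
          / (((m : ℝ) + 1) * (2 * m + 2 * d + 5) * (m + d + 3)))
        = 4 * (2 * (d : ℝ) + 3) * (2 * d + 5) * (2 * d + 7) * S m * ((m + d + 2) ^ 2 * (2 * m + 3)
          / (((m : ℝ) + 1) * (2 * m + 2 * d + 5) * (m + d + 3))) := by ring
      _ ≤ (5 * (d + 2) * (d + 3) * (d + 7) * (((m : ℝ) + 1) / (2 * (2 * m + d + 3) * (m + d + 2))))
          * ((m + 2) * (2 * m + d + 3) * (m + d + 2) / ((m + 1) * (2 * m + d + 5) * (m + d + 3))) :=
        mul_le_mul ih k (by positivity) (hS1.trans ih)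
      _ = _ := by ring

/-- For a = d + 1 the last coefficient of `virial_succ` vanishes at J = d. The recurrence therefore
starts from the moment of order d + 1 alone and expresses the next three through it. -/
theorem betaInt_wm_higher (d : ℕ) {l E : ℝ} {P : ℝ[X]} (hP : SolvesJacobi (d + 1) 1 l P)
    (hE : E = 4 * l + (d + 1 + 1 + 1) ^ 2) (hE3 : ((d : ℝ) + 4) ^ 2 < E) :
    4 * ((d : ℝ) + 2) * (d + 3) * (E - (d + 2) ^ 2)
        * betaInt (2 * d + 3) 3 (X ^ (d + 1) * ((1 - X) ^ 2 * (P * P)))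
      = 3 * (E - (d + 1) ^ 2) * betaInt (2 * d + 3) 3 (X ^ (d + 1) * (P * P)) ∧
    2 * ((d : ℝ) + 4) * (E - (d + 4) ^ 2)
        * betaInt (2 * d + 3) 3 (X ^ (d + 1) * ((1 - X) ^ 3 * (P * P)))
      = (5 * (E - (d + 4) ^ 2) + 2 * d + 3)
        * betaInt (2 * d + 3) 3 (X ^ (d + 1) * ((1 - X) ^ 2 * (P * P))) := by
  have hA : ((2 * d + 3 : ℕ) : ℝ) = 2 * ((d : ℝ) + 1) + 1 := by push_cast; ring
  have hB : ((3 : ℕ) : ℝ) = 2 * (1 : ℝ) + 1 := by norm_num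
  have v1 := virial_succ hA hB hP hE d
  have v2 := virial_succ hA hB hP hE (d + 1)
  have v3 := virial_succ hA hB hP hE (d + 2)
  have x2 : betaInt (2 * d + 3) 3 (X ^ (d + 1) * ((1 - X) ^ 2 * (P * P)))
      = betaInt (2 * d + 3) 3 (X ^ (d + 1) * (P * P))
        - 2 * betaInt (2 * d + 3) 3 (X ^ (d + 1 + 1) * (P * P))
        + betaInt (2 * d + 3) 3 (X ^ (d + 2 + 1) * (P * P)) := by
    rw [← betaInt_C_mul, ← map_sub, ← map_add]
    congr 1
    simp only [map_ofNat]
    ring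
  have x3 : betaInt (2 * d + 3) 3 (X ^ (d + 1) * ((1 - X) ^ 3 * (P * P)))
      = betaInt (2 * d + 3) 3 (X ^ (d + 1) * (P * P))
        - 3 * betaInt (2 * d + 3) 3 (X ^ (d + 1 + 1) * (P * P))
        + 3 * betaInt (2 * d + 3) 3 (X ^ (d + 2 + 1) * (P * P))
        - betaInt (2 * d + 3) 3 (X ^ (d + 2 + 2) * (P * P)) := by
    rw [← betaInt_C_mul, ← betaInt_C_mul, ← map_sub, ← map_add, ← map_sub]
    congr 1
    simp only [map_ofNat]
    ring
  rw [x2, x3]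
  push_cast at v1 v2 v3
  rw [show d + 2 = d + 1 + 1 by ring] at v1 v3 ⊢
  rw [show d + 1 + 2 = d + 1 + 1 + 1 by ring] at v2
  rw [show d + 1 + 1 + 2 = d + 1 + 1 + 1 + 1 by ring] at v3 ⊢
  generalize betaInt (2 * d + 3) 3 (X ^ (d + 1) * (P * P)) = S0 at *
  generalize betaInt (2 * d + 3) 3 (X ^ (d + 1 + 1) * (P * P)) = S1 at *
  generalize betaInt (2 * d + 3) 3 (X ^ (d + 1 + 1 + 1) * (P * P)) = S2 at *
  generalize betaInt (2 * d + 3) 3 (X ^ (d + 1 + 1 + 1 + 1) * (P * P)) = S3 at *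
  have hd0 : (0 : ℝ) ≤ d := d.cast_nonneg
  have n2 : E - ((d : ℝ) + 2) ^ 2 ≠ 0 := by nlinarith
  have n3 : E - ((d : ℝ) + 3) ^ 2 ≠ 0 := by nlinarith
  have n4 : E - ((d : ℝ) + 4) ^ 2 ≠ 0 := by nlinarith
  have e1 : S1 = (2 * d + 3) * (E - (d + 2) ^ 2 - 1) * S0 / (2 * ((d : ℝ) + 2) * (E - (d + 2) ^ 2)) := by
    rw [eq_div_iff (mul_ne_zero (by positivity) n2)]
    linear_combination v1
  have e2 : S2 = ((2 * d + 5) * (E - (d + 2) ^ 2 - (d + 3) ^ 2 + (d + 1) ^ 2 - 1) * S1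
      - 2 * (d + 2) * ((d + 1) ^ 2 - (d + 2) ^ 2) * S0) / (2 * ((d : ℝ) + 3) * (E - (d + 3) ^ 2)) := by
    rw [eq_div_iff (mul_ne_zero (by positivity) n3)]
    linear_combination v2
  have e3 : S3 = ((2 * d + 7) * (E - (d + 3) ^ 2 - (d + 4) ^ 2 + (d + 1) ^ 2 - 1) * S2
      - 2 * (d + 3) * ((d + 1) ^ 2 - (d + 3) ^ 2) * S1) / (2 * ((d : ℝ) + 4) * (E - (d + 4) ^ 2)) := by
    rw [eq_div_iff (mul_ne_zero (by positivity) n4)]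
    linear_combination v3
  constructor
  · rw [e2, e1]
    field_simp
    ring
  · rw [e3, e2, e1]
    field_simp
    ring

theorem betaInt_wm_nl (d : ℕ) (P : ℝ[X]) :
    betaInt (4 * d + 3) 7 P = betaInt (2 * d + 3) 3 (X ^ d * ((1 - X) ^ 2 * P)) := by
  rw [betaInt_X_pow_mul, betaInt_one_sub_X_pow_mul]
  congr 1
  congr 1
  ring

theorem betaInt_wm_nl_one (d : ℕ) :
    betaInt (4 * d + 3) 7 1 = 3 / (4 * (2 * d + 5) * (d + 2) * (2 * d + 3) * (d + 1)) := by
  have := betaInt_jacobiPoly_sq 0 (4 * d + 3) 7 (a := 2 * d + 1) (b := 3)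
    (by push_cast; ring) (by norm_num) (by omega)
  rw [jacobiPoly_zero, mul_one] at this
  rw [this]
  have h1 := Real.Gamma_pos_of_pos (show (0 : ℝ) < 2 * d + 2 by positivity)
  have e1 : Real.Gamma (((0 : ℕ) : ℝ) + (2 * d + 1) + 3 + 1)
      = (2 * d + 4) * (2 * d + 3) * (2 * d + 2) * Real.Gamma (2 * d + 2) := by
    rw [show ((0 : ℕ) : ℝ) + (2 * d + 1) + 3 + 1 = 2 * d + 2 + 1 + 1 + 1 by push_cast; ring,
      Real.Gamma_add_one (by positivity), Real.Gamma_add_one (by positivity),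
      Real.Gamma_add_one (by positivity)]
    ring
  have e2 : Real.Gamma (((0 : ℕ) : ℝ) + 3 + 1) = 6 := by
    rw [show ((0 : ℕ) : ℝ) + 3 + 1 = ((3 : ℕ) : ℝ) + 1 by push_cast; ring,
      Real.Gamma_nat_eq_factorial]
    norm_num [Nat.factorial]
  rw [e1, e2, show ((0 : ℕ) : ℝ) + (2 * d + 1) + 1 = 2 * d + 2 by push_cast; ring,
    Nat.factorial_zero]
  push_cast
  field_simp
  ring

theorem betaInt_wm_nl_first (d : ℕ) :
    (d + 3) * (2 * (d : ℝ) + 7) * betaInt (4 * d + 3) 7 (jacobiPoly 1 (d + 1) 1 * jacobiPoly 1 (d + 1) 1)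
      = 2 * (d ^ 2 + 6 * d + 10) * betaInt (4 * d + 3) 7 1 := by
  have e : jacobiPoly 1 ((d : ℝ) + 1) 1 = C ((d : ℝ) + 2) + C (-((d : ℝ) + 4)) * X := by
    rw [jacobiPoly_one, C_neg]
    ring_nf
  rw [e, betaInt_linear_sq]
  push_cast
  field_simp
  ring

/-- For δ = 1 both parameters equal 1. By symmetry the first moment is half the norm, and one virial
step gives the second. -/
theorem betaInt_wm_nl_special (m : ℕ) :
    8 * ((2 * m + 3) ^ 2 - 4) * betaInt 3 7 (jacobiPoly m 1 1 * jacobiPoly m 1 1)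
      = 3 * ((2 * m + 3) ^ 2 - 5) * betaInt 3 3 (jacobiPoly m 1 1 * jacobiPoly m 1 1) := by
  have hA : ((3 : ℕ) : ℝ) = 2 * (1 : ℝ) + 1 := by norm_num
  have hE : (2 * (m : ℝ) + 3) ^ 2 = 4 * (m * (m + 1 + 1 + 1)) + (1 + 1 + 1) ^ 2 := by ring
  have v0 := virial_zero hA hA (solvesJacobi_jacobiPoly m 1 1) hE
  have v1 := virial_succ hA hA (solvesJacobi_jacobiPoly m 1 1) hE 0
  have x2 := betaInt_one_sub_X_pow_mul 3 3 2 (jacobiPoly m 1 1 * jacobiPoly m 1 1)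
  rw [← x2, show (1 - X) ^ 2 * (jacobiPoly m 1 1 * jacobiPoly m 1 1)
    = jacobiPoly m 1 1 * jacobiPoly m 1 1 - C 2 * (X * (jacobiPoly m 1 1 * jacobiPoly m 1 1))
      + X ^ (0 + 2) * (jacobiPoly m 1 1 * jacobiPoly m 1 1) by simp only [map_ofNat]; ring,
    map_add, map_sub, betaInt_C_mul]
  rw [zero_add, zero_add, pow_one] at v1
  rw [zero_add]
  push_cast at v1
  have hm : (0 : ℝ) ≤ m := m.cast_nonneg
  have n1 : 2 * ((2 * (m : ℝ) + 3) ^ 2 - 1) ≠ 0 := by nlinarith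
  have e1 : betaInt 3 3 (X * (jacobiPoly m 1 1 * jacobiPoly m 1 1))
      = betaInt 3 3 (jacobiPoly m 1 1 * jacobiPoly m 1 1) / 2 := by
    refine mul_left_cancel₀ n1 ?_
    linear_combination v0
  rw [e1] at v1 ⊢
  linear_combination 2 * v1

/-- The numerical comparison that closes `betaInt_wm_nl_le`. Here k bounds the maximum of z^d
(1-z)^4: exactly for d = 1, and through `div_add_four_pow_le` for d ≥ 2. -/
theorem wm_rational_bound {d : ℝ} {k : ℝ} (hd : (d = 1 ∧ k = 256 / 3125)
      ∨ (2 ≤ d ∧ k = 256 / (9 * (d + 4) ^ 4))) :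
    9 * (d + 4) * (d + 7) / (4 * (2 * d + 9) * (2 * d + 3) * (2 * d + 5) * (2 * d + 7))
        * (1 + (5 + (2 * d + 3) / (3 * (2 * d + 11))) / (2 * (d + 4))) + k
      < 3 * (d + 7) ^ 2 / (4 * (d + 3) * (d + 1) * (2 * d + 3) * (2 * d + 5)) := by
  rcases hd with ⟨rfl, rfl⟩ | ⟨hd, rfl⟩
  · norm_num
  -- In terms of d - 2 ≥ 0 the cleared inequality becomes positivity of a polynomial whose
  -- coefficients are all positive.
  · obtain ⟨k, rfl⟩ : ∃ k, d = k + 2 := ⟨d - 2, by ring⟩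
    have hk : 0 ≤ k := by linarith
    have e : 9 * (k + 2 + 4) * (k + 2 + 7) / (4 * (2 * (k + 2) + 9) * (2 * (k + 2) + 3)
        * (2 * (k + 2) + 5) * (2 * (k + 2) + 7))
        * (1 + (5 + (2 * (k + 2) + 3) / (3 * (2 * (k + 2) + 11))) / (2 * (k + 2 + 4)))
        = 3 * (k + 9) * (6 * (k + 2) ^ 2 + 73 * (k + 2) + 216)
          / (4 * (2 * k + 7) * (2 * k + 9) * (2 * k + 11) * (2 * k + 13) * (2 * k + 15)) := by
      field_simp
      ring
    rw [e, div_add_div _ _ (by positivity) (by positivity),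
      div_lt_div_iff₀ (by positivity) (by positivity), ← sub_pos]
    have e2 : 3 * (k + 2 + 7) ^ 2 * (4 * (2 * k + 7) * (2 * k + 9) * (2 * k + 11) * (2 * k + 13)
          * (2 * k + 15) * (9 * (k + 2 + 4) ^ 4))
        - (3 * (k + 9) * (6 * (k + 2) ^ 2 + 73 * (k + 2) + 216) * (9 * (k + 2 + 4) ^ 4)
          + 4 * (2 * k + 7) * (2 * k + 9) * (2 * k + 11) * (2 * k + 13) * (2 * k + 15) * 256)
          * (4 * (k + 2 + 3) * (k + 2 + 1) * (2 * (k + 2) + 3) * (2 * (k + 2) + 5))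
        = 4 * (2 * k + 7) * (2 * k + 9) * (27 * (k + 9) * ((k + 9) * (2 * k + 11) * (2 * k + 13)
            * (2 * k + 15) - (6 * (k + 2) ^ 2 + 73 * (k + 2) + 216) * (k + 3) * (k + 5)) * (k + 6) ^ 4
          - 1024 * (2 * k + 7) * (2 * k + 9) * (k + 5) * (k + 3) * (2 * k + 11) * (2 * k + 13)
            * (2 * k + 15)) := by ring
    rw [e2]
    refine mul_pos (by positivity) ?_
    ring_nf
    positivity

theorem betaInt_mul_sq_le {A B p q : ℕ} {c : ℝ} (P : ℝ[X])
    (hc : ∀ z : ℝ, 0 ≤ z → z ≤ 1 → z ^ p * (1 - z) ^ q ≤ c) :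
    betaInt A B (X ^ p * ((1 - X) ^ q * (P * P))) ≤ c * betaInt A B (P * P) := by
  rw [← betaInt_C_mul]
  refine betaInt_mono A B fun z h0 h1 => ?_
  simp only [eval_mul, eval_pow, eval_X, eval_sub, eval_one, eval_C]
  rw [← mul_assoc]
  exact mul_le_mul_of_nonneg_right (hc z h0 h1) (mul_self_nonneg _)

/-- Since 1 = z + z(1-z) + (1-z)², the factor z^d (1-z)² splits into z^{d+1}(1-z)², z^{d+1}(1-z)³
and z^d (1-z)^4. The first two parts are controlled by the moment of order d + 1 through
`betaInt_wm_higher`, the third by its supremum. The constant is the one required for nonresonance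
when ω_m = d + 7, the frequency at m = 2. -/
theorem betaInt_wm_nl_le (d m : ℕ) (hd : 1 ≤ d) (hm : 2 ≤ m) :
    4 * ((d : ℝ) + 3) * (d + 1) * (2 * d + 3) * (2 * d + 5)
        * betaInt (4 * d + 3) 7 (jacobiPoly m (d + 1) 1 * jacobiPoly m (d + 1) 1)
      < 3 * (d + 7) ^ 2
        * betaInt (2 * d + 3) 3 (jacobiPoly m (d + 1) 1 * jacobiPoly m (d + 1) 1) := by
  set P := jacobiPoly m ((d : ℝ) + 1) 1 with hP
  have hm2 : (2 : ℝ) ≤ m := by exact_mod_cast hm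
  have hd1 : (1 : ℝ) ≤ d := by exact_mod_cast hd
  have hE7 : ((d : ℝ) + 7) ^ 2 ≤ (2 * m + d + 3) ^ 2 := by
    have : (d : ℝ) + 7 ≤ 2 * m + d + 3 := by linarith
    gcongr
  have hS := betaInt_wm_moment_le d m hm
  rw [← hP] at hS
  obtain ⟨h2, h3⟩ := betaInt_wm_higher d (solvesJacobi_jacobiPoly m ((d : ℝ) + 1) 1)
    (E := (2 * m + d + 3) ^ 2) (by ring) (by nlinarith)
  rw [← hP] at h2 h3
  have hpos : 0 < betaInt (2 * d + 3) 3 (P * P) :=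
    betaInt_jacobiPoly_sq_pos m (2 * d + 3) 3 (by push_cast; ring) (by norm_num) (by omega)
  have hs : betaInt (4 * d + 3) 7 (P * P) = betaInt (2 * d + 3) 3 (X ^ (d + 1) * ((1 - X) ^ 2 * (P * P)))
      + betaInt (2 * d + 3) 3 (X ^ (d + 1) * ((1 - X) ^ 3 * (P * P)))
      + betaInt (2 * d + 3) 3 (X ^ d * ((1 - X) ^ 4 * (P * P))) := by
    rw [betaInt_wm_nl, ← map_add, ← map_add]
    congr 1
    ring
  have hS0 : 0 ≤ betaInt (2 * d + 3) 3 (X ^ (d + 1) * (P * P)) := betaInt_nonneg _ _ fun z h0 _ => by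
    simp only [eval_mul, eval_pow, eval_X]
    exact mul_nonneg (pow_nonneg h0 _) (mul_self_nonneg _)
  obtain ⟨κ, hκ, hκ'⟩ : ∃ κ : ℝ, ((d : ℝ) = 1 ∧ κ = 256 / 3125
      ∨ 2 ≤ (d : ℝ) ∧ κ = 256 / (9 * ((d : ℝ) + 4) ^ 4))
      ∧ betaInt (2 * d + 3) 3 (X ^ d * ((1 - X) ^ 4 * (P * P))) ≤ κ * betaInt (2 * d + 3) 3 (P * P) := by
    have hz : ∀ z : ℝ, 0 ≤ z → z ≤ 1 → z ^ d * (1 - z) ^ 4 ≤ ((d : ℝ) / (d + 4)) ^ d * (4 / (d + 4)) ^ 4 :=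
      fun z h0 h1 => by simpa using pow_mul_one_sub_pow_le (by omega) (by norm_num : 0 < 4) h0 h1
    rcases hd.eq_or_lt with rfl | hd2
    · refine ⟨_, Or.inl ⟨by norm_num, rfl⟩, betaInt_mul_sq_le P fun z h0 h1 => (hz z h0 h1).trans ?_⟩
      norm_num
    · refine ⟨_, Or.inr ⟨by exact_mod_cast hd2, rfl⟩,
        betaInt_mul_sq_le P fun z h0 h1 => (hz z h0 h1).trans ?_⟩
      calc ((d : ℝ) / (d + 4)) ^ d * (4 / (d + 4)) ^ 4 ≤ 1 / 9 * (4 / (d + 4)) ^ 4 := by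
            gcongr
            exact div_add_four_pow_le hd2
        _ = _ := by
            rw [div_pow]
            field_simp
            norm_num
  have hr := wm_rational_bound hκ
  rw [hs]
  generalize betaInt (2 * d + 3) 3 (X ^ d * ((1 - X) ^ 4 * (P * P))) = R at *
  generalize betaInt (2 * d + 3) 3 (X ^ (d + 1) * (P * P)) = S at *
  generalize betaInt (2 * d + 3) 3 (X ^ (d + 1) * ((1 - X) ^ 2 * (P * P))) = M2 at *
  generalize betaInt (2 * d + 3) 3 (X ^ (d + 1) * ((1 - X) ^ 3 * (P * P))) = M3 at *
  generalize betaInt (2 * d + 3) 3 (P * P) = h at *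
  generalize (2 * (m : ℝ) + d + 3) ^ 2 = E at *
  -- These are (d+7)² - (d+2)² and (d+7)² - (d+4)², available because ω_m ≥ d + 7 for m ≥ 2.
  have hE2 : 5 * (2 * (d : ℝ) + 9) ≤ E - (d + 2) ^ 2 := by linarith
  have hE4 : 3 * (2 * (d : ℝ) + 11) ≤ E - (d + 4) ^ 2 := by linarith
  have p2 : 0 < E - ((d : ℝ) + 2) ^ 2 := by linarith
  have p4 : 0 < E - ((d : ℝ) + 4) ^ 2 := by linarith
  have b2 : M2 ≤ 9 * (d + 4) / (5 * (d + 2) * (d + 3) * (2 * d + 9)) * S := by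
    have e : M2 = 3 * (E - (d + 1) ^ 2) / (4 * ((d : ℝ) + 2) * (d + 3) * (E - (d + 2) ^ 2)) * S := by
      rw [div_mul_eq_mul_div, eq_div_iff (by positivity)]
      linear_combination h2
    rw [e]
    gcongr ?_ * S
    rw [div_le_div_iff₀ (by positivity) (by positivity)]
    have : 9 * ((d : ℝ) + 4) * (4 * ((d : ℝ) + 2) * (d + 3) * (E - (d + 2) ^ 2))
        - 3 * (E - (d + 1) ^ 2) * (5 * (d + 2) * (d + 3) * (2 * d + 9))
        = (d + 2) * (d + 3) * (3 * (2 * d + 3) * (E - (d + 2) ^ 2 - 5 * (2 * d + 9))) := by ring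
    have h0 : 0 ≤ ((d : ℝ) + 2) * (d + 3) * (3 * (2 * d + 3) * (E - (d + 2) ^ 2 - 5 * (2 * d + 9))) := by
      have : 0 ≤ E - ((d : ℝ) + 2) ^ 2 - 5 * (2 * d + 9) := by linarith
      positivity
    linarith
  have hM2 : 0 ≤ M2 := by
    have : 0 ≤ 3 * (E - ((d : ℝ) + 1) ^ 2) * S := mul_nonneg (by nlinarith) hS0
    rw [← h2] at this
    exact nonneg_of_mul_nonneg_right this (by positivity)
  have b3 : M3 ≤ (5 + (2 * d + 3) / (3 * (2 * d + 11))) / (2 * (d + 4)) * M2 := by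
    have e : M3 = (5 + (2 * d + 3) / (E - (d + 4) ^ 2)) / (2 * (d + 4)) * M2 := by
      refine mul_left_cancel₀ (show 2 * ((d : ℝ) + 4) * (E - (d + 4) ^ 2) ≠ 0 by positivity) ?_
      rw [h3]
      field_simp
      ring
    rw [e]
    gcongr
  have b23 : M2 + M3 ≤ 9 * (d + 4) * (d + 7) / (4 * (2 * d + 9) * (2 * d + 3) * (2 * d + 5) * (2 * d + 7))
        * (1 + (5 + (2 * d + 3) / (3 * (2 * d + 11))) / (2 * (d + 4))) * h := by
    have hS' : S ≤ 5 * (d + 2) * (d + 3) * (d + 7)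
        / (4 * (2 * (d : ℝ) + 3) * (2 * d + 5) * (2 * d + 7)) * h := by
      rw [div_mul_eq_mul_div, le_div_iff₀ (by positivity)]
      linarith
    calc M2 + M3 ≤ (1 + (5 + (2 * d + 3) / (3 * (2 * d + 11))) / (2 * (d + 4))) * M2 := by linarith
      _ ≤ (1 + (5 + (2 * d + 3) / (3 * (2 * d + 11))) / (2 * (d + 4)))
          * (9 * (d + 4) / (5 * (d + 2) * (d + 3) * (2 * d + 9)) * (5 * (d + 2) * (d + 3) * (d + 7)
        / (4 * (2 * (d : ℝ) + 3) * (2 * d + 5) * (2 * d + 7)) * h)) := by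
          gcongr
          refine b2.trans ?_
          gcongr
      _ = _ := by field_simp
  have fin : M2 + M3 + R < 3 * (d + 7) ^ 2 / (4 * (d + 3) * (d + 1) * (2 * d + 3) * (2 * d + 5)) * h := by
    refine lt_of_le_of_lt (add_le_add b23 hκ') ?_
    rw [← add_mul]
    gcongr
  rw [div_mul_eq_mul_div, lt_div_iff₀ (by positivity)] at fin
  linarith

/-- The nonresonance condition for the wave map model, `δ = d + 1`. -/
theorem wm_nonresonance (d m : ℕ) (hm : 1 ≤ m) :
    2 * ((d : ℝ) + 3) ^ 2 * (betaInt (4 * d + 3) 7 (jacobiPoly m (d + 1) 1 * jacobiPoly m (d + 1) 1)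
        * betaInt (2 * d + 3) 3 1)
      < (2 * m + d + 3) ^ 2 * (betaInt (4 * d + 3) 7 1
        * betaInt (2 * d + 3) 3 (jacobiPoly m (d + 1) 1 * jacobiPoly m (d + 1) 1)) := by
  have h0 := betaInt_wm_norm d 0
  have t0 := betaInt_wm_nl_one d
  rw [jacobiPoly_zero, mul_one] at h0
  have hm1 : (1 : ℝ) ≤ m := by exact_mod_cast hm
  have hpos : 0 < betaInt (2 * d + 3) 3 (jacobiPoly m (d + 1) 1 * jacobiPoly m (d + 1) 1) :=
    betaInt_jacobiPoly_sq_pos m (2 * d + 3) 3 (by push_cast; ring) (by norm_num) (by omega)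
  -- The general estimate assumes d ≥ 1 and m ≥ 2, so δ = 1 and m = 1 are settled by exact formulas.
  rcases Nat.eq_zero_or_pos d with rfl | hd
  · have h := betaInt_wm_nl_special m
    simp only [Nat.cast_zero, zero_add, add_zero, mul_zero] at h0 t0 hpos ⊢
    rw [h0, t0]
    generalize betaInt 3 3 (jacobiPoly m 1 1 * jacobiPoly m 1 1) = k at *
    generalize betaInt 3 7 (jacobiPoly m 1 1 * jacobiPoly m 1 1) = T at *
    norm_num
    have hE : (25 : ℝ) ≤ (2 * m + 3) ^ 2 := by nlinarith
    generalize (2 * (m : ℝ) + 3) ^ 2 = E at *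
    have e : T = 3 * (E - 5) * k / (8 * (E - 4)) := by
      rw [eq_div_iff (by linarith)]
      linear_combination h
    have : T ≤ 3 / 8 * k := by
      rw [e, div_le_iff₀ (by linarith)]
      nlinarith
    nlinarith
  rcases hm.eq_or_lt with rfl | hm2
  · have h := betaInt_wm_nl_first d
    rw [t0] at h
    rw [betaInt_wm_norm, h0, t0]
    have e : betaInt (4 * d + 3) 7 (jacobiPoly 1 (d + 1) 1 * jacobiPoly 1 (d + 1) 1)
        = 2 * (d ^ 2 + 6 * d + 10) * (3 / (4 * (2 * d + 5) * (d + 2) * (2 * d + 3) * (d + 1)))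
          / ((d + 3) * (2 * (d : ℝ) + 7)) := by
      rw [eq_div_iff (by positivity)]
      linear_combination h
    rw [e]
    push_cast
    rw [← sub_pos]
    have e2 : (2 * (1 : ℝ) + d + 3) ^ 2 * (3 / (4 * (2 * d + 5) * (d + 2) * (2 * d + 3) * (d + 1))
        * ((1 + 1) / (2 * (2 * 1 + d + 3) * (1 + d + 2)))) - 2 * ((d : ℝ) + 3) ^ 2
        * (2 * (d ^ 2 + 6 * d + 10) * (3 / (4 * (2 * d + 5) * (d + 2) * (2 * d + 3) * (d + 1)))
          / ((d + 3) * (2 * (d : ℝ) + 7)) * ((0 + 1) / (2 * (2 * 0 + d + 3) * (0 + d + 2))))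
        = 3 / (4 * (2 * d + 5) * (d + 2) * (2 * d + 3) * (d + 1))
          * (3 * d ^ 2 + 13 * d + 10) / ((d + 2) * (d + 3) * (2 * d + 7)) := by
      field_simp
      ring
    rw [e2]
    positivity
  · have h := betaInt_wm_nl_le d m hd hm2
    have hm3 : (2 : ℝ) ≤ m := by exact_mod_cast hm2
    rw [h0, t0]
    generalize betaInt (2 * d + 3) 3 (jacobiPoly m (d + 1) 1 * jacobiPoly m (d + 1) 1) = k at *
    generalize betaInt (4 * d + 3) 7 (jacobiPoly m (d + 1) 1 * jacobiPoly m (d + 1) 1) = T at *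
    have hd0 : (0 : ℝ) ≤ d := d.cast_nonneg
    have hT : T < 3 * (d + 7) ^ 2 * k / (4 * ((d : ℝ) + 3) * (d + 1) * (2 * d + 3) * (2 * d + 5)) := by
      rw [lt_div_iff₀ (by positivity)]
      linarith
    calc 2 * ((d : ℝ) + 3) ^ 2 * (T * (((0 : ℕ) + 1) / (2 * (2 * (0 : ℕ) + d + 3) * ((0 : ℕ) + d + 2))))
        < 2 * ((d : ℝ) + 3) ^ 2 * (3 * (d + 7) ^ 2 * k
          / (4 * ((d : ℝ) + 3) * (d + 1) * (2 * d + 3) * (2 * d + 5))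
          * (((0 : ℕ) + 1) / (2 * (2 * (0 : ℕ) + d + 3) * ((0 : ℕ) + d + 2)))) := by gcongr
      _ = (d + 7) ^ 2 * (3 / (4 * (2 * d + 5) * (d + 2) * (2 * d + 3) * (d + 1)) * k) := by
        push_cast
        field_simp
        ring
      _ ≤ _ := by
        have : (d : ℝ) + 7 ≤ 2 * m + d + 3 := by linarith
        gcongr

/-! ### Both models in uniform notation, with modes as polynomials in sin² -/

/-- The power of `sin` in the weight. -/
def sinExp : Model → ℕ → ℕ
  | Model.KG, _ => 2
  | Model.WM, δ => 2 * δ + 1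

/-- The power of `cos` in the weight. -/
def cosExp : Model → ℕ → ℕ
  | Model.KG, δ => 2 * δ - 2
  | Model.WM, _ => 3

/-- The first Jacobi parameter. -/
def jacA : Model → ℕ → ℝ
  | Model.KG, _ => 1 / 2
  | Model.WM, δ => δ

/-- The second Jacobi parameter. -/
def jacB : Model → ℕ → ℝ
  | Model.KG, δ => δ - 3 / 2
  | Model.WM, _ => 1

/-- The lowest frequency, as a natural number. -/
def baseFreq : Model → ℕ → ℕ
  | Model.KG, δ => δ
  | Model.WM, δ => δ + 2

/-- The coefficient of the cubic nonlinearity, as a polynomial in `sin²`. -/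
def nlPoly : Model → ℕ → ℝ[X]
  | Model.KG, δ => (1 - X) ^ (δ - 1)
  | Model.WM, δ => X ^ (δ - 1) * (1 - X) ^ 2

variable {M : Model} {δ : ℕ}

theorem weight_eq (M : Model) (δ : ℕ) (x : ℝ) :
    weight M δ x = Real.sin x ^ sinExp M δ * Real.cos x ^ cosExp M δ := by
  cases M <;> rfl

theorem Admissible.one_le (hδ : Admissible M δ) : 1 ≤ δ := by
  cases M <;> simp only [Admissible] at hδ <;> omega

theorem nlWeight_eq (M : Model) (δ : ℕ) (x : ℝ) :
    nlWeight M δ x = (nlPoly M δ).eval (Real.sin x ^ 2) := by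
  have h : 2 * δ - 2 = 2 * (δ - 1) := by omega
  cases M <;> simp [nlWeight, nlPoly, h, pow_mul, ← Real.cos_sq']
  left
  ring

/-- This strict bound excludes the resonances ω_m - ω_n = ±2ω_0: multiplication by W couples only
modes with |m - n| < ω_0. -/
theorem natDegree_nlPoly (hδ : Admissible M δ) : (nlPoly M δ).natDegree + 1 ≤ baseFreq M δ := by
  have h1 := hδ.one_le
  have h : ((1 : ℝ[X]) - X).natDegree ≤ 1 := by compute_degree
  cases M
  · have := natDegree_pow_le_of_le (δ - 1) h
    simp only [nlPoly, baseFreq]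
    omega
  · have := natDegree_mul_le_of_le (natDegree_pow_le_of_le (δ - 1) (natDegree_X_le (R := ℝ)))
      (natDegree_pow_le_of_le 2 h)
    simp only [nlPoly, baseFreq]
    omega

theorem freq_eq (M : Model) (δ n : ℕ) : freq M δ n = 2 * n + baseFreq M δ := by
  cases M
  · rfl
  · simp only [freq, baseFreq]
    push_cast
    ring

theorem massSq_eq (M : Model) (δ : ℕ) : massSq M δ = (baseFreq M δ : ℝ) ^ 2 := by
  cases M <;> simp [massSq, baseFreq]

theorem baseFreq_eq (M : Model) (δ : ℕ) : (baseFreq M δ : ℝ) = jacA M δ + jacB M δ + 1 := by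
  cases M <;> simp [baseFreq, jacA, jacB] <;> ring

theorem two_le_baseFreq (hδ : Admissible M δ) : 2 ≤ baseFreq M δ := by
  cases M <;> simp only [Admissible, baseFreq] at hδ ⊢ <;> omega

theorem sinExp_eq (M : Model) (δ : ℕ) : (sinExp M δ : ℝ) = 2 * jacA M δ + 1 := by
  cases M <;> simp [sinExp, jacA]
  norm_num

theorem cosExp_eq (hδ : Admissible M δ) : (cosExp M δ : ℝ) = 2 * jacB M δ + 1 := by
  cases M <;> simp only [Admissible, cosExp, jacB] at hδ ⊢
  · rw [Nat.cast_sub (by omega)]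
    push_cast
    ring
  · norm_num

theorem two_le_sinExp (hδ : Admissible M δ) : 2 ≤ sinExp M δ := by
  cases M <;> simp only [Admissible, sinExp] at hδ ⊢ <;> omega

theorem two_le_cosExp (hδ : Admissible M δ) : 2 ≤ cosExp M δ := by
  cases M <;> simp only [Admissible, cosExp] at hδ ⊢ <;> omega

/-- The eigenfunctions as polynomials in `sin²`. -/
def modePoly (M : Model) (δ n : ℕ) : ℝ[X] :=
  C (normConst M δ n) * jacobiPoly n (jacA M δ) (jacB M δ)

theorem eigenfun_eq (M : Model) (δ n : ℕ) (x : ℝ) :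
    eigenfun M δ n x = (modePoly M δ n).eval (Real.sin x ^ 2) := by
  have h : (1 - Real.cos (2 * x)) / 2 = Real.sin x ^ 2 := by
    rw [Real.cos_two_mul, Real.cos_sq']
    ring
  cases M <;> simp only [eigenfun, modePoly, eval_mul, eval_C, jacobiP_eq_eval, h, jacA, jacB]

theorem normConst_sq_mul (hδ : Admissible M δ) (n : ℕ) :
    normConst M δ n ^ 2 * betaInt (sinExp M δ) (cosExp M δ)
      (jacobiPoly n (jacA M δ) (jacB M δ) * jacobiPoly n (jacA M δ) (jacB M δ)) = 1 := by
  rw [betaInt_jacobiPoly_sq n _ _ (sinExp_eq M δ) (cosExp_eq hδ) (by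
    have := two_le_sinExp hδ
    omega)]
  have h1 := hδ.one_le
  have h1' : (1 : ℝ) ≤ δ := by exact_mod_cast h1
  have hn : (0 : ℝ) ≤ n := n.cast_nonneg
  have hf : (0 : ℝ) < n.factorial := by exact_mod_cast n.factorial_pos
  cases M
  · simp only [normConst, jacA, jacB]
    have g1 := Real.Gamma_pos_of_pos (show (0 : ℝ) < n + 3 / 2 by linarith)
    have g2 := Real.Gamma_pos_of_pos (show (0 : ℝ) < n + δ - 1 / 2 by linarith)
    have g3 := Real.Gamma_pos_of_pos (show (0 : ℝ) < n + δ by linarith)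
    have p : (0 : ℝ) < 2 * n + δ := by linarith
    rw [Real.Gamma_nat_eq_factorial, Real.sq_sqrt (by positivity),
      show (n : ℝ) + 1 / 2 + 1 = n + 3 / 2 by ring,
      show (n : ℝ) + (δ - 3 / 2) + 1 = n + δ - 1 / 2 by ring,
      show (n : ℝ) + 1 / 2 + (δ - 3 / 2) + 1 = n + δ by ring,
      show 2 * (n : ℝ) + 1 / 2 + (δ - 3 / 2) + 1 = 2 * n + δ by ring]
    generalize Real.Gamma ((n : ℝ) + δ - 1 / 2) = G at g2 ⊢
    field_simp
  · simp only [normConst, jacA, jacB]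
    have g1 := Real.Gamma_pos_of_pos (show (0 : ℝ) < n + δ + 1 by linarith)
    rw [Real.sq_sqrt (by positivity), Real.Gamma_add_one (s := n + δ + 1) (by positivity),
      Real.Gamma_add_one (s := n + 1) (by positivity), Real.Gamma_nat_eq_factorial]
    field_simp
    ring

theorem betaInt_modePoly_mul (hδ : Admissible M δ) (m n : ℕ) :
    betaInt (sinExp M δ) (cosExp M δ) (modePoly M δ m * modePoly M δ n) = if m = n then 1 else 0 := by
  have e : modePoly M δ m * modePoly M δ n = C (normConst M δ m * normConst M δ n)
      * (jacobiPoly m (jacA M δ) (jacB M δ) * jacobiPoly n (jacA M δ) (jacB M δ)) := by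
    rw [modePoly, modePoly, C_mul]
    ring
  rw [e, betaInt_C_mul]
  split_ifs with h
  · subst h
    rw [← sq, normConst_sq_mul hδ]
  · rw [betaInt_mul_eq_zero (sinExp_eq M δ) (cosExp_eq hδ) (solvesJacobi_jacobiPoly m _ _)
      (solvesJacobi_jacobiPoly n _ _), mul_zero]
    intro h'
    apply h
    have hb := baseFreq_eq M δ
    have hb0 : (0 : ℝ) ≤ baseFreq M δ := Nat.cast_nonneg _
    have h2 := two_le_baseFreq hδ
    have h2' : (2 : ℝ) ≤ baseFreq M δ := by exact_mod_cast h2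
    have hm : (0 : ℝ) ≤ m := m.cast_nonneg
    have hn : (0 : ℝ) ≤ n := n.cast_nonneg
    have : ((m : ℝ) - n) * (m + n + baseFreq M δ) = 0 := by
      rw [hb]
      linear_combination h'
    rcases mul_eq_zero.1 this with h3 | h3
    · exact_mod_cast sub_eq_zero.1 h3
    · linarith

theorem normConst_ne_zero (hδ : Admissible M δ) (n : ℕ) : normConst M δ n ≠ 0 := by
  intro h
  have := normConst_sq_mul hδ n
  simp [h] at this

theorem natDegree_modePoly (hδ : Admissible M δ) (n : ℕ) : (modePoly M δ n).natDegree = n := by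
  rw [modePoly, natDegree_C_mul (normConst_ne_zero hδ n), natDegree_jacobiPoly]
  rw [← baseFreq_eq]
  have := two_le_baseFreq hδ
  positivity

theorem modePoly_ne_zero (hδ : Admissible M δ) (n : ℕ) : modePoly M δ n ≠ 0 := by
  intro h
  have := betaInt_modePoly_mul hδ n n
  simp [h] at this

theorem modePoly_zero (M : Model) (δ : ℕ) : modePoly M δ 0 = C (normConst M δ 0) := by
  simp [modePoly]

/-- Every polynomial of degree `< N` is a combination of the first `N` eigenfunctions. -/
theorem exists_modePoly_sum (hδ : Admissible M δ) (N : ℕ) (P : ℝ[X]) (hP : P.natDegree < N) :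
    ∃ c : ℕ → ℝ, P = ∑ n ∈ Finset.range N, C (c n) * modePoly M δ n := by
  induction N generalizing P with
  | zero => omega
  | succ N ih =>
    have hl : (modePoly M δ N).coeff N ≠ 0 := by
      have := leadingCoeff_ne_zero.2 (modePoly_ne_zero hδ N)
      rwa [leadingCoeff, natDegree_modePoly hδ] at this
    set r := P.coeff N / (modePoly M δ N).coeff N with hr
    set Q := P - C r * modePoly M δ N with hQ
    have hQN : Q.coeff N = 0 := by
      rw [hQ, coeff_sub, coeff_C_mul, hr]
      field_simp
      ring
    have hQd : Q.natDegree ≤ N := by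
      refine (natDegree_sub_le _ _).trans (max_le (by omega) ?_)
      exact (natDegree_C_mul_le _ _).trans (natDegree_modePoly hδ N).le
    rcases Nat.eq_zero_or_pos N with rfl | hN
    · refine ⟨fun _ => r, ?_⟩
      have : Q = 0 := by
        rw [eq_C_of_natDegree_le_zero hQd, hQN, C_0]
      rw [Finset.sum_range_one]
      exact sub_eq_zero.1 this
    · obtain ⟨c, hc⟩ := ih Q (by
        refine lt_of_le_of_ne hQd fun h => ?_
        have h0 : Q.leadingCoeff = 0 := by rw [leadingCoeff, h, hQN]
        rw [leadingCoeff_eq_zero] at h0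
        rw [h0, natDegree_zero] at h
        omega)
      refine ⟨Function.update c N r, ?_⟩
      rw [Finset.sum_range_succ, Function.update_self, ← sub_eq_iff_eq_add, ← hQ, hc]
      refine Finset.sum_congr rfl fun n hn => ?_
      rw [Function.update_of_ne (Finset.mem_range.1 hn).ne]

/-! ### The weighted L² space and the Hilbert basis of eigenfunctions -/

theorem integral_mu (M : Model) (δ : ℕ) (f : ℝ → ℝ) :
    ∫ x, f x ∂(mu M δ) = ∫ x in Ioo 0 (Real.pi / 2), weight M δ x * f x := by
  unfold mu
  rw [integral_withDensity_eq_integral_toReal_smul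
    (continuous_weight M δ).measurable.ennreal_ofReal
    (Filter.Eventually.of_forall fun x => ENNReal.ofReal_lt_top)]
  refine setIntegral_congr_fun measurableSet_Ioo fun x hx => ?_
  change (ENNReal.ofReal (weight M δ x)).toReal * f x = _
  rw [ENNReal.toReal_ofReal (weight_pos M δ hx).le]

theorem ae_mu_mem (M : Model) (δ : ℕ) : ∀ᵐ x ∂(mu M δ), x ∈ Ioo 0 (Real.pi / 2) :=
  withDensity_absolutelyContinuous _ _ (ae_restrict_mem measurableSet_Ioo)

theorem integral_mu_eval (P : ℝ[X]) :
    ∫ x, P.eval (Real.sin x ^ 2) ∂(mu M δ) = betaInt (sinExp M δ) (cosExp M δ) P := by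
  rw [integral_mu, betaInt_apply, intervalIntegral.integral_of_le (by positivity),
    integral_Ioc_eq_integral_Ioo]
  simp only [weight_eq]

theorem memLp_of_continuous (M : Model) (δ : ℕ) {f : ℝ → ℝ} (hf : Continuous f) :
    MemLp f 2 (mu M δ) := by
  obtain ⟨C, hC⟩ := isCompact_Icc.exists_bound_of_continuousOn
    (s := Icc 0 (Real.pi / 2)) hf.continuousOn
  refine MemLp.of_bound hf.aestronglyMeasurable C ?_
  filter_upwards [ae_mu_mem M δ] with x hx using hC x (Ioo_subset_Icc_self hx)

theorem memLp_eval (M : Model) (δ : ℕ) (P : ℝ[X]) :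
    MemLp (fun x => P.eval (Real.sin x ^ 2)) 2 (mu M δ) :=
  memLp_of_continuous M δ (by fun_prop)

/-- The function `P(sin² x)` as an element of `L²`. -/
def polyL2 (M : Model) (δ : ℕ) : ℝ[X] →ₗ[ℝ] L2 M δ where
  toFun P := (memLp_eval M δ P).toLp _
  map_add' P Q := by
    rw [← MemLp.toLp_add]
    refine MemLp.toLp_congr _ _ (Filter.Eventually.of_forall fun x => ?_)
    simp
  map_smul' c P := by
    rw [RingHom.id_apply, ← MemLp.toLp_const_smul]
    refine MemLp.toLp_congr _ _ (Filter.Eventually.of_forall fun x => ?_)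
    simp

theorem coeFn_polyL2 (P : ℝ[X]) : polyL2 M δ P =ᵐ[mu M δ] fun x => P.eval (Real.sin x ^ 2) :=
  (memLp_eval M δ P).coeFn_toLp

theorem inner_eq_integral (φ ψ : L2 M δ) : inner ℝ φ ψ = ∫ x, φ x * ψ x ∂(mu M δ) := by
  rw [L2.inner_def]
  refine integral_congr_ae (Filter.Eventually.of_forall fun x => ?_)
  simp only [RCLike.inner_apply, conj_trivial]
  ring

theorem inner_polyL2 (P Q : ℝ[X]) : inner ℝ (polyL2 M δ P) (polyL2 M δ Q)
    = betaInt (sinExp M δ) (cosExp M δ) (P * Q) := by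
  rw [inner_eq_integral, ← integral_mu_eval]
  refine integral_congr_ae ?_
  filter_upwards [coeFn_polyL2 (M := M) (δ := δ) P, coeFn_polyL2 (M := M) (δ := δ) Q] with x h1 h2
  rw [h1, h2, eval_mul]

theorem eigenmode_eq (M : Model) (δ n : ℕ) : eigenmode M δ n = polyL2 M δ (modePoly M δ n) :=
  MemLp.toLp_congr _ (memLp_eval M δ _)
    (Filter.Eventually.of_forall fun x => eigenfun_eq M δ n x)

theorem orthonormal_eigenmode (hδ : Admissible M δ) : Orthonormal ℝ (eigenmode M δ) := by
  rw [orthonormal_iff_ite]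
  intro i j
  rw [eigenmode_eq, eigenmode_eq, inner_polyL2, betaInt_modePoly_mul hδ]

theorem polyL2_mem_span (hδ : Admissible M δ) (P : ℝ[X]) :
    polyL2 M δ P ∈ Submodule.span ℝ (range (eigenmode M δ)) := by
  obtain ⟨c, hc⟩ := exists_modePoly_sum hδ (P.natDegree + 1) P (Nat.lt_succ_self _)
  rw [hc, map_sum]
  refine Submodule.sum_mem _ fun n _ => ?_
  rw [← smul_eq_C_mul, map_smul, ← eigenmode_eq]
  exact Submodule.smul_mem _ _ (Submodule.subset_span ⟨n, rfl⟩)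

theorem integrable_weight_mul (φ : L2 M δ) {f : ℝ → ℝ} (hf : Continuous f) :
    IntegrableOn (fun x => weight M δ x * (φ x * f x)) (Ioo 0 (Real.pi / 2)) := by
  have h : Integrable (fun x => φ x * f x) (mu M δ) :=
    (Lp.memLp φ).integrable_mul (memLp_of_continuous M δ hf)
  unfold mu at h
  rw [integrable_withDensity_iff_integrable_smul'
    (continuous_weight M δ).measurable.ennreal_ofReal
    (Filter.Eventually.of_forall fun x => ENNReal.ofReal_lt_top)] at h
  refine h.congr ?_
  filter_upwards [ae_restrict_mem measurableSet_Ioo] with x hx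
  rw [ENNReal.toReal_ofReal (weight_pos M δ hx).le, smul_eq_mul]
  rfl

/-- Weierstrass approximation in z = sin² x: a test function is a continuous function of z, and φw
is integrable, so orthogonality to polynomials passes to all test functions. -/
theorem eq_zero_of_inner_polyL2 (φ : L2 M δ) (h : ∀ P : ℝ[X], inner ℝ (polyL2 M δ P) φ = 0) :
    φ = 0 := by
  have hint : IntegrableOn (fun x => φ x * weight M δ x) (Ioo 0 (Real.pi / 2)) := by
    have := integrable_weight_mul φ (f := fun _ => 1) continuous_const
    refine this.congr (Filter.Eventually.of_forall fun x => ?_)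
    simp only
    ring
  have hP : ∀ P : ℝ[X], ∫ x in Ioo 0 (Real.pi / 2), φ x * weight M δ x * P.eval (Real.sin x ^ 2) = 0 := by
    intro P
    refine Eq.trans ?_ (h P)
    rw [inner_eq_integral]
    have : ∫ x, polyL2 M δ P x * φ x ∂(mu M δ) = ∫ x, P.eval (Real.sin x ^ 2) * φ x ∂(mu M δ) := by
      refine integral_congr_ae ?_
      filter_upwards [coeFn_polyL2 (M := M) (δ := δ) P] with x hx
      rw [hx]
    rw [this, integral_mu]
    refine integral_congr_ae (Filter.Eventually.of_forall fun x => ?_)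
    simp only
    ring
  have hz : (fun x => φ x * weight M δ x) =ᵐ[volume.restrict (Ioo 0 (Real.pi / 2))] 0 := by
    refine ae_eq_zero_of_test hint.locallyIntegrableOn fun η hη => ?_
    have hη0 : Continuous η := hη.1.continuous
    by_contra hne
    set I := ∫ x in Ioo 0 (Real.pi / 2), φ x * weight M δ x * η x with hI
    set K := ∫ x in Ioo 0 (Real.pi / 2), ‖φ x * weight M δ x‖ with hK
    have hK0 : 0 ≤ K := integral_nonneg fun x => norm_nonneg _
    have hIpos : 0 < |I| := abs_pos.2 hne
    -- With this tolerance the error is at most |I|K/(2(K + 1)) < |I|, a contradiction.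
    obtain ⟨P, hPn⟩ := exists_polynomial_near_of_continuousOn 0 1
      (fun z => η (Real.arcsin (Real.sqrt z))) (by fun_prop) (|I| / (2 * (K + 1))) (by positivity)
    have hcl : ∀ x ∈ Ioo 0 (Real.pi / 2), |η x - P.eval (Real.sin x ^ 2)| ≤ |I| / (2 * (K + 1)) := by
      intro x hx
      have hs : 0 ≤ Real.sin x := Real.sin_nonneg_of_nonneg_of_le_pi hx.1.le
        (by linarith [hx.2, Real.pi_pos])
      have := hPn (Real.sin x ^ 2) ⟨by positivity, Real.sin_sq_le_one x⟩
      rw [Real.sqrt_sq hs, Real.arcsin_sin (by linarith [hx.1, Real.pi_pos]) hx.2.le, abs_sub_comm]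
        at this
      exact this.le
    have i1 : IntegrableOn (fun x => φ x * weight M δ x * η x) (Ioo 0 (Real.pi / 2)) := by
      refine (integrable_weight_mul φ hη0).congr (Filter.Eventually.of_forall fun x => ?_)
      simp only
      ring
    have i2 : IntegrableOn (fun x => φ x * weight M δ x * P.eval (Real.sin x ^ 2))
        (Ioo 0 (Real.pi / 2)) := by
      refine (integrable_weight_mul φ (f := fun x => P.eval (Real.sin x ^ 2)) (by fun_prop)).congr
        (Filter.Eventually.of_forall fun x => ?_)
      simp only
      ring
    have e : I = ∫ x in Ioo 0 (Real.pi / 2), φ x * weight M δ x * (η x - P.eval (Real.sin x ^ 2)) := by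
      simp only [mul_sub]
      rw [integral_sub i1 i2, hP, sub_zero]
    have b : |I| ≤ |I| / (2 * (K + 1)) * K := by
      nth_rw 1 [e]
      rw [← Real.norm_eq_abs, hK, ← integral_const_mul]
      refine norm_integral_le_of_norm_le (hint.norm.const_mul _) ?_
      filter_upwards [ae_restrict_mem measurableSet_Ioo] with x hx
      rw [norm_mul, mul_comm, Real.norm_eq_abs (η x - _)]
      exact mul_le_mul_of_nonneg_right (hcl x hx) (norm_nonneg _)
    have b2 : |I| / (2 * (K + 1)) * K < |I| := by
      rw [div_mul_eq_mul_div, div_lt_iff₀ (by positivity)]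
      nlinarith
    linarith
  refine L2_eq_zero_of_ae ?_
  filter_upwards [hz, ae_restrict_mem measurableSet_Ioo] with x hx hxI
  exact (mul_eq_zero.1 hx).resolve_right (weight_pos M δ hxI).ne'

/-- The eigenfunctions form a Hilbert basis of `L²`. -/
def modeBasis (hδ : Admissible M δ) : HilbertBasis ℕ ℝ (L2 M δ) :=
  HilbertBasis.mkOfOrthogonalEqBot (orthonormal_eigenmode hδ) (by
    rw [Submodule.eq_bot_iff]
    intro φ hφ
    exact eq_zero_of_inner_polyL2 φ fun P =>
      (Submodule.mem_orthogonal _ _).1 hφ _ (polyL2_mem_span hδ P))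

theorem modeBasis_apply (hδ : Admissible M δ) (n : ℕ) : modeBasis hδ n = eigenmode M δ n := by
  rw [modeBasis, HilbertBasis.coe_mkOfOrthogonalEqBot]

theorem modeBasis_repr (hδ : Admissible M δ) (φ : L2 M δ) (n : ℕ) :
    (modeBasis hδ).repr φ n = coeff n φ := by
  rw [HilbertBasis.repr_apply_apply, modeBasis_apply]
  rfl

/-! ### Integration by parts up to the endpoints -/

theorem exists_deriv_smoothTransition_bound : ∃ D : ℝ, 0 ≤ D ∧ ∀ y : ℝ,
    |deriv Real.smoothTransition y| ≤ D ∧ (1 < y → deriv Real.smoothTransition y = 0) := by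
  have hc : Continuous (deriv Real.smoothTransition) :=
    (Real.smoothTransition.contDiff (n := 1)).continuous_deriv (by simp)
  obtain ⟨D, hD⟩ := isCompact_Icc.exists_bound_of_continuousOn (s := Icc (0 : ℝ) 1) hc.continuousOn
  have h1 : ∀ y : ℝ, 1 < y → deriv Real.smoothTransition y = 0 := by
    intro y hy
    have : Real.smoothTransition =ᶠ[nhds y] fun _ => 1 := by
      filter_upwards [lt_mem_nhds hy] with z hz using Real.smoothTransition.one_of_one_le hz.le
    rw [this.deriv_eq, deriv_const]
  have h0 : ∀ y : ℝ, y < 0 → deriv Real.smoothTransition y = 0 := by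
    intro y hy
    have : Real.smoothTransition =ᶠ[nhds y] fun _ => 0 := by
      filter_upwards [gt_mem_nhds hy] with z hz using Real.smoothTransition.zero_of_nonpos hz.le
    rw [this.deriv_eq, deriv_const]
  refine ⟨max D 0, le_max_right _ _, fun y => ⟨?_, h1 y⟩⟩
  rcases lt_or_ge y 0 with h | h
  · simp [h0 y h]
  · rcases lt_or_ge 1 y with h' | h'
    · simp [h1 y h']
    · exact (hD y ⟨h, h'⟩).trans (le_max_left _ _)

/-- The cutoff functions. -/
def cutoff (k : ℕ) (x : ℝ) : ℝ := Real.smoothTransition (k * (x * (Real.pi / 2 - x)) - 1)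

theorem contDiff_cutoff (k : ℕ) : ContDiff ℝ ∞ (cutoff k) :=
  Real.smoothTransition.contDiff.comp (by fun_prop)

theorem hasDerivAt_cutoff (k : ℕ) (x : ℝ) : HasDerivAt (cutoff k)
    (deriv Real.smoothTransition (k * (x * (Real.pi / 2 - x)) - 1) * (k * (Real.pi / 2 - 2 * x))) x := by
  have h1 : HasDerivAt Real.smoothTransition
      (deriv Real.smoothTransition (k * (x * (Real.pi / 2 - x)) - 1))
      (k * (x * (Real.pi / 2 - x)) - 1) :=
    ((Real.smoothTransition.contDiff (n := 1)).differentiable (by simp) _).hasDerivAt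
  have h2 : HasDerivAt (fun x : ℝ => (k : ℝ) * (x * (Real.pi / 2 - x)) - 1)
      (k * (Real.pi / 2 - 2 * x)) x := by
    refine ((((hasDerivAt_id x).mul ((hasDerivAt_const x (Real.pi / 2)).sub
      (hasDerivAt_id x))).const_mul (k : ℝ)).sub_const 1).congr_deriv ?_
    simp only [id, Pi.sub_apply]
    ring
  exact h1.comp x h2

/-- The cutoff vanishes unless k·x(π/2 - x) ≥ 1, a set which is compactly contained in the open
interval. -/
theorem isTest_cutoff_mul (k : ℕ) {F : ℝ → ℝ} (hF : ContDiff ℝ ∞ F) :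
    IsTest fun x => cutoff k x * F x := by
  have hs : tsupport (fun x => cutoff k x * F x)
      ⊆ {x : ℝ | 1 ≤ (k : ℝ) * (x * (Real.pi / 2 - x))} := by
    refine closure_minimal (fun x hx => ?_) (isClosed_le (by fun_prop) (by fun_prop))
    by_contra h
    simp only [mem_ofPred_eq, not_le] at h
    exact hx (by
      change cutoff k x * F x = 0
      rw [cutoff, Real.smoothTransition.zero_of_nonpos (by linarith), zero_mul])
  have hI : {x : ℝ | 1 ≤ (k : ℝ) * (x * (Real.pi / 2 - x))} ⊆ Ioo 0 (Real.pi / 2) := by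
    intro x hx
    have hk : (0 : ℝ) ≤ k := k.cast_nonneg
    have hp : 0 < x * (Real.pi / 2 - x) := by
      by_contra h
      have := mul_nonpos_of_nonneg_of_nonpos hk (not_lt.1 h)
      simp only [mem_ofPred_eq] at hx
      linarith
    have := Real.pi_pos
    constructor <;> by_contra h <;> rw [not_lt] at h <;> nlinarith
  exact ⟨(contDiff_cutoff k).mul hF, (isCompact_Icc (a := 0) (b := Real.pi / 2)).of_isClosed_subset
    (isClosed_tsupport _) (hs.trans (hI.trans Ioo_subset_Icc_self)), hs.trans hI⟩

/-- Integration by parts against functions whose boundary terms vanish. -/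
theorem HasWeakDeriv.integral_mul_eval {ψ ψ' : L2 M δ} (h : HasWeakDeriv ψ ψ') (G : ℝ[X]) :
    ∫ x, ψ x * ((C ((sinExp M δ : ℝ) + 1) * (1 - X) - C ((cosExp M δ : ℝ) + 1) * X) * G
        + 2 * X * (1 - X) * derivative G).eval (Real.sin x ^ 2) ∂(mu M δ)
      = - ∫ x, ψ' x * (Real.sin x * Real.cos x * G.eval (Real.sin x ^ 2)) ∂(mu M δ) := by
  set H := (C ((sinExp M δ : ℝ) + 1) * (1 - X) - C ((cosExp M δ : ℝ) + 1) * X) * G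
        + 2 * X * (1 - X) * derivative G with hH
  set F : ℝ → ℝ := fun x => Real.sin x ^ (sinExp M δ + 1) * Real.cos x ^ (cosExp M δ + 1)
    * G.eval (Real.sin x ^ 2) with hF
  have hFw : ∀ x, F x = weight M δ x * (Real.sin x * Real.cos x * G.eval (Real.sin x ^ 2)) := by
    intro x
    rw [hF, weight_eq]
    ring
  have hFs : ContDiff ℝ ∞ F := by
    have : ContDiff ℝ ∞ fun x => G.eval (Real.sin x ^ 2) := by
      simp only [eval_eq_sum_range]
      exact ContDiff.sum fun i _ => contDiff_const.mul ((Real.contDiff_sin.pow 2).pow i)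
    exact ((Real.contDiff_sin.pow _).mul (Real.contDiff_cos.pow _)).mul this
  have hFd : ∀ x, HasDerivAt F (weight M δ x * H.eval (Real.sin x ^ 2)) x := by
    intro x
    rw [weight_eq]
    exact hasDerivAt_sin_cos_eval _ _ G x
  obtain ⟨D, hD0, hD⟩ := exists_deriv_smoothTransition_bound
  obtain ⟨K, hK⟩ := isCompact_Icc.exists_bound_of_continuousOn (s := Icc 0 (Real.pi / 2))
    (f := fun x => G.eval (Real.sin x ^ 2)) (by fun_prop)
  have hψ := integrable_weight_mul ψ (f := fun _ => 1) continuous_const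
  have hψH := integrable_weight_mul ψ (f := fun x => H.eval (Real.sin x ^ 2)) (by fun_prop)
  have hψ'G := integrable_weight_mul ψ'
    (f := fun x => Real.sin x * Real.cos x * G.eval (Real.sin x ^ 2)) (by fun_prop)
  rw [integral_mu, integral_mu]
  have hd : ∀ (k : ℕ) (x : ℝ), deriv (fun x => cutoff k x * F x) x
      = deriv Real.smoothTransition (k * (x * (Real.pi / 2 - x)) - 1) * (k * (Real.pi / 2 - 2 * x)) * F x
        + cutoff k x * (weight M δ x * H.eval (Real.sin x ^ 2)) :=
    fun k x => ((hasDerivAt_cutoff k x).mul (hFd x)).deriv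
  have hlim : ∀ x ∈ Ioo 0 (Real.pi / 2), ∀ᶠ k : ℕ in Filter.atTop,
      1 < (k : ℝ) * (x * (Real.pi / 2 - x)) - 1 := by
    intro x hx
    have hv : 0 < x * (Real.pi / 2 - x) := mul_pos hx.1 (by linarith [hx.2])
    have : Filter.Tendsto (fun k : ℕ => (k : ℝ) * (x * (Real.pi / 2 - x))) Filter.atTop Filter.atTop :=
      tendsto_natCast_atTop_atTop.atTop_mul_const hv
    filter_upwards [this.eventually_gt_atTop 2] with k hk
    linarith
  have hcut : ∀ k x, ‖cutoff k x‖ ≤ 1 := fun k x => by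
    rw [Real.norm_eq_abs, cutoff, abs_of_nonneg (Real.smoothTransition.nonneg _)]
    exact Real.smoothTransition.le_one _
  have t2 : Filter.Tendsto (fun k : ℕ => ∫ x in Ioo 0 (Real.pi / 2), ψ' x * (cutoff k x * F x))
      Filter.atTop (nhds (∫ x in Ioo 0 (Real.pi / 2), weight M δ x * (ψ' x
        * (Real.sin x * Real.cos x * G.eval (Real.sin x ^ 2))))) := by
    refine tendsto_integral_of_dominated_convergence _ (fun k => ?_) hψ'G.norm (fun k => ?_) ?_
    · exact ((isTest_cutoff_mul k hFs).integrable ψ').aestronglyMeasurable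
    · refine Filter.Eventually.of_forall fun x => ?_
      calc ‖ψ' x * (cutoff k x * F x)‖ = ‖cutoff k x‖ * ‖ψ' x * F x‖ := by
            rw [← norm_mul]
            congr 1
            ring
        _ ≤ 1 * ‖ψ' x * F x‖ := by gcongr; exact hcut k x
        _ = _ := by
            rw [one_mul, hFw]
            congr 1
            ring
    · filter_upwards [ae_restrict_mem measurableSet_Ioo] with x hx
      refine tendsto_const_nhds.congr' ?_
      filter_upwards [hlim x hx] with k hk
      rw [cutoff, Real.smoothTransition.one_of_one_le hk.le, hFw]
      ring
  have t1 : Filter.Tendsto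
      (fun k : ℕ => ∫ x in Ioo 0 (Real.pi / 2), ψ x * deriv (fun x => cutoff k x * F x) x)
      Filter.atTop (nhds (∫ x in Ioo 0 (Real.pi / 2), weight M δ x * (ψ x
        * H.eval (Real.sin x ^ 2)))) := by
    refine tendsto_integral_of_dominated_convergence
      (fun x => D * (2 * (Real.pi / 2)) * K * ‖weight M δ x * (ψ x * 1)‖
        + ‖weight M δ x * (ψ x * H.eval (Real.sin x ^ 2))‖) (fun k => ?_)
      ((hψ.norm.const_mul _).add hψH.norm) (fun k => ?_) ?_
    · exact ((isTest_cutoff_mul k hFs).integrable_deriv ψ).aestronglyMeasurable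
    · filter_upwards [ae_restrict_mem measurableSet_Ioo] with x hx
      have hw := weight_pos M δ hx
      have hv1 : 0 < x := hx.1
      have hv2 : 0 < Real.pi / 2 - x := by linarith [hx.2]
      rw [hd, mul_add]
      refine (norm_add_le _ _).trans (add_le_add ?_ ?_)
      · set y := (k : ℝ) * (x * (Real.pi / 2 - x)) - 1 with hy
        have hk0 : (0 : ℝ) ≤ k := k.cast_nonneg
        have hsc : |Real.sin x * Real.cos x| ≤ x * (Real.pi / 2 - x) := by
          have s0 : 0 ≤ Real.sin x := Real.sin_nonneg_of_nonneg_of_le_pi hv1.le (by linarith)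
          have c0 : 0 ≤ Real.cos x := Real.cos_nonneg_of_neg_pi_div_two_le_of_le (by linarith) hx.2.le
          rw [abs_of_nonneg (mul_nonneg s0 c0)]
          have h1 := Real.sin_le hv1.le
          have h2 : Real.cos x ≤ Real.pi / 2 - x := by
            rw [← Real.sin_pi_div_two_sub]
            exact Real.sin_le hv2.le
          gcongr
        have hGx : |G.eval (Real.sin x ^ 2)| ≤ K := hK x (Ioo_subset_Icc_self hx)
        have hK0 : 0 ≤ K := (abs_nonneg _).trans hGx
        have hp : |Real.pi / 2 - 2 * x| ≤ Real.pi / 2 := by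
          rw [abs_le]
          constructor <;> linarith
        -- The derivative of the cutoff is of order k, but it is nonzero only where k·x(π/2 - x) ≤
        -- 2. The extra factor sin x cos x ≤ x(π/2 - x) of F therefore compensates it uniformly in
        -- k, and dominated convergence applies.
        have key : |deriv Real.smoothTransition y| * (k * (x * (Real.pi / 2 - x))) ≤ D * 2 := by
          rcases lt_or_ge 1 y with h1 | h1
          · rw [(hD y).2 h1, abs_zero, zero_mul]
            positivity
          · exact mul_le_mul (hD y).1 (by linarith) (by positivity) hD0
        rw [hFw]
        calc ‖ψ x * (deriv Real.smoothTransition y * (k * (Real.pi / 2 - 2 * x))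
              * (weight M δ x * (Real.sin x * Real.cos x * G.eval (Real.sin x ^ 2))))‖
            = |deriv Real.smoothTransition y| * (k * |Real.sin x * Real.cos x|) * |Real.pi / 2 - 2 * x|
              * |G.eval (Real.sin x ^ 2)| * ‖weight M δ x * (ψ x * 1)‖ := by
              simp only [Real.norm_eq_abs, abs_mul, Nat.abs_cast, mul_one]
              ring
          _ ≤ |deriv Real.smoothTransition y| * (k * (x * (Real.pi / 2 - x))) * (Real.pi / 2) * K
              * ‖weight M δ x * (ψ x * 1)‖ := by gcongr
          _ ≤ D * 2 * (Real.pi / 2) * K * ‖weight M δ x * (ψ x * 1)‖ := by gcongr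
          _ = _ := by ring
      · calc ‖ψ x * (cutoff k x * (weight M δ x * H.eval (Real.sin x ^ 2)))‖
            = ‖cutoff k x‖ * ‖weight M δ x * (ψ x * H.eval (Real.sin x ^ 2))‖ := by
              rw [← norm_mul]
              congr 1
              ring
          _ ≤ 1 * ‖weight M δ x * (ψ x * H.eval (Real.sin x ^ 2))‖ := by
              gcongr
              exact hcut k x
          _ = _ := one_mul _
    · filter_upwards [ae_restrict_mem measurableSet_Ioo] with x hx
      refine tendsto_const_nhds.congr' ?_
      filter_upwards [hlim x hx] with k hk
      rw [hd, (hD _).2 hk, cutoff, Real.smoothTransition.one_of_one_le hk.le]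
      ring
  exact tendsto_nhds_unique t1 (t2.neg.congr fun k => (h _ (isTest_cutoff_mul k hFs)).symm)

/-- The classical derivative of `P(sin² x)`. -/
theorem hasDerivAt_eval_sin_sq (P : ℝ[X]) (x : ℝ) :
    HasDerivAt (fun x => P.eval (Real.sin x ^ 2))
      (Real.sin x * Real.cos x * (C 2 * derivative P).eval (Real.sin x ^ 2)) x := by
  refine ((P.hasDerivAt (Real.sin x ^ 2)).comp x ((Real.hasDerivAt_sin x).pow 2)).congr_deriv ?_
  simp only [eval_mul, eval_C, Nat.cast_ofNat]
  ring

theorem memLp_deriv_eval (M : Model) (δ : ℕ) (P : ℝ[X]) :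
    MemLp (fun x => Real.sin x * Real.cos x * (C 2 * derivative P).eval (Real.sin x ^ 2)) 2 (mu M δ) :=
  memLp_of_continuous M δ (by fun_prop)

theorem hasWeakDeriv_polyL2 (P : ℝ[X]) :
    HasWeakDeriv (polyL2 M δ P) ((memLp_deriv_eval M δ P).toLp _) := by
  intro η hη
  have r : ∀ (f ρ : ℝ → ℝ) (hf : MemLp f 2 (mu M δ)), tsupport ρ ⊆ Ioo 0 (Real.pi / 2) →
      ∫ x in Ioo 0 (Real.pi / 2), hf.toLp f x * ρ x = ∫ x, f x * ρ x := by
    intro f ρ hf hρ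
    have : ∫ x in Ioo 0 (Real.pi / 2), hf.toLp f x * ρ x = ∫ x in Ioo 0 (Real.pi / 2), f x * ρ x := by
      refine integral_congr_ae ?_
      filter_upwards [restrict_absolutelyContinuous_mu M δ hf.coeFn_toLp] with x hx
      rw [hx]
    rw [this]
    refine setIntegral_eq_integral_of_forall_compl_eq_zero fun x hx => ?_
    rw [image_eq_zero_of_notMem_tsupport (fun h => hx (hρ h)), mul_zero]
  have cη' : Continuous (deriv η) := hη.1.continuous_deriv (by simp)
  have cP : Continuous fun x => P.eval (Real.sin x ^ 2) := by fun_prop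
  have cP' : Continuous fun x => Real.sin x * Real.cos x * (C 2 * derivative P).eval (Real.sin x ^ 2) := by
    fun_prop
  rw [r _ _ (memLp_deriv_eval M δ P) hη.2.2]
  refine (r _ _ (memLp_eval M δ P) ((tsupport_deriv_subset).trans hη.2.2)).trans ?_
  exact integral_mul_deriv_eq_deriv_mul_of_integrable
    (fun x _ => hasDerivAt_eval_sin_sq P x)
    (fun x _ => (hη.1.differentiable (by simp) x).hasDerivAt)
    ((cP.mul cη').integrable_of_hasCompactSupport hη.2.1.deriv.mul_left)
    ((cP'.mul hη.1.continuous).integrable_of_hasCompactSupport hη.2.1.mul_left)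
    ((cP.mul hη.1.continuous).integrable_of_hasCompactSupport hη.2.1.mul_left)

theorem solvesJacobi_modePoly (M : Model) (δ n : ℕ) : SolvesJacobi (jacA M δ) (jacB M δ)
    (n * (n + jacA M δ + jacB M δ + 1)) (modePoly M δ n) := by
  have h := solvesJacobi_jacobiPoly n (jacA M δ) (jacB M δ)
  unfold SolvesJacobi at h ⊢
  rw [modePoly]
  simp only [derivative_C_mul]
  linear_combination C (normConst M δ n) * h

/-- The form identity is the integration by parts with G = 2P'. By the Jacobi equation its
polynomial is -4lP, and 4l = ω_n² - c. -/
theorem isL_eigenmode (hδ : Admissible M δ) (n : ℕ) :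
    IsL (eigenmode M δ n) (freq M δ n ^ 2 • eigenmode M δ n) := by
  rw [eigenmode_eq]
  refine ⟨_, hasWeakDeriv_polyL2 _, fun ψ ψ' hψ => ?_⟩
  have h := hψ.integral_mul_eval (C 2 * derivative (modePoly M δ n))
  have hs := solvesJacobi_modePoly M δ n
  unfold SolvesJacobi at hs
  set P := modePoly M δ n with hP
  set l : ℝ := n * (n + jacA M δ + jacB M δ + 1) with hl
  have e : (C ((sinExp M δ : ℝ) + 1) * (1 - X) - C ((cosExp M δ : ℝ) + 1) * X) * (C 2 * derivative P)
        + 2 * X * (1 - X) * derivative (C 2 * derivative P) = C (-4 * l) * P := by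
    rw [sinExp_eq, cosExp_eq hδ, derivative_C_mul]
    simp only [C_add, C_mul, map_ofNat, map_one, C_neg] at hs ⊢
    linear_combination 4 * hs
  rw [e] at h
  have hf : freq M δ n ^ 2 = massSq M δ + 4 * l := by
    rw [freq_eq, massSq_eq, hl]
    linear_combination -4 * (n : ℝ) * baseFreq_eq M δ * (-1)
  have i1 : inner ℝ ((memLp_deriv_eval M δ P).toLp _) ψ' = ∫ x, ψ' x * (Real.sin x * Real.cos x
      * (C 2 * derivative P).eval (Real.sin x ^ 2)) ∂(mu M δ) := by
    rw [inner_eq_integral]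
    refine integral_congr_ae ?_
    filter_upwards [(memLp_deriv_eval M δ P).coeFn_toLp] with x hx
    rw [hx, mul_comm]
  have i2 : 4 * l * inner ℝ (polyL2 M δ P) ψ
      = - ∫ x, ψ x * (C (-4 * l) * P).eval (Real.sin x ^ 2) ∂(mu M δ) := by
    rw [inner_eq_integral, ← integral_const_mul, ← integral_neg]
    refine integral_congr_ae ?_
    filter_upwards [coeFn_polyL2 (M := M) (δ := δ) P] with x hx
    rw [hx, eval_mul, eval_C]
    ring
  rw [real_inner_smul_left, hf, add_mul, i2, i1, h]
  ring

theorem eigenmode_mem_domL (hδ : Admissible M δ) (n : ℕ) : eigenmode M δ n ∈ domL M δ :=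
  ⟨_, isL_eigenmode hδ n⟩

/-- Symmetry of the form: testing the equation for φ with e_n and the equation for e_n with φ gives
the same number. -/
theorem IsL.coeff_eq (hδ : Admissible M δ) {φ g : L2 M δ} (h : IsL φ g) (n : ℕ) :
    coeff n g = freq M δ n ^ 2 * coeff n φ := by
  obtain ⟨φ', h1, h2⟩ := h
  obtain ⟨e', k1, k2⟩ := isL_eigenmode hδ n
  have a := h2 _ _ k1
  have b := k2 _ _ h1
  rw [real_inner_smul_left] at b
  rw [coeff, coeff, ← b, real_inner_comm, ← a, real_inner_comm φ', real_inner_comm φ]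

theorem coeff_opL (hδ : Admissible M δ) (φ : domL M δ) (n : ℕ) :
    coeff n (opL φ) = freq M δ n ^ 2 * coeff n (φ : L2 M δ) :=
  ((isL_iff φ _).2 rfl).coeff_eq hδ n

/-! ### Pointwise bounds from the graph norm -/

/-- The polynomial `q` with `(sin^(A+1) cos^(B+1) G(sin²))' = sin^A cos^B q(sin²)`. -/
def fluxPoly (A B : ℕ) (G : ℝ[X]) : ℝ[X] :=
  (C ((A : ℝ) + 1) * (1 - X) - C ((B : ℝ) + 1) * X) * G + 2 * X * (1 - X) * derivative G

theorem sin_nonneg_of_mem {x : ℝ} (hx : x ∈ Icc 0 (Real.pi / 2)) : 0 ≤ Real.sin x :=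
  Real.sin_nonneg_of_nonneg_of_le_pi hx.1 (by linarith [hx.2, Real.pi_pos])

theorem cos_nonneg_of_mem {x : ℝ} (hx : x ∈ Icc 0 (Real.pi / 2)) : 0 ≤ Real.cos x :=
  Real.cos_nonneg_of_neg_pi_div_two_le_of_le (by linarith [hx.1, Real.pi_pos]) hx.2

theorem sin_pos_of_mem {x : ℝ} (hx : x ∈ Ioo 0 (Real.pi / 2)) : 0 < Real.sin x :=
  Real.sin_pos_of_pos_of_lt_pi hx.1 (by linarith [hx.2, Real.pi_pos])

theorem cos_pos_of_mem {x : ℝ} (hx : x ∈ Ioo 0 (Real.pi / 2)) : 0 < Real.cos x :=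
  Real.cos_pos_of_mem_Ioo ⟨by linarith [hx.1, Real.pi_pos], hx.2⟩

theorem setIntegral_le_betaInt (A B : ℕ) {P : ℝ[X]} (hP : ∀ z, 0 ≤ P.eval z) {u v : ℝ} (hu : 0 ≤ u)
    (huv : u ≤ v) (hv : v ≤ Real.pi / 2) :
    ∫ x in u..v, Real.sin x ^ A * Real.cos x ^ B * P.eval (Real.sin x ^ 2) ≤ betaInt A B P := by
  rw [betaInt_apply]
  refine intervalIntegral.integral_mono_interval hu huv hv ?_
    ((continuous_betaIntegrand A B P).intervalIntegrable _ _)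
  filter_upwards [ae_restrict_mem measurableSet_Ioc] with x hx
  have := sin_nonneg_of_mem ⟨hx.1.le, hx.2⟩
  have := cos_nonneg_of_mem ⟨hx.1.le, hx.2⟩
  have := hP (Real.sin x ^ 2)
  simp only [Pi.zero_apply]
  positivity

theorem integral_mul_eval_sq_le (A B : ℕ) (q : ℝ[X]) {u v : ℝ} (hu : 0 ≤ u) (huv : u ≤ v)
    (hv : v ≤ Real.pi / 2) :
    (∫ x in u..v, Real.sin x ^ A * Real.cos x ^ B * q.eval (Real.sin x ^ 2)) ^ 2
      ≤ (∫ x in u..v, Real.sin x ^ A * Real.cos x ^ B) * betaInt A B (q * q) := by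
  set f := ∫ x in u..v, Real.sin x ^ A * Real.cos x ^ B * q.eval (Real.sin x ^ 2) with hf
  set a := ∫ x in u..v, Real.sin x ^ A * Real.cos x ^ B with ha
  set b := ∫ x in u..v, Real.sin x ^ A * Real.cos x ^ B * (q * q).eval (Real.sin x ^ 2) with hb
  have hpos : ∀ x ∈ Icc u v, 0 ≤ Real.sin x ^ A * Real.cos x ^ B := by
    intro x hx
    have := sin_nonneg_of_mem ⟨hu.trans hx.1, hx.2.trans hv⟩
    have := cos_nonneg_of_mem ⟨hu.trans hx.1, hx.2.trans hv⟩
    positivity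
  have ha0 : 0 ≤ a := intervalIntegral.integral_nonneg huv hpos
  have hbb : b ≤ betaInt A B (q * q) :=
    setIntegral_le_betaInt A B (fun z => by rw [eval_mul]; exact mul_self_nonneg _) hu huv hv
  -- Cauchy-Schwarz by the discriminant of the nonnegative quadratic t ↦ ∫ w(t + q)².
  have key : ∀ t : ℝ, 0 ≤ a * (t * t) + 2 * f * t + b := by
    intro t
    have e : a * (t * t) + 2 * f * t + b
        = ∫ x in u..v, Real.sin x ^ A * Real.cos x ^ B * (t + q.eval (Real.sin x ^ 2)) ^ 2 := by
      rw [ha, hf, hb, ← intervalIntegral.integral_mul_const, ← intervalIntegral.integral_const_mul,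
        ← intervalIntegral.integral_mul_const, ← intervalIntegral.integral_add,
        ← intervalIntegral.integral_add]
      · congr 1
        funext x
        rw [eval_mul]
        ring
      all_goals exact Continuous.intervalIntegrable (by fun_prop) _ _
    rw [e]
    exact intervalIntegral.integral_nonneg huv fun x hx => mul_nonneg (hpos x hx) (sq_nonneg _)
  have := discrim_le_zero key
  rw [discrim] at this
  have h2 : a * b ≤ a * betaInt A B (q * q) := by gcongr
  nlinarith

theorem integral_sin_cos_left (A B : ℕ) (hB : 1 ≤ B) {x : ℝ} (hx : x ∈ Icc 0 (Real.pi / 2)) :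
    ∫ y in (0 : ℝ)..x, Real.sin y ^ A * Real.cos y ^ B ≤ Real.sin x ^ (A + 1) := by
  have h : ∫ y in (0 : ℝ)..x, ((A : ℝ) + 1) * Real.sin y ^ A * Real.cos y = Real.sin x ^ (A + 1) := by
    rw [intervalIntegral.integral_eq_sub_of_hasDerivAt (f := fun y => Real.sin y ^ (A + 1))
      (fun y _ => ((Real.hasDerivAt_sin y).pow (A + 1)).congr_deriv (by simp))
      (Continuous.intervalIntegrable (by fun_prop) _ _)]
    simp
  rw [← h]
  refine intervalIntegral.integral_mono_on hx.1 (Continuous.intervalIntegrable (by fun_prop) _ _)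
    (Continuous.intervalIntegrable (by fun_prop) _ _) fun y hy => ?_
  have hs := sin_nonneg_of_mem ⟨hy.1, hy.2.trans hx.2⟩
  have hc := cos_nonneg_of_mem ⟨hy.1, hy.2.trans hx.2⟩
  have h1 : Real.cos y ^ B ≤ Real.cos y := pow_le_of_le_one hc (Real.cos_le_one y) (by omega)
  have hA : (1 : ℝ) ≤ (A : ℝ) + 1 := by simp
  calc Real.sin y ^ A * Real.cos y ^ B ≤ Real.sin y ^ A * Real.cos y := by gcongr
    _ = 1 * (Real.sin y ^ A * Real.cos y) := (one_mul _).symm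
    _ ≤ ((A : ℝ) + 1) * (Real.sin y ^ A * Real.cos y) := by gcongr
    _ = _ := by ring

theorem integral_sin_cos_right (A B : ℕ) (hA : 1 ≤ A) {x : ℝ} (hx : x ∈ Icc 0 (Real.pi / 2)) :
    ∫ y in x..(Real.pi / 2), Real.sin y ^ A * Real.cos y ^ B ≤ Real.cos x ^ (B + 1) := by
  have h := integral_sin_cos_left B A hA (x := Real.pi / 2 - x)
    ⟨by linarith [hx.2], by linarith [hx.1]⟩
  rw [Real.sin_pi_div_two_sub] at h
  refine le_trans (le_of_eq ?_) h
  have e := intervalIntegral.integral_comp_sub_left (a := x) (b := Real.pi / 2)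
    (fun y => Real.sin y ^ B * Real.cos y ^ A) (Real.pi / 2)
  rw [sub_self] at e
  rw [← e]
  congr 1
  funext y
  rw [Real.sin_pi_div_two_sub, Real.cos_pi_div_two_sub, mul_comm]

/-- The flux vanishes at both endpoints, so it is the integral of the weight times `fluxPoly` from
either side. Cauchy-Schwarz then bounds it by the mass of the weight on that side, which decays like
a power at the endpoint. -/
theorem flux_sq_le (A B : ℕ) (hA : 1 ≤ A) (hB : 1 ≤ B) (G : ℝ[X]) {x : ℝ}
    (hx : x ∈ Icc 0 (Real.pi / 2)) :
    (Real.sin x ^ (A + 1) * Real.cos x ^ (B + 1) * G.eval (Real.sin x ^ 2)) ^ 2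
        ≤ Real.sin x ^ (A + 1) * betaInt A B (fluxPoly A B G * fluxPoly A B G) ∧
    (Real.sin x ^ (A + 1) * Real.cos x ^ (B + 1) * G.eval (Real.sin x ^ 2)) ^ 2
        ≤ Real.cos x ^ (B + 1) * betaInt A B (fluxPoly A B G * fluxPoly A B G) := by
  have hI : ∀ u v : ℝ, ∫ y in u..v, Real.sin y ^ A * Real.cos y ^ B
      * (fluxPoly A B G).eval (Real.sin y ^ 2)
      = Real.sin v ^ (A + 1) * Real.cos v ^ (B + 1) * G.eval (Real.sin v ^ 2)
        - Real.sin u ^ (A + 1) * Real.cos u ^ (B + 1) * G.eval (Real.sin u ^ 2) := fun u v =>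
    intervalIntegral.integral_eq_sub_of_hasDerivAt (fun y _ => hasDerivAt_sin_cos_eval A B G y)
      ((continuous_betaIntegrand A B _).intervalIntegrable _ _)
  have h0 : 0 ≤ betaInt A B (fluxPoly A B G * fluxPoly A B G) :=
    betaInt_nonneg _ _ fun z _ _ => by rw [eval_mul]; exact mul_self_nonneg _
  constructor
  · have h := integral_mul_eval_sq_le A B (fluxPoly A B G) le_rfl hx.1 hx.2
    rw [hI] at h
    simp only [Real.sin_zero, ne_eq, Nat.succ_ne_zero, not_false_eq_true, zero_pow, zero_mul,
      sub_zero] at h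
    exact h.trans (mul_le_mul_of_nonneg_right (integral_sin_cos_left A B hB hx) h0)
  · have h := integral_mul_eval_sq_le A B (fluxPoly A B G) hx.1 hx.2 le_rfl
    rw [hI] at h
    simp only [Real.cos_pi_div_two, ne_eq, Nat.succ_ne_zero, not_false_eq_true, zero_pow, mul_zero,
      zero_mul, zero_sub, neg_sq] at h
    exact h.trans (mul_le_mul_of_nonneg_right (integral_sin_cos_right A B hA hx) h0)

/-- On the half where s ≤ c one has c² ≥ 1/2, so powers of c cost only constants. The flux bound
gives |d| ≲ n·s^{(1-A)/2}, and A ≤ 2α + 3 says exactly that this is at most n·s^{-α-1}. Exchanging s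
and c covers the other half. -/
theorem deriv_bound_aux {A B : ℕ} {α s c d n : ℝ} (hα : (A : ℝ) ≤ 2 * α + 3)
    (hs : 0 < s) (hc : 0 < c) (hsc : s ^ 2 + c ^ 2 = 1) (hle : s ≤ c) (hn : 0 ≤ n)
    (h : (s ^ A * c ^ B * d) ^ 2 ≤ s ^ (A + 1) * n ^ 2) :
    |d| ≤ n * 2 ^ (B + 1) * (s ^ (-α - 1) * c) := by
  have hc2 : 1 ≤ 2 * c ^ 2 := by nlinarith
  have hs1 : s ≤ 1 := by nlinarith
  refine abs_le_of_sq_le_sq ?_ (by positivity)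
  have e1 : d ^ 2 * (s ^ (A - 1 : ℝ)) * (c ^ 2) ^ B ≤ n ^ 2 := by
    have hsA : s ^ (A - 1 : ℝ) * s ^ (A + 1) = s ^ A * s ^ A := by
      rw [← Real.rpow_natCast s (A + 1), ← Real.rpow_natCast s A, ← Real.rpow_add hs,
        ← Real.rpow_add hs]
      congr 1
      push_cast
      ring
    refine le_of_mul_le_mul_left ?_ (show 0 < s ^ (A + 1) by positivity)
    refine le_trans (le_of_eq ?_) h
    calc s ^ (A + 1) * (d ^ 2 * s ^ (A - 1 : ℝ) * (c ^ 2) ^ B)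
        = (s ^ (A - 1 : ℝ) * s ^ (A + 1)) * d ^ 2 * (c ^ 2) ^ B := by ring
      _ = _ := by rw [hsA]; ring
  have e2 : 1 ≤ 2 ^ (2 * B) * (c ^ 2) ^ B * 1 := by
    rw [pow_mul, ← mul_pow, mul_one]
    exact one_le_pow₀ (by linarith)
  have e3 : 1 ≤ s ^ (-2 * α - 2) * s ^ (A - 1 : ℝ) := by
    rw [← Real.rpow_add hs]
    exact Real.one_le_rpow_of_pos_of_le_one_of_nonpos hs hs1 (by linarith)
  have e4 : (s ^ (-α - 1)) ^ 2 = s ^ (-2 * α - 2) := by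
    rw [← Real.rpow_natCast, ← Real.rpow_mul hs.le]
    congr 1
    push_cast
    ring
  rw [mul_pow, mul_pow, mul_pow, e4, ← pow_mul]
  have hp : 0 < s ^ (-2 * α - 2) := by positivity
  have hq : 0 < s ^ (A - 1 : ℝ) := by positivity
  calc d ^ 2 ≤ d ^ 2 * ((s ^ (-2 * α - 2) * s ^ (A - 1 : ℝ)) * (2 ^ (2 * B) * (c ^ 2) ^ B * 1)
        * (2 * (c ^ 2))) := by
        refine le_mul_of_one_le_right (sq_nonneg _) ?_
        exact one_le_mul_of_one_le_of_one_le (one_le_mul_of_one_le_of_one_le e3 e2) hc2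
    _ = (d ^ 2 * s ^ (A - 1 : ℝ) * (c ^ 2) ^ B) * (2 ^ (2 * B) * 2 * (s ^ (-2 * α - 2) * c ^ 2)) := by
        ring
    _ ≤ n ^ 2 * (2 ^ (2 * B) * 2 * (s ^ (-2 * α - 2) * c ^ 2)) := by gcongr
    _ ≤ n ^ 2 * (2 ^ (2 * B) * 4 * (s ^ (-2 * α - 2) * c ^ 2)) := by gcongr; norm_num
    _ = _ := by ring

/-- A pointwise bound for `P(sin²)` in terms of its graph norm. -/
theorem abs_eval_le_of_betaInt_le (A B : ℕ) (hA : 1 ≤ A) (hB : 1 ≤ B) {α β : ℝ} (hα : 0 < α)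
    (hβ : 0 < β) (hAα : (A : ℝ) ≤ 2 * α + 3) (hBβ : (B : ℝ) ≤ 2 * β + 3) :
    ∃ K : ℝ, 0 ≤ K ∧ ∀ (P : ℝ[X]) (n : ℝ), 0 ≤ n → betaInt A B (P * P) ≤ n ^ 2 →
      betaInt A B (fluxPoly A B (C 2 * derivative P) * fluxPoly A B (C 2 * derivative P)) ≤ n ^ 2 →
      ∀ x ∈ Ioo 0 (Real.pi / 2),
        |P.eval (Real.sin x ^ 2)| ≤ K * n * (Real.sin x ^ (-α) * Real.cos x ^ (-β)) := by
  set k : ℝ := 2 ^ (B + 1) / α + 2 ^ (A + 1) / β with hk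
  have hk0 : 0 ≤ k := by positivity
  set D : ℝ → ℝ := fun x => Real.cos x ^ (-β) - Real.sin x ^ (-α) with hD
  refine ⟨2 ^ (A + B + 1) + k * (1 + 2 ^ α + 2 ^ β), by positivity, fun P n hn hP hG x hx => ?_⟩
  have hDd : ∀ y ∈ Ioo 0 (Real.pi / 2), HasDerivAt D (β * (Real.cos y ^ (-β - 1) * Real.sin y)
      + α * (Real.sin y ^ (-α - 1) * Real.cos y)) y := by
    intro y hy
    have h1 := (Real.hasDerivAt_cos y).rpow_const (p := -β) (Or.inl (cos_pos_of_mem hy).ne')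
    have h2 := (Real.hasDerivAt_sin y).rpow_const (p := -α) (Or.inl (sin_pos_of_mem hy).ne')
    refine (h1.sub h2).congr_deriv ?_
    ring
  have hPd := hasDerivAt_eval_sin_sq P
  have hb : ∀ y ∈ Ioo 0 (Real.pi / 2),
      |Real.sin y * Real.cos y * (C 2 * derivative P).eval (Real.sin y ^ 2)|
        ≤ n * k * (β * (Real.cos y ^ (-β - 1) * Real.sin y)
          + α * (Real.sin y ^ (-α - 1) * Real.cos y)) := by
    intro y hy
    have hs := sin_pos_of_mem hy
    have hc := cos_pos_of_mem hy
    have hsc := Real.sin_sq_add_cos_sq y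
    obtain ⟨f1, f2⟩ := flux_sq_le A B hA hB (C 2 * derivative P) (Ioo_subset_Icc_self hy)
    have e : Real.sin y ^ (A + 1) * Real.cos y ^ (B + 1) * (C 2 * derivative P).eval (Real.sin y ^ 2)
        = Real.sin y ^ A * Real.cos y ^ B
          * (Real.sin y * Real.cos y * (C 2 * derivative P).eval (Real.sin y ^ 2)) := by ring
    rw [e] at f1 f2
    set d := Real.sin y * Real.cos y * (C 2 * derivative P).eval (Real.sin y ^ 2) with hd
    have p1 : 0 < Real.sin y ^ (-α - 1) * Real.cos y := by positivity
    have p2 : 0 < Real.cos y ^ (-β - 1) * Real.sin y := by positivity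
    have k1 : 2 ^ (B + 1) ≤ k * α := by
      rw [hk, add_mul, div_mul_cancel₀ _ hα.ne']
      exact le_add_of_nonneg_right (by positivity)
    have k2 : 2 ^ (A + 1) ≤ k * β := by
      rw [hk, add_mul, div_mul_cancel₀ _ hβ.ne']
      exact le_add_of_nonneg_left (by positivity)
    rcases le_total (Real.sin y) (Real.cos y) with h | h
    · refine (deriv_bound_aux hAα hs hc hsc h hn (f1.trans (by gcongr))).trans ?_
      calc n * 2 ^ (B + 1) * (Real.sin y ^ (-α - 1) * Real.cos y)
          ≤ n * (k * α) * (Real.sin y ^ (-α - 1) * Real.cos y) := by gcongr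
        _ ≤ n * (k * α) * (Real.sin y ^ (-α - 1) * Real.cos y)
            + n * (k * β) * (Real.cos y ^ (-β - 1) * Real.sin y) :=
          le_add_of_nonneg_right (by positivity)
        _ = _ := by ring
    · have f3 : (Real.cos y ^ B * Real.sin y ^ A * d) ^ 2 ≤ Real.cos y ^ (B + 1) * n ^ 2 := by
        rw [mul_comm (Real.cos y ^ B)]
        exact f2.trans (by gcongr)
      refine (deriv_bound_aux hBβ hc hs (by linarith) h hn f3).trans ?_
      calc n * 2 ^ (A + 1) * (Real.cos y ^ (-β - 1) * Real.sin y)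
          ≤ n * (k * β) * (Real.cos y ^ (-β - 1) * Real.sin y) := by gcongr
        _ ≤ n * (k * α) * (Real.sin y ^ (-α - 1) * Real.cos y)
            + n * (k * β) * (Real.cos y ^ (-β - 1) * Real.sin y) :=
          le_add_of_nonneg_left (by positivity)
        _ = _ := by ring
  -- By `hb` the derivative of nk·D dominates that of ±P, so nk·D ± P is increasing. Increments of P
  -- are thus controlled by increments of D without integrating.
  have hmono : ∀ σ : ℝ, |σ| = 1 → MonotoneOn (fun y => n * k * D y + σ * P.eval (Real.sin y ^ 2))
      (Ioo 0 (Real.pi / 2)) := by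
    intro σ hσ
    have hdv : ∀ y ∈ Ioo 0 (Real.pi / 2), HasDerivAt
        (fun y => n * k * D y + σ * P.eval (Real.sin y ^ 2)) _ y := fun y hy =>
      ((hDd y hy).const_mul (n * k)).add ((hPd y).const_mul σ)
    refine monotoneOn_of_deriv_nonneg (convex_Ioo _ _)
      (fun y hy => (hdv y hy).continuousAt.continuousWithinAt)
      (fun y hy => (hdv y (interior_subset hy)).differentiableAt.differentiableWithinAt)
      fun y hy => ?_
    have hy' := interior_subset hy
    rw [(hdv y hy').deriv]
    have h1 := hb y hy'
    have h0 : |σ * (Real.sin y * Real.cos y * (C 2 * derivative P).eval (Real.sin y ^ 2))|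
        = |Real.sin y * Real.cos y * (C 2 * derivative P).eval (Real.sin y ^ 2)| := by
      rw [abs_mul, hσ, one_mul]
    have h2 := neg_abs_le (σ * (Real.sin y * Real.cos y * (C 2 * derivative P).eval (Real.sin y ^ 2)))
    linarith
  -- A base point: on [π/6, π/3] the weight is bounded below, so the minimum of P² there is
  -- controlled by the norm.
  obtain ⟨y, hy, hyP⟩ : ∃ y ∈ Icc (Real.pi / 6) (Real.pi / 3),
      |P.eval (Real.sin y ^ 2)| ≤ 2 ^ (A + B + 1) * n := by
    have hpi := Real.pi_pos
    obtain ⟨y, hy, hmin⟩ := isCompact_Icc.exists_isMinOn (s := Icc (Real.pi / 6) (Real.pi / 3))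
      ⟨Real.pi / 6, le_rfl, by linarith⟩ (f := fun y => (P.eval (Real.sin y ^ 2)) ^ 2)
      (by fun_prop)
    refine ⟨y, hy, abs_le_of_sq_le_sq ?_ (by positivity)⟩
    have hlow : ∫ _ in (Real.pi / 6)..(Real.pi / 3), ((1 / 2) ^ A * (1 / 2) ^ B
        * (P.eval (Real.sin y ^ 2)) ^ 2) ≤ betaInt A B (P * P) := by
      refine le_trans ?_ (setIntegral_le_betaInt A B (P := P * P)
        (fun z => by rw [eval_mul]; exact mul_self_nonneg _) (u := Real.pi / 6) (v := Real.pi / 3)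
        (by positivity) (by linarith) (by linarith))
      refine intervalIntegral.integral_mono_on (by linarith)
        (Continuous.intervalIntegrable (by fun_prop) _ _)
        ((continuous_betaIntegrand A B _).intervalIntegrable _ _) fun u hu => ?_
      have hm : P.eval (Real.sin y ^ 2) ^ 2 ≤ P.eval (Real.sin u ^ 2) ^ 2 := hmin hu
      have s1 : 1 / 2 ≤ Real.sin u := by
        rw [← Real.sin_pi_div_six]
        exact Real.sin_le_sin_of_le_of_le_pi_div_two (by linarith) (by linarith [hu.2]) hu.1
      have c1 : 1 / 2 ≤ Real.cos u := by
        rw [← Real.cos_pi_div_three]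
        exact Real.cos_le_cos_of_nonneg_of_le_pi (by linarith [hu.1]) (by linarith) hu.2
      rw [eval_mul, ← sq]
      gcongr
    rw [intervalIntegral.integral_const, smul_eq_mul] at hlow
    have h3 : (1 / 2 : ℝ) ≤ Real.pi / 3 - Real.pi / 6 := by linarith [Real.pi_gt_three]
    have hq : 0 ≤ (1 / 2) ^ A * (1 / 2) ^ B * (P.eval (Real.sin y ^ 2)) ^ 2 := by positivity
    have h4 : 1 / 2 * ((1 / 2) ^ A * (1 / 2) ^ B * (P.eval (Real.sin y ^ 2)) ^ 2) ≤ n ^ 2 := by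
      nlinarith
    have h5 : (2 : ℝ) ^ (A + B + 1) * (1 / 2 * ((1 / 2) ^ A * (1 / 2) ^ B)) = 1 := by
      rw [← pow_add, ← pow_succ', ← mul_pow]
      norm_num
    have h6 : (1 : ℝ) ≤ 2 ^ (A + B + 1) := one_le_pow₀ (by norm_num)
    calc P.eval (Real.sin y ^ 2) ^ 2
        = 2 ^ (A + B + 1) * (1 / 2 * ((1 / 2) ^ A * (1 / 2) ^ B * P.eval (Real.sin y ^ 2) ^ 2)) := by
          linear_combination (-P.eval (Real.sin y ^ 2) ^ 2) * h5
      _ ≤ 2 ^ (A + B + 1) * n ^ 2 := by gcongr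
      _ ≤ 2 ^ (A + B + 1) * (2 ^ (A + B + 1) * n ^ 2) := by
          gcongr
          exact le_mul_of_one_le_left (sq_nonneg _) h6
      _ = _ := by ring
  have hpi := Real.pi_pos
  have hy' : y ∈ Ioo 0 (Real.pi / 2) := ⟨by linarith [hy.1], by linarith [hy.2]⟩
  have hdiff : |P.eval (Real.sin x ^ 2) - P.eval (Real.sin y ^ 2)| ≤ n * k * |D x - D y| := by
    have m1 := hmono 1 (by simp)
    have m2 := hmono (-1) (by simp)
    have hnk : 0 ≤ n * k := by positivity
    rcases le_total x y with h | h
    · have a1 := m1 hx hy' h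
      have a2 := m2 hx hy' h
      simp only at a1 a2
      have := mul_le_mul_of_nonneg_left (neg_le_abs (D x - D y)) hnk
      rw [abs_le]
      constructor <;> linarith
    · have a1 := m1 hy' hx h
      have a2 := m2 hy' hx h
      simp only at a1 a2
      have := mul_le_mul_of_nonneg_left (le_abs_self (D x - D y)) hnk
      rw [abs_le]
      constructor <;> linarith
  have hs1 : 1 ≤ Real.sin x ^ (-α) := Real.one_le_rpow_of_pos_of_le_one_of_nonpos
    (sin_pos_of_mem hx) (Real.sin_le_one x) (by linarith)
  have hc1 : 1 ≤ Real.cos x ^ (-β) := Real.one_le_rpow_of_pos_of_le_one_of_nonpos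
    (cos_pos_of_mem hx) (Real.cos_le_one x) (by linarith)
  have hF1 : 1 ≤ Real.sin x ^ (-α) * Real.cos x ^ (-β) := one_le_mul_of_one_le_of_one_le hs1 hc1
  have hDx : |D x| ≤ Real.sin x ^ (-α) * Real.cos x ^ (-β) := by
    rw [abs_le]
    simp only [hD]
    constructor <;> nlinarith
  have hDy : |D y| ≤ 2 ^ α + 2 ^ β := by
    have s1 : 1 / 2 ≤ Real.sin y := by
      rw [← Real.sin_pi_div_six]
      exact Real.sin_le_sin_of_le_of_le_pi_div_two (by linarith) (by linarith [hy.2]) hy.1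
    have c1 : 1 / 2 ≤ Real.cos y := by
      rw [← Real.cos_pi_div_three]
      exact Real.cos_le_cos_of_nonneg_of_le_pi (by linarith [hy.1]) (by linarith) hy.2
    have h2 : ∀ (γ u : ℝ), 0 < γ → 1 / 2 ≤ u → 0 ≤ u ^ (-γ) ∧ u ^ (-γ) ≤ 2 ^ γ := by
      intro γ u hγ hu
      have hu0 : 0 < u := by linarith
      refine ⟨by positivity, ?_⟩
      have := Real.rpow_le_rpow_of_nonpos (show (0 : ℝ) < 1 / 2 by norm_num) hu
        (show -γ ≤ 0 by linarith)
      rwa [one_div, Real.inv_rpow (by norm_num), Real.rpow_neg zero_le_two, inv_inv] at this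
    obtain ⟨a1, a2⟩ := h2 α _ hα s1
    obtain ⟨b1, b2⟩ := h2 β _ hβ c1
    rw [abs_le]
    simp only [hD]
    constructor <;> linarith
  have hnk : 0 ≤ n * k := by positivity
  have t1 : |P.eval (Real.sin x ^ 2)|
      ≤ |P.eval (Real.sin x ^ 2) - P.eval (Real.sin y ^ 2)| + |P.eval (Real.sin y ^ 2)| := by
    have := abs_add_le (P.eval (Real.sin x ^ 2) - P.eval (Real.sin y ^ 2)) (P.eval (Real.sin y ^ 2))
    rwa [sub_add_cancel] at this
  set F := Real.sin x ^ (-α) * Real.cos x ^ (-β) with hF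
  have t2 : |D x - D y| ≤ F + (2 ^ α + 2 ^ β) := (abs_sub _ _).trans (add_le_add hDx hDy)
  have t3 : n * k * |D x - D y| ≤ n * k * (F + (2 ^ α + 2 ^ β)) := by gcongr
  have q1 : 0 ≤ (2 : ℝ) ^ α + 2 ^ β := by positivity
  have q2 : 0 ≤ n * k * ((2 ^ α + 2 ^ β) * (F - 1)) :=
    mul_nonneg hnk (mul_nonneg q1 (by linarith))
  have q3 : 0 ≤ 2 ^ (A + B + 1) * n * (F - 1) := mul_nonneg (by positivity) (by linarith)
  linarith

/-! ### Fourier multipliers -/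

theorem coeff_ext (hδ : Admissible M δ) {φ ψ : L2 M δ} (h : ∀ n, coeff n φ = coeff n ψ) : φ = ψ := by
  refine (modeBasis hδ).repr.injective (lp.ext (funext fun n => ?_))
  rw [modeBasis_repr, modeBasis_repr, h]

theorem norm_mul_le_norm_smul {a : ℕ → ℝ} {K : ℝ} (ha : ∀ n, |a n| ≤ K) (c : ℕ → ℝ) (n : ℕ) :
    ‖a n * c n‖ ≤ ‖(K • c) n‖ := by
  rw [Pi.smul_apply, norm_smul, norm_mul]
  gcongr
  exact (ha n).trans (le_abs_self K)

/-- Multiplication of a square summable sequence by a bounded sequence. -/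
def diagLinear (a : ℕ → ℝ) (K : ℝ) (ha : ∀ n, |a n| ≤ K) :
    lp (fun _ : ℕ => ℝ) 2 →ₗ[ℝ] lp (fun _ : ℕ => ℝ) 2 where
  toFun c := ⟨fun n => a n * c n, (c.2.const_smul K).mono' (norm_mul_le_norm_smul ha c)⟩
  map_add' c d := by
    ext n
    exact mul_add _ _ _
  map_smul' r c := by
    ext n
    exact mul_left_comm _ _ _

theorem norm_diagLinear_le (a : ℕ → ℝ) (K : ℝ) (ha : ∀ n, |a n| ≤ K)
    (c : lp (fun _ : ℕ => ℝ) 2) : ‖diagLinear a K ha c‖ ≤ K * ‖c‖ :=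
  calc ‖diagLinear a K ha c‖ ≤ ‖K • c‖ := lp.norm_mono (by norm_num) (norm_mul_le_norm_smul ha c)
    _ = K * ‖c‖ := by rw [norm_smul, Real.norm_of_nonneg ((abs_nonneg _).trans (ha 0))]

/-- The Fourier multiplier with the bounded symbol `a`. -/
def multiplier (hδ : Admissible M δ) (a : ℕ → ℝ) (K : ℝ) (ha : ∀ n, |a n| ≤ K) :
    L2 M δ →L[ℝ] L2 M δ :=
  ((modeBasis hδ).repr.symm.toContinuousLinearEquiv : _ →L[ℝ] L2 M δ) ∘L
    (diagLinear a K ha).mkContinuous K (norm_diagLinear_le a K ha) ∘L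
    ((modeBasis hδ).repr.toContinuousLinearEquiv : L2 M δ →L[ℝ] _)

theorem coeff_multiplier (hδ : Admissible M δ) {a : ℕ → ℝ} {K : ℝ} (ha : ∀ n, |a n| ≤ K)
    (φ : L2 M δ) (n : ℕ) : coeff n (multiplier hδ a K ha φ) = a n * coeff n φ := by
  rw [← modeBasis_repr hδ, ← modeBasis_repr hδ]
  change (modeBasis hδ).repr ((modeBasis hδ).repr.symm (diagLinear a K ha ((modeBasis hδ).repr φ))) n = _
  rw [LinearIsometryEquiv.apply_symm_apply]
  rfl

theorem norm_multiplier_le (hδ : Admissible M δ) {a : ℕ → ℝ} {K : ℝ} (ha : ∀ n, |a n| ≤ K)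
    (φ : L2 M δ) : ‖multiplier hδ a K ha φ‖ ≤ K * ‖φ‖ := by
  change ‖(modeBasis hδ).repr.symm (diagLinear a K ha ((modeBasis hδ).repr φ))‖ ≤ _
  rw [LinearIsometryEquiv.norm_map]
  refine (norm_diagLinear_le a K ha _).trans ?_
  rw [LinearIsometryEquiv.norm_map]

theorem coeff_add (n : ℕ) (φ ψ : L2 M δ) : coeff n (φ + ψ) = coeff n φ + coeff n ψ :=
  inner_add_right _ _ _

theorem coeff_smul (n : ℕ) (c : ℝ) (φ : L2 M δ) : coeff n (c • φ) = c * coeff n φ :=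
  real_inner_smul_right _ _ _

theorem coeff_eigenmode (hδ : Admissible M δ) (m n : ℕ) :
    coeff m (eigenmode M δ n) = if m = n then 1 else 0 :=
  orthonormal_iff_ite.1 (orthonormal_eigenmode hδ) m n

theorem hasSum_coeff (hδ : Admissible M δ) (φ : L2 M δ) :
    HasSum (fun n => coeff n φ • eigenmode M δ n) φ := by
  have h := (modeBasis hδ).hasSum_repr φ
  simpa only [modeBasis_repr, modeBasis_apply] using h

theorem linFlow_eq (hδ : Admissible M δ) (t : ℝ) (φ : L2 M δ) :
    linFlow t φ = multiplier hδ (fun n => Real.cos (freq M δ n * t)) 1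
      (fun _ => Real.abs_cos_le_one _) φ := by
  have h := hasSum_coeff hδ (multiplier hδ (fun n => Real.cos (freq M δ n * t)) 1
      (fun _ => Real.abs_cos_le_one _) φ)
  simp only [coeff_multiplier] at h
  rw [linFlow, ← h.tsum_eq]
  congr 1
  funext n
  rw [mul_comm]

theorem coeff_linFlow (hδ : Admissible M δ) (t : ℝ) (φ : L2 M δ) (n : ℕ) :
    coeff n (linFlow t φ) = Real.cos (freq M δ n * t) * coeff n φ := by
  rw [linFlow_eq hδ, coeff_multiplier]

theorem two_le_freq (hδ : Admissible M δ) (n : ℕ) : 2 ≤ freq M δ n := by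
  rw [freq_eq]
  have h : (2 : ℝ) ≤ baseFreq M δ := by exact_mod_cast two_le_baseFreq hδ
  have hn : (0 : ℝ) ≤ n := n.cast_nonneg
  linarith

theorem abs_inv_freq_sq_le (hδ : Admissible M δ) (n : ℕ) : |(freq M δ n ^ 2)⁻¹| ≤ 1 := by
  have := two_le_freq hδ n
  rw [abs_of_nonneg (by positivity)]
  exact inv_le_one_of_one_le₀ (by nlinarith)

/-- The inverse of `L`. -/
def invL (hδ : Admissible M δ) : L2 M δ →L[ℝ] L2 M δ :=
  multiplier hδ (fun n => (freq M δ n ^ 2)⁻¹) 1 (abs_inv_freq_sq_le hδ)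

theorem coeff_polyL2_sum (hδ : Admissible M δ) (N m : ℕ) (c : ℕ → ℝ) :
    coeff m (polyL2 M δ (∑ n ∈ Finset.range N, C (c n) * modePoly M δ n))
      = if m < N then c m else 0 := by
  have e : polyL2 M δ (∑ n ∈ Finset.range N, C (c n) * modePoly M δ n)
      = ∑ n ∈ Finset.range N, c n • eigenmode M δ n := by
    rw [map_sum]
    refine Finset.sum_congr rfl fun n _ => ?_
    rw [← smul_eq_C_mul, map_smul, eigenmode_eq]
  rw [e, coeff, inner_sum]
  change ∑ n ∈ Finset.range N, coeff m (c n • eigenmode M δ n) = _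
  simp only [coeff_smul, coeff_eigenmode hδ, mul_ite, mul_one, mul_zero, Finset.sum_ite_eq,
    Finset.mem_range]

/-- The eigenvalue equation (1/w)(w e_n')' = (c - ω_n²) e_n in polynomial form. -/
theorem fluxPoly_derivative_modePoly (hδ : Admissible M δ) (n : ℕ) :
    fluxPoly (sinExp M δ) (cosExp M δ) (C 2 * derivative (modePoly M δ n))
      = C (massSq M δ - freq M δ n ^ 2) * modePoly M δ n := by
  have hs := solvesJacobi_modePoly M δ n
  have hf : massSq M δ - freq M δ n ^ 2 = -4 * (n * (n + jacA M δ + jacB M δ + 1)) := by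
    rw [freq_eq, massSq_eq]
    linear_combination -4 * (n : ℝ) * baseFreq_eq M δ
  unfold SolvesJacobi at hs
  rw [fluxPoly, hf, sinExp_eq, cosExp_eq hδ, derivative_C_mul]
  simp only [C_add, C_mul, map_ofNat, map_one, C_neg] at hs ⊢
  linear_combination 4 * hs

theorem fluxPoly_derivative_sum (hδ : Admissible M δ) (N : ℕ) (c : ℕ → ℝ) :
    fluxPoly (sinExp M δ) (cosExp M δ)
        (C 2 * derivative (∑ n ∈ Finset.range N, C (c n) * modePoly M δ n))
      = ∑ n ∈ Finset.range N, C ((massSq M δ - freq M δ n ^ 2) * c n) * modePoly M δ n := by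
  have e : ∀ n, C ((massSq M δ - freq M δ n ^ 2) * c n) * modePoly M δ n
      = C (c n) * fluxPoly (sinExp M δ) (cosExp M δ) (C 2 * derivative (modePoly M δ n)) := by
    intro n
    rw [fluxPoly_derivative_modePoly hδ, C_mul]
    ring
  simp only [e, fluxPoly, derivative_sum, Finset.mul_sum, derivative_mul,
    derivative_C, zero_mul, zero_add, ← Finset.sum_add_distrib]
  refine Finset.sum_congr rfl fun n _ => ?_
  ring

/-! ### Pointwise bounds on the domain -/

/-- The power of `sin` in the coefficient of the nonlinearity. -/
def nlSinExp : Model → ℕ → ℕ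
  | Model.KG, _ => 0
  | Model.WM, δ => 2 * δ - 2

/-- The power of `cos` in the coefficient of the nonlinearity. -/
def nlCosExp : Model → ℕ → ℕ
  | Model.KG, δ => 2 * δ - 2
  | Model.WM, _ => 4

theorem nlWeight_eq_pow (M : Model) (δ : ℕ) (x : ℝ) :
    nlWeight M δ x = Real.sin x ^ nlSinExp M δ * Real.cos x ^ nlCosExp M δ := by
  cases M <;> simp [nlWeight, nlSinExp, nlCosExp]

/-- A function whose cube, multiplied by the coefficient of the nonlinearity, is still square
integrable. -/
def growth (M : Model) (δ : ℕ) (x : ℝ) : ℝ :=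
  Real.sin x ^ (-(((sinExp M δ : ℝ) + 2 * nlSinExp M δ) / 6))
    * Real.cos x ^ (-(((cosExp M δ : ℝ) + 2 * nlCosExp M δ) / 6))

theorem growth_pos {x : ℝ} (hx : x ∈ Ioo 0 (Real.pi / 2)) : 0 < growth M δ x := by
  have := sin_pos_of_mem hx
  have := cos_pos_of_mem hx
  unfold growth
  positivity

theorem nlWeight_nonneg {x : ℝ} (hx : x ∈ Ioo 0 (Real.pi / 2)) : 0 ≤ nlWeight M δ x := by
  have := sin_pos_of_mem hx
  have := cos_pos_of_mem hx
  rw [nlWeight_eq_pow]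
  positivity

/-- The exponents of `growth` are made for this: b - 3(a + 2b)/6 = -a/2 for each of the factors sin
and cos. -/
theorem nlWeight_mul_growth {x : ℝ} (hx : x ∈ Ioo 0 (Real.pi / 2)) :
    nlWeight M δ x * growth M δ x ^ 3 = (Real.sqrt (weight M δ x))⁻¹ := by
  have hs := sin_pos_of_mem hx
  have hc := cos_pos_of_mem hx
  have key : ∀ (u : ℝ) (a b : ℕ), 0 < u →
      u ^ b * (u ^ (-(((a : ℝ) + 2 * b) / 6))) ^ 3 = (Real.sqrt (u ^ a))⁻¹ := by
    intro u a b hu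
    rw [Real.sqrt_eq_rpow, ← Real.rpow_natCast u a, ← Real.rpow_natCast u b, ← Real.rpow_mul hu.le,
      ← Real.rpow_natCast, ← Real.rpow_mul hu.le, ← Real.rpow_add hu, ← Real.rpow_neg hu.le]
    congr 1
    push_cast
    ring
  rw [weight_eq, Real.sqrt_mul (by positivity), mul_inv, ← key _ _ (nlSinExp M δ) hs,
    ← key _ _ (nlCosExp M δ) hc, nlWeight_eq_pow, growth]
  ring

/-- For the exponents of `growth` the condition A ≤ 2α + 3 reads 2A ≤ 2b + 9, where b is the
exponent of the same factor in W. It holds for sin and cos in both models. -/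
theorem exists_abs_polyL2_le (hδ : Admissible M δ) : ∃ K : ℝ, 0 ≤ K ∧ ∀ (P : ℝ[X]) (n : ℝ), 0 ≤ n →
    betaInt (sinExp M δ) (cosExp M δ) (P * P) ≤ n ^ 2 →
    betaInt (sinExp M δ) (cosExp M δ) (fluxPoly (sinExp M δ) (cosExp M δ) (C 2 * derivative P)
      * fluxPoly (sinExp M δ) (cosExp M δ) (C 2 * derivative P)) ≤ n ^ 2 →
    ∀ x ∈ Ioo 0 (Real.pi / 2), |P.eval (Real.sin x ^ 2)| ≤ K * n * growth M δ x := by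
  have h1 := two_le_sinExp hδ
  have h2 := two_le_cosExp hδ
  have h1' : (2 : ℝ) ≤ sinExp M δ := by exact_mod_cast h1
  have h2' : (2 : ℝ) ≤ cosExp M δ := by exact_mod_cast h2
  have h3 : (0 : ℝ) ≤ nlSinExp M δ := Nat.cast_nonneg _
  have h4 : (0 : ℝ) ≤ nlCosExp M δ := Nat.cast_nonneg _
  refine abs_eval_le_of_betaInt_le (sinExp M δ) (cosExp M δ) (by omega) (by omega)
    (by linarith) (by linarith) ?_ ?_
  · have : 2 * sinExp M δ ≤ 2 * nlSinExp M δ + 9 := by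
      cases M <;> simp only [sinExp, nlSinExp, Admissible] at hδ ⊢ <;> omega
    have : (2 : ℝ) * sinExp M δ ≤ 2 * nlSinExp M δ + 9 := by exact_mod_cast this
    linarith
  · have : 2 * cosExp M δ ≤ 2 * nlCosExp M δ + 9 := by
      cases M <;> simp only [cosExp, nlCosExp, Admissible] at hδ ⊢ <;> omega
    have : (2 : ℝ) * cosExp M δ ≤ 2 * nlCosExp M δ + 9 := by exact_mod_cast this
    linarith

/-- Elements of the domain of `L` are dominated by `growth`. -/
theorem exists_abs_invL_le (hδ : Admissible M δ) : ∃ K : ℝ, 0 ≤ K ∧ ∀ g : L2 M δ,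
    ∀ᵐ x ∂(mu M δ), |invL hδ g x| ≤ K * ‖g‖ * growth M δ x := by
  obtain ⟨K, hK, h⟩ := exists_abs_polyL2_le hδ
  refine ⟨K, hK, fun g => ?_⟩
  set P : ℕ → ℝ[X] := fun N =>
    ∑ n ∈ Finset.range N, C ((freq M δ n ^ 2)⁻¹ * coeff n g) * modePoly M δ n with hP
  -- Used with the symbols ω_n^{-2} and (c - ω_n²)ω_n^{-2}, both bounded by 1; the second describes
  -- the flux polynomial of the partial sum.
  have hbound : ∀ (N : ℕ) (a : ℕ → ℝ), (∀ n, |a n| ≤ 1) →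
      betaInt (sinExp M δ) (cosExp M δ)
        ((∑ n ∈ Finset.range N, C (a n * coeff n g) * modePoly M δ n)
          * (∑ n ∈ Finset.range N, C (a n * coeff n g) * modePoly M δ n)) ≤ ‖g‖ ^ 2 := by
    intro N a ha
    have ha' : ∀ n, |if n < N then a n else 0| ≤ 1 := fun n => by
      split_ifs
      · exact ha n
      · simp
    have e : polyL2 M δ (∑ n ∈ Finset.range N, C (a n * coeff n g) * modePoly M δ n)
        = multiplier hδ _ 1 ha' g := by
      refine coeff_ext hδ fun m => ?_
      rw [coeff_polyL2_sum hδ, coeff_multiplier]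
      split_ifs <;> simp
    rw [← inner_polyL2, e, real_inner_self_eq_norm_sq]
    have := norm_multiplier_le hδ ha' g
    rw [one_mul] at this
    gcongr
  have hPx : ∀ N, ∀ x ∈ Ioo 0 (Real.pi / 2),
      |(P N).eval (Real.sin x ^ 2)| ≤ K * ‖g‖ * growth M δ x := by
    intro N
    refine h (P N) ‖g‖ (norm_nonneg _) (hbound N _ (abs_inv_freq_sq_le hδ)) ?_
    rw [hP, fluxPoly_derivative_sum hδ]
    simp only [← mul_assoc]
    refine hbound N _ fun n => ?_
    have h2 := two_le_freq hδ n
    have h3 : massSq M δ ≤ freq M δ n ^ 2 := by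
      rw [massSq_eq, freq_eq]
      have hn : (0 : ℝ) ≤ n := n.cast_nonneg
      gcongr
      linarith
    have h4 : 0 ≤ massSq M δ := by
      rw [massSq_eq]
      positivity
    rw [abs_mul, abs_of_nonpos (by linarith), abs_of_nonneg (by positivity),
      ← div_eq_mul_inv, div_le_one (by positivity)]
    linarith
  have hlim : Filter.Tendsto (fun N => polyL2 M δ (P N)) Filter.atTop (nhds (invL hδ g)) := by
    refine ((hasSum_coeff hδ (invL hδ g)).tendsto_sum_nat).congr fun N => ?_
    rw [hP, map_sum]
    refine Finset.sum_congr rfl fun n _ => ?_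
    rw [← smul_eq_C_mul, map_smul, eigenmode_eq, invL, coeff_multiplier]
  -- The bound is uniform in N, so it passes to the L² limit along an almost everywhere convergent
  -- subsequence.
  obtain ⟨ns, _, hns⟩ := (tendstoInMeasure_of_tendsto_Lp hlim).exists_seq_tendsto_ae
  have hcoe : ∀ᵐ x ∂(mu M δ), ∀ N, polyL2 M δ (P N) x = (P N).eval (Real.sin x ^ 2) :=
    ae_all_iff.2 fun N => coeFn_polyL2 _
  filter_upwards [hns, hcoe, ae_mu_mem M δ] with x h1 h2 h3
  refine le_of_tendsto h1.abs (Filter.Eventually.of_forall fun i => ?_)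
  rw [h2]
  exact hPx _ x h3

/-! ### Estimates for the cubic nonlinearity -/

theorem memLp_inv_sqrt_weight (M : Model) (δ : ℕ) :
    MemLp (fun x => (Real.sqrt (weight M δ x))⁻¹) 2 (mu M δ) := by
  have hm : Measurable fun x => (Real.sqrt (weight M δ x))⁻¹ :=
    ((continuous_weight M δ).measurable.sqrt).inv
  refine (memLp_two_iff_integrable_sq hm.aestronglyMeasurable).2 ?_
  unfold mu
  rw [integrable_withDensity_iff_integrable_smul'
    (continuous_weight M δ).measurable.ennreal_ofReal
    (Filter.Eventually.of_forall fun x => ENNReal.ofReal_lt_top)]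
  have : IntegrableOn (fun _ : ℝ => (1 : ℝ)) (Ioo 0 (Real.pi / 2)) :=
    integrableOn_const (by simp)
  refine this.congr ?_
  filter_upwards [ae_restrict_mem measurableSet_Ioo] with x hx
  have hw := weight_pos M δ hx
  rw [ENNReal.toReal_ofReal hw.le, inv_pow, Real.sq_sqrt hw.le, smul_eq_mul, mul_inv_cancel₀ hw.ne']

/-- The function `w^(-1/2)` as an element of `L²`. -/
def invSqrtWeight (M : Model) (δ : ℕ) : L2 M δ := (memLp_inv_sqrt_weight M δ).toLp _

theorem norm_le_of_ae_le {φ : L2 M δ} {R : ℝ}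
    (h : ∀ᵐ x ∂(mu M δ), |φ x| ≤ R * (Real.sqrt (weight M δ x))⁻¹) :
    ‖φ‖ ≤ R * ‖invSqrtWeight M δ‖ := by
  refine Lp.norm_le_mul_norm_of_ae_le_mul ?_
  filter_upwards [h, (memLp_inv_sqrt_weight M δ).coeFn_toLp] with x h1 h2
  rw [invSqrtWeight, h2, Real.norm_eq_abs, Real.norm_eq_abs,
    abs_of_nonneg (inv_nonneg.2 (Real.sqrt_nonneg _))]
  exact h1

theorem continuous_nlWeight (M : Model) (δ : ℕ) : Continuous (nlWeight M δ) := by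
  simp only [funext (nlWeight_eq_pow M δ)]
  fun_prop

/-- A constant in the pointwise bound of `invL`. -/
def invLConst (hδ : Admissible M δ) : ℝ := Classical.choose (exists_abs_invL_le hδ)

theorem invLConst_nonneg (hδ : Admissible M δ) : 0 ≤ invLConst hδ :=
  (Classical.choose_spec (exists_abs_invL_le hδ)).1

theorem abs_invL_le (hδ : Admissible M δ) (g : L2 M δ) :
    ∀ᵐ x ∂(mu M δ), |invL hδ g x| ≤ invLConst hδ * ‖g‖ * growth M δ x :=
  (Classical.choose_spec (exists_abs_invL_le hδ)).2 g

/-- The trilinear estimate behind all bounds on the cubic term: three factors `growth` and one W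
give w^(-1/2), whose square is integrable against w dx on a bounded interval. -/
theorem abs_triple_le (hδ : Admissible M δ) (g₁ g₂ g₃ : L2 M δ) : ∀ᵐ x ∂(mu M δ),
    |nlWeight M δ x * (invL hδ g₁ x * invL hδ g₂ x * invL hδ g₃ x)|
      ≤ invLConst hδ ^ 3 * (‖g₁‖ * ‖g₂‖ * ‖g₃‖) * (Real.sqrt (weight M δ x))⁻¹ := by
  filter_upwards [abs_invL_le hδ g₁, abs_invL_le hδ g₂, abs_invL_le hδ g₃, ae_mu_mem M δ]
    with x h1 h2 h3 hx
  have hW := nlWeight_nonneg (M := M) (δ := δ) hx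
  have hF := growth_pos (M := M) (δ := δ) hx
  have hK := invLConst_nonneg hδ
  rw [abs_mul, abs_mul, abs_mul, abs_of_nonneg hW, ← nlWeight_mul_growth hx]
  calc nlWeight M δ x * (|invL hδ g₁ x| * |invL hδ g₂ x| * |invL hδ g₃ x|)
      ≤ nlWeight M δ x * ((invLConst hδ * ‖g₁‖ * growth M δ x) * (invLConst hδ * ‖g₂‖ * growth M δ x)
        * (invLConst hδ * ‖g₃‖ * growth M δ x)) := by gcongr
    _ = _ := by ring

theorem memLp_cubic (hδ : Admissible M δ) (g : L2 M δ) :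
    MemLp (fun x => -(nlWeight M δ x * invL hδ g x ^ 3)) 2 (mu M δ) := by
  refine (memLp_inv_sqrt_weight M δ).of_le_mul (c := invLConst hδ ^ 3 * (‖g‖ * ‖g‖ * ‖g‖)) ?_ ?_
  · exact ((continuous_nlWeight M δ).aestronglyMeasurable.mul
      ((Lp.aestronglyMeasurable _).pow 3)).neg
  · filter_upwards [abs_triple_le hδ g g g] with x hx
    rw [norm_neg, Real.norm_eq_abs, Real.norm_of_nonneg (inv_nonneg.2 (Real.sqrt_nonneg _))]
    convert hx using 3
    ring

theorem coeFn_cubic (hδ : Admissible M δ) (g : L2 M δ) :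
    cubic (invL hδ g) =ᵐ[mu M δ] fun x => -(nlWeight M δ x * invL hδ g x ^ 3) := by
  rw [cubic, dif_pos (memLp_cubic hδ g)]
  exact (memLp_cubic hδ g).coeFn_toLp

theorem norm_cubic_sub_le (hδ : Admissible M δ) (g h : L2 M δ) :
    ‖cubic (invL hδ g) - cubic (invL hδ h)‖
      ≤ invLConst hδ ^ 3 * (‖g - h‖ * (‖g‖ * ‖g‖ + ‖g‖ * ‖h‖ + ‖h‖ * ‖h‖)) * ‖invSqrtWeight M δ‖ := by
  refine norm_le_of_ae_le ?_
  have hsub : invL hδ (g - h) =ᵐ[mu M δ] fun x => invL hδ g x - invL hδ h x := by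
    rw [map_sub]
    exact Lp.coeFn_sub _ _
  filter_upwards [abs_triple_le hδ (g - h) g g, abs_triple_le hδ (g - h) g h,
    abs_triple_le hδ (g - h) h h, hsub, coeFn_cubic hδ g, coeFn_cubic hδ h,
    Lp.coeFn_sub (cubic (invL hδ g)) (cubic (invL hδ h))] with x h1 h2 h3 h4 h5 h6 h7
  rw [h7, Pi.sub_apply, h5, h6]
  rw [h4] at h1 h2 h3
  set u := invL hδ g x
  set v := invL hδ h x
  have e : -(nlWeight M δ x * u ^ 3) - -(nlWeight M δ x * v ^ 3)
      = -(nlWeight M δ x * ((u - v) * u * u) + nlWeight M δ x * ((u - v) * u * v)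
        + nlWeight M δ x * ((u - v) * v * v)) := by ring
  rw [e, abs_neg]
  refine (abs_add_three _ _ _).trans ((add_le_add (add_le_add h1 h2) h3).trans (le_of_eq ?_))
  ring

theorem continuous_cubic (hδ : Admissible M δ) : Continuous fun g : L2 M δ => cubic (invL hδ g) := by
  rw [continuous_iff_continuousAt]
  intro h
  rw [ContinuousAt, tendsto_iff_norm_sub_tendsto_zero]
  refine squeeze_zero (fun _ => norm_nonneg _) (fun g => norm_cubic_sub_le hδ g h) ?_
  have : Continuous fun g : L2 M δ => invLConst hδ ^ 3
      * (‖g - h‖ * (‖g‖ * ‖g‖ + ‖g‖ * ‖h‖ + ‖h‖ * ‖h‖)) * ‖invSqrtWeight M δ‖ := by fun_prop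
  have h0 := this.tendsto h
  simpa using h0

/-! ### The linear flow -/

theorem norm_linFlow_le (hδ : Admissible M δ) (t : ℝ) (φ : L2 M δ) : ‖linFlow t φ‖ ≤ ‖φ‖ := by
  rw [linFlow_eq hδ]
  simpa using norm_multiplier_le hδ (fun _ => Real.abs_cos_le_one _) φ

theorem linFlow_add (hδ : Admissible M δ) (t : ℝ) (φ ψ : L2 M δ) :
    linFlow t (φ + ψ) = linFlow t φ + linFlow t ψ := by
  simp only [linFlow_eq hδ, map_add]

theorem linFlow_sub (hδ : Admissible M δ) (t : ℝ) (φ ψ : L2 M δ) :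
    linFlow t (φ - ψ) = linFlow t φ - linFlow t ψ := by
  simp only [linFlow_eq hδ, map_sub]

theorem linFlow_smul (hδ : Admissible M δ) (t c : ℝ) (φ : L2 M δ) :
    linFlow t (c • φ) = c • linFlow t φ := by
  simp only [linFlow_eq hδ, map_smul]

theorem linFlow_eigenmode (hδ : Admissible M δ) (t : ℝ) (n : ℕ) :
    linFlow t (eigenmode M δ n) = Real.cos (freq M δ n * t) • eigenmode M δ n := by
  refine coeff_ext hδ fun m => ?_
  rw [coeff_linFlow hδ, coeff_smul, coeff_eigenmode hδ]
  split_ifs with h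
  · rw [h]
  · simp

theorem coeff_invL (hδ : Admissible M δ) (g : L2 M δ) (n : ℕ) :
    coeff n (invL hδ g) = (freq M δ n ^ 2)⁻¹ * coeff n g := coeff_multiplier hδ _ g n

theorem linFlow_invL (hδ : Admissible M δ) (t : ℝ) (g : L2 M δ) :
    linFlow t (invL hδ g) = invL hδ (linFlow t g) := by
  refine coeff_ext hδ fun m => ?_
  rw [coeff_linFlow hδ, coeff_invL, coeff_invL, coeff_linFlow hδ]
  ring

/-- The flow is a contraction for each t, so the orbit is a uniform limit of orbits of finite mode
sums. -/
theorem continuous_linFlow (hδ : Admissible M δ) (φ : L2 M δ) : Continuous fun t => linFlow t φ := by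
  set S : ℕ → L2 M δ := fun N => ∑ n ∈ Finset.range N, coeff n φ • eigenmode M δ n with hS
  have hlim : Filter.Tendsto S Filter.atTop (nhds φ) := (hasSum_coeff hδ φ).tendsto_sum_nat
  have hu : TendstoUniformly (fun N t => linFlow t (S N)) (fun t => linFlow t φ) Filter.atTop := by
    rw [Metric.tendstoUniformly_iff]
    intro ε hε
    filter_upwards [(Metric.tendsto_nhds.1 hlim) ε hε] with N hN t
    rw [dist_comm, dist_eq_norm, ← linFlow_sub hδ]
    exact (norm_linFlow_le hδ t _).trans_lt (by rwa [← dist_eq_norm])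
  refine hu.continuous (Filter.Frequently.of_forall fun N => ?_)
  have e : (fun t => linFlow t (S N)) = fun t => ∑ n ∈ Finset.range N,
      coeff n φ • (Real.cos (freq M δ n * t) • eigenmode M δ n) := by
    funext t
    rw [hS, linFlow_eq hδ, map_sum]
    refine Finset.sum_congr rfl fun n _ => ?_
    rw [map_smul, ← linFlow_eq hδ, linFlow_eigenmode hδ]
  rw [e]
  fun_prop

theorem continuous_linFlow_comp (hδ : Admissible M δ) {f : ℝ → L2 M δ} (hf : Continuous f)
    {τ : ℝ → ℝ} (hτ : Continuous τ) : Continuous fun t => linFlow (τ t) (f t) := by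
  rw [continuous_iff_continuousAt]
  intro t₀
  rw [ContinuousAt, tendsto_iff_norm_sub_tendsto_zero]
  refine squeeze_zero (g := fun t => ‖f t - f t₀‖
    + ‖linFlow (τ t) (f t₀) - linFlow (τ t₀) (f t₀)‖) (fun _ => norm_nonneg _) (fun t => ?_) ?_
  · have e : linFlow (τ t) (f t) - linFlow (τ t₀) (f t₀) = linFlow (τ t) (f t - f t₀)
        + (linFlow (τ t) (f t₀) - linFlow (τ t₀) (f t₀)) := by
      rw [linFlow_sub hδ]
      abel
    rw [e]
    exact (norm_add_le _ _).trans (add_le_add_left (norm_linFlow_le hδ _ _) _)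
  · have h2 := (continuous_linFlow hδ (f t₀)).comp hτ
    have : Continuous fun t => ‖f t - f t₀‖ + ‖linFlow (τ t) (f t₀) - linFlow (τ t₀) (f t₀)‖ :=
      (hf.sub continuous_const).norm.add (h2.sub continuous_const).norm
    simpa using this.tendsto t₀

theorem continuous_integrand (hδ : Admissible M δ) (g : L2 M δ) :
    Continuous fun t => linFlow (-t) (cubic (linFlow t (invL hδ g))) := by
  simp only [linFlow_invL hδ]
  exact continuous_linFlow_comp hδ ((continuous_cubic hδ).comp (continuous_linFlow hδ g))
    continuous_neg

/-! ### The averaged linearization -/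

theorem exists_mulPoly (M : Model) (δ : ℕ) (Q : ℝ[X]) : ∃ T : L2 M δ →L[ℝ] L2 M δ,
    ∀ f : L2 M δ, T f =ᵐ[mu M δ] fun x => Q.eval (Real.sin x ^ 2) * f x := by
  obtain ⟨K, hK⟩ := isCompact_Icc.exists_bound_of_continuousOn (s := Icc 0 (Real.pi / 2))
    (f := fun x => Q.eval (Real.sin x ^ 2)) (by fun_prop)
  have hb : ∀ f : L2 M δ, ∀ᵐ x ∂(mu M δ), ‖Q.eval (Real.sin x ^ 2) * f x‖ ≤ K * ‖f x‖ := by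
    intro f
    filter_upwards [ae_mu_mem M δ] with x hx
    rw [norm_mul]
    exact mul_le_mul_of_nonneg_right (hK x (Ioo_subset_Icc_self hx)) (norm_nonneg _)
  have hQ : Continuous fun x => Q.eval (Real.sin x ^ 2) := by fun_prop
  have hm : ∀ f : L2 M δ, MemLp (fun x => Q.eval (Real.sin x ^ 2) * f x) 2 (mu M δ) := fun f =>
    (Lp.memLp f).of_le_mul (hQ.aestronglyMeasurable.mul (Lp.aestronglyMeasurable f)) (hb f)
  refine ⟨LinearMap.mkContinuous
    { toFun := fun f => (hm f).toLp _
      map_add' := fun f g => ?_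
      map_smul' := fun c f => ?_ } K fun f => ?_, fun f => (hm f).coeFn_toLp⟩
  · rw [← MemLp.toLp_add]
    refine MemLp.toLp_congr _ _ ?_
    filter_upwards [Lp.coeFn_add f g] with x hx
    rw [hx, Pi.add_apply, Pi.add_apply, mul_add]
  · rw [RingHom.id_apply, ← MemLp.toLp_const_smul]
    refine MemLp.toLp_congr _ _ ?_
    filter_upwards [Lp.coeFn_smul c f] with x hx
    rw [hx, Pi.smul_apply, Pi.smul_apply, smul_eq_mul, smul_eq_mul]
    ring
  · refine Lp.norm_le_mul_norm_of_ae_le_mul ?_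
    filter_upwards [(hm f).coeFn_toLp, hb f] with x h1 h2
    change ‖(hm f).toLp _ x‖ ≤ _
    rw [h1]
    exact h2

/-- Multiplication by `P(sin²)`. -/
def mulPoly (M : Model) (δ : ℕ) (Q : ℝ[X]) : L2 M δ →L[ℝ] L2 M δ :=
  Classical.choose (exists_mulPoly M δ Q)

theorem coeFn_mulPoly (Q : ℝ[X]) (f : L2 M δ) :
    mulPoly M δ Q f =ᵐ[mu M δ] fun x => Q.eval (Real.sin x ^ 2) * f x :=
  Classical.choose_spec (exists_mulPoly M δ Q) f

theorem inner_polyL2_mulPoly (P Q : ℝ[X]) (f : L2 M δ) :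
    inner ℝ (polyL2 M δ P) (mulPoly M δ Q f) = inner ℝ (polyL2 M δ (P * Q)) f := by
  rw [inner_eq_integral, inner_eq_integral]
  refine integral_congr_ae ?_
  filter_upwards [coeFn_polyL2 (M := M) (δ := δ) P, coeFn_polyL2 (M := M) (δ := δ) (P * Q),
    coeFn_mulPoly Q f] with x h1 h2 h3
  rw [h1, h2, h3, eval_mul]
  ring

/-- The potential `W e_0²` as a polynomial in `sin²`. -/
def potPoly (M : Model) (δ : ℕ) : ℝ[X] := nlPoly M δ * modePoly M δ 0 ^ 2

theorem betaInt_sum_mul_modePoly (hδ : Admissible M δ) (N n : ℕ) (c : ℕ → ℝ) :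
    betaInt (sinExp M δ) (cosExp M δ)
      ((∑ k ∈ Finset.range N, C (c k) * modePoly M δ k) * modePoly M δ n)
      = if n < N then c n else 0 := by
  rw [Finset.sum_mul, map_sum]
  simp only [mul_assoc, betaInt_C_mul, betaInt_modePoly_mul hδ, mul_ite, mul_one, mul_zero,
    Finset.sum_ite_eq', Finset.mem_range]

/-- Since e_0 is constant, the product has degree at most m + deg W < m + ω_0. Hence the matrix of W
e_0² is banded. -/
theorem exists_modePoly_mul_potPoly (hδ : Admissible M δ) (m : ℕ) : ∃ c : ℕ → ℝ,
    modePoly M δ m * potPoly M δ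
      = ∑ k ∈ Finset.range (m + baseFreq M δ), C (c k) * modePoly M δ k := by
  refine exists_modePoly_sum hδ _ _ ?_
  have h1 := natDegree_nlPoly hδ
  have h2 : (potPoly M δ).natDegree ≤ (nlPoly M δ).natDegree := by
    rw [potPoly, modePoly_zero, ← C_pow]
    exact natDegree_mul_C_le _ _
  have h3 := natDegree_mul_le (p := modePoly M δ m) (q := potPoly M δ)
  rw [natDegree_modePoly hδ] at h3
  omega

/-- The matrix elements of the potential. -/
def potMatrix (M : Model) (δ m n : ℕ) : ℝ :=
  betaInt (sinExp M δ) (cosExp M δ) (modePoly M δ m * potPoly M δ * modePoly M δ n)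

theorem potMatrix_symm (m n : ℕ) : potMatrix M δ m n = potMatrix M δ n m := by
  rw [potMatrix, potMatrix]
  congr 1
  ring

theorem potMatrix_eq_zero (hδ : Admissible M δ) {m n : ℕ} (h : m + baseFreq M δ ≤ n) :
    potMatrix M δ m n = 0 := by
  obtain ⟨c, hc⟩ := exists_modePoly_mul_potPoly hδ m
  rw [potMatrix, hc, betaInt_sum_mul_modePoly hδ, if_neg (by omega)]

theorem coeff_mulPoly_potPoly (hδ : Admissible M δ) (m : ℕ) (f : L2 M δ) :
    coeff m (mulPoly M δ (potPoly M δ) f)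
      = ∑ n ∈ Finset.range (m + baseFreq M δ), potMatrix M δ m n * coeff n f := by
  obtain ⟨c, hc⟩ := exists_modePoly_mul_potPoly hδ m
  rw [coeff, eigenmode_eq, inner_polyL2_mulPoly, hc, map_sum, sum_inner]
  refine Finset.sum_congr rfl fun n hn => ?_
  rw [potMatrix, hc, betaInt_sum_mul_modePoly hδ, if_pos (Finset.mem_range.1 hn), ← smul_eq_C_mul,
    map_smul, real_inner_smul_left, ← eigenmode_eq]
  rfl

theorem abs_potMatrix_le (hδ : Admissible M δ) (m : ℕ) :
    |potMatrix M δ m m| ≤ ‖mulPoly M δ (potPoly M δ)‖ := by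
  have h1 : ‖eigenmode M δ m‖ = 1 := (orthonormal_eigenmode hδ).1 m
  have h2 : potMatrix M δ m m = inner ℝ (eigenmode M δ m) (mulPoly M δ (potPoly M δ) (eigenmode M δ m)) := by
    rw [eigenmode_eq, inner_polyL2_mulPoly, inner_polyL2, potMatrix]
  rw [h2]
  refine (abs_real_inner_le_norm _ _).trans ?_
  rw [h1, one_mul]
  simpa [h1] using (mulPoly M δ (potPoly M δ)).le_opNorm (eigenmode M δ m)

theorem integral_cos_int_mul (k : ℤ) :
    ∫ t in (0 : ℝ)..(2 * Real.pi), Real.cos (k * t) = if k = 0 then 2 * Real.pi else 0 := by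
  split_ifs with h
  · simp [h]
  · have hk : (k : ℝ) ≠ 0 := by exact_mod_cast h
    rw [intervalIntegral.integral_comp_mul_left (fun t => Real.cos t) hk, integral_cos, mul_zero,
      Real.sin_zero, sub_zero, smul_eq_mul]
    have := Real.sin_int_mul_pi (k * 2)
    push_cast at this
    rw [mul_assoc] at this
    rw [this, mul_zero]

/-- The average of `cos²(ω_0 t) cos²(ω_m t)` over a period. -/
def avgFactor (m : ℕ) : ℝ := if m = 0 then 3 / 8 else 1 / 4

/-- Product-to-sum formulas leave six cosines of integer frequency. The assumption |m - n| < ω_0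
makes 2ω_0 ± (ω_m - ω_n) nonzero, so the mean survives only from ω_m - ω_n = 0, with weight 1/4, and
for m = n = 0 also from 2ω_0 - ω_m - ω_n = 0, with weight 1/8. -/
theorem integral_cos_sq_mul_cos_mul_cos (M : Model) (δ : ℕ) {m n : ℕ} (h1 : m < n + baseFreq M δ)
    (h2 : n < m + baseFreq M δ) :
    ∫ t in (0 : ℝ)..(2 * Real.pi), Real.cos (freq M δ m * t) * (Real.cos (freq M δ 0 * t) ^ 2
      * Real.cos (freq M δ n * t)) = if m = n then 2 * Real.pi * avgFactor m else 0 := by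
  set b := baseFreq M δ with hb
  have e : ∀ t : ℝ, Real.cos (freq M δ m * t) * (Real.cos (freq M δ 0 * t) ^ 2
      * Real.cos (freq M δ n * t))
      = 1 / 4 * Real.cos ((2 * m - 2 * n : ℤ) * t) + 1 / 4 * Real.cos ((2 * m + 2 * n + 2 * b : ℤ) * t)
        + 1 / 8 * Real.cos ((2 * b + 2 * m - 2 * n : ℤ) * t)
        + 1 / 8 * Real.cos ((2 * b + 2 * n - 2 * m : ℤ) * t)
        + 1 / 8 * Real.cos ((4 * b + 2 * m + 2 * n : ℤ) * t)
        + 1 / 8 * Real.cos ((2 * m + 2 * n : ℤ) * t) := by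
    intro t
    have p : ∀ x y : ℝ, Real.cos x * Real.cos y = (Real.cos (x - y) + Real.cos (x + y)) / 2 := by
      intro x y
      rw [Real.cos_sub, Real.cos_add]
      ring
    have h0 : Real.cos (freq M δ 0 * t) ^ 2 = 1 / 2 + Real.cos (2 * (freq M δ 0 * t)) / 2 :=
      Real.cos_sq _
    have hmn := p (freq M δ m * t) (freq M δ n * t)
    have q1 := p (2 * (freq M δ 0 * t)) (freq M δ m * t - freq M δ n * t)
    have q2 := p (2 * (freq M δ 0 * t)) (freq M δ m * t + freq M δ n * t)
    have s1 : ((2 * m - 2 * n : ℤ) : ℝ) * t = freq M δ m * t - freq M δ n * t := by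
      rw [freq_eq, freq_eq]; push_cast; ring
    have s2 : ((2 * m + 2 * n + 2 * b : ℤ) : ℝ) * t = freq M δ m * t + freq M δ n * t := by
      rw [freq_eq, freq_eq]; push_cast; ring
    have s3 : ((2 * b + 2 * m - 2 * n : ℤ) : ℝ) * t
        = 2 * (freq M δ 0 * t) + (freq M δ m * t - freq M δ n * t) := by
      rw [freq_eq, freq_eq, freq_eq]; push_cast; ring
    have s4 : ((2 * b + 2 * n - 2 * m : ℤ) : ℝ) * t
        = 2 * (freq M δ 0 * t) - (freq M δ m * t - freq M δ n * t) := by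
      rw [freq_eq, freq_eq, freq_eq]; push_cast; ring
    have s5 : ((4 * b + 2 * m + 2 * n : ℤ) : ℝ) * t
        = 2 * (freq M δ 0 * t) + (freq M δ m * t + freq M δ n * t) := by
      rw [freq_eq, freq_eq, freq_eq]; push_cast; ring
    have s6 : Real.cos (((2 * m + 2 * n : ℤ) : ℝ) * t)
        = Real.cos (2 * (freq M δ 0 * t) - (freq M δ m * t + freq M δ n * t)) := by
      rw [← Real.cos_neg, freq_eq, freq_eq, freq_eq]
      congr 1
      push_cast
      ring
    rw [s1, s2, s3, s4, s5, s6, h0]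
    linear_combination (1 / 2 + Real.cos (2 * (freq M δ 0 * t)) / 2) * hmn + q1 / 4 + q2 / 4
  simp only [e]
  have i : ∀ (r : ℝ) (k : ℤ), IntervalIntegrable (fun t : ℝ => r * Real.cos (k * t)) volume 0
      (2 * Real.pi) := fun r k => Continuous.intervalIntegrable (by fun_prop) _ _
  rw [intervalIntegral.integral_add (((((i _ _).add (i _ _)).add (i _ _)).add (i _ _)).add (i _ _))
      (i _ _), intervalIntegral.integral_add ((((i _ _).add (i _ _)).add (i _ _)).add (i _ _)) (i _ _),
    intervalIntegral.integral_add (((i _ _).add (i _ _)).add (i _ _)) (i _ _),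
    intervalIntegral.integral_add ((i _ _).add (i _ _)) (i _ _),
    intervalIntegral.integral_add (i _ _) (i _ _)]
  simp only [intervalIntegral.integral_const_mul, integral_cos_int_mul]
  rw [if_neg (show ¬ (2 * m + 2 * n + 2 * b : ℤ) = 0 by omega),
    if_neg (show ¬ (2 * b + 2 * m - 2 * n : ℤ) = 0 by omega),
    if_neg (show ¬ (2 * b + 2 * n - 2 * m : ℤ) = 0 by omega),
    if_neg (show ¬ (4 * b + 2 * m + 2 * n : ℤ) = 0 by omega)]
  by_cases hmn : m = n
  · subst hmn
    by_cases hm : m = 0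
    · subst hm
      simp [avgFactor]
      ring
    · rw [if_pos (by omega), if_neg (by omega), if_pos rfl, avgFactor, if_neg hm]
      ring
  · rw [if_neg (by omega), if_neg (by omega), if_neg hmn]
    ring

theorem abs_avgFactor_mul_le (hδ : Admissible M δ) (m : ℕ) :
    |avgFactor m * potMatrix M δ m m| ≤ ‖mulPoly M δ (potPoly M δ)‖ := by
  rw [abs_mul]
  have h : |avgFactor m| ≤ 1 := by
    unfold avgFactor
    split_ifs <;> norm_num
  calc |avgFactor m| * |potMatrix M δ m m| ≤ 1 * ‖mulPoly M δ (potPoly M δ)‖ :=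
        mul_le_mul h (abs_potMatrix_le hδ m) (abs_nonneg _) zero_le_one
    _ = _ := one_mul _

/-- The time average of `Φ^{-t} cos²(ω_0 t) W e_0² Φ^t`. -/
def avgPot (hδ : Admissible M δ) : L2 M δ →L[ℝ] L2 M δ :=
  multiplier hδ (fun m => avgFactor m * potMatrix M δ m m) _ (abs_avgFactor_mul_le hδ)

theorem continuous_avgPot_integrand (hδ : Admissible M δ) (f : L2 M δ) :
    Continuous fun t => linFlow (-t) (Real.cos (freq M δ 0 * t) ^ 2
      • mulPoly M δ (potPoly M δ) (linFlow t f)) := by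
  refine continuous_linFlow_comp hδ ?_ continuous_neg
  exact (by fun_prop : Continuous fun t => Real.cos (freq M δ 0 * t) ^ 2).smul
    ((mulPoly M δ (potPoly M δ)).continuous.comp (continuous_linFlow hδ f))

/-- Tested against e_m the integrand is a finite sum over n, by bandedness. Off-diagonal terms
vanish either in the matrix or in the time integral. -/
theorem integral_avgPot (hδ : Admissible M δ) (f : L2 M δ) :
    ∫ t in (0 : ℝ)..(2 * Real.pi), linFlow (-t) (Real.cos (freq M δ 0 * t) ^ 2
      • mulPoly M δ (potPoly M δ) (linFlow t f)) = (2 * Real.pi) • avgPot hδ f := by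
  refine coeff_ext hδ fun m => ?_
  have hc : ∀ φ : L2 M δ, coeff m φ = innerSL ℝ (eigenmode M δ m) φ := fun φ => rfl
  rw [hc, ← ContinuousLinearMap.intervalIntegral_comp_comm _
    ((continuous_avgPot_integrand hδ f).intervalIntegrable _ _)]
  simp only [← hc]
  have e : ∀ t : ℝ, coeff m (linFlow (-t) (Real.cos (freq M δ 0 * t) ^ 2
      • mulPoly M δ (potPoly M δ) (linFlow t f)))
      = ∑ n ∈ Finset.range (m + baseFreq M δ), potMatrix M δ m n * coeff n f
        * (Real.cos (freq M δ m * t) * (Real.cos (freq M δ 0 * t) ^ 2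
          * Real.cos (freq M δ n * t))) := by
    intro t
    rw [coeff_linFlow hδ, coeff_smul, coeff_mulPoly_potPoly hδ, mul_neg, Real.cos_neg,
      Finset.mul_sum, Finset.mul_sum]
    refine Finset.sum_congr rfl fun n _ => ?_
    rw [coeff_linFlow hδ]
    ring
  simp only [e]
  rw [intervalIntegral.integral_finsetSum fun n _ => Continuous.intervalIntegrable (by fun_prop) _ _]
  simp only [intervalIntegral.integral_const_mul]
  rw [Finset.sum_eq_single_of_mem m (Finset.mem_range.2 (by
    have := two_le_baseFreq hδ
    omega))]
  · have := two_le_baseFreq hδ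
    rw [integral_cos_sq_mul_cos_mul_cos M δ (by omega) (by omega), if_pos rfl, coeff_smul, avgPot,
      coeff_multiplier]
    ring
  · intro n hn hnm
    by_cases h : n + baseFreq M δ ≤ m
    · rw [potMatrix_symm, potMatrix_eq_zero hδ h]
      ring
    · rw [integral_cos_sq_mul_cos_mul_cos M δ (by omega) (Finset.mem_range.1 hn), if_neg (Ne.symm hnm),
        mul_zero]

/-! ### The derivative of the averaged nonlinearity -/

/-- The preimage of `κ e_0` under `invL`. -/
def baseState (M : Model) (δ : ℕ) (κ : ℝ) : L2 M δ := (κ * freq M δ 0 ^ 2) • eigenmode M δ 0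

theorem invL_linFlow_baseState (hδ : Admissible M δ) (κ t : ℝ) :
    invL hδ (linFlow t (baseState M δ κ)) = (κ * Real.cos (freq M δ 0 * t)) • eigenmode M δ 0 := by
  have h := two_le_freq hδ 0
  refine coeff_ext hδ fun m => ?_
  rw [coeff_invL, coeff_linFlow hδ, baseState, coeff_smul, coeff_smul, coeff_eigenmode hδ]
  split_ifs with hm
  · subst hm
    field_simp
  · simp

/-- With u = κ cos(ω_0 t) e_0 and v the perturbation, (u + v)³ - u³ - 3u²v = 3uv² + v³; each product
is bounded by `abs_triple_le`, uniformly in t. -/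
theorem norm_cubic_remainder_le (hδ : Admissible M δ) (κ t : ℝ) (g : L2 M δ) :
    ‖cubic (invL hδ (linFlow t (baseState M δ κ + g))) - cubic (invL hδ (linFlow t (baseState M δ κ)))
        + (3 * κ ^ 2) • (Real.cos (freq M δ 0 * t) ^ 2
          • mulPoly M δ (potPoly M δ) (linFlow t (invL hδ g)))‖
      ≤ invLConst hδ ^ 3 * (3 * ‖baseState M δ κ‖ + ‖g‖) * ‖invSqrtWeight M δ‖ * ‖g‖ ^ 2 := by
  have key : ‖cubic (invL hδ (linFlow t (baseState M δ κ + g)))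
        - cubic (invL hδ (linFlow t (baseState M δ κ)))
        + (3 * κ ^ 2) • (Real.cos (freq M δ 0 * t) ^ 2
          • mulPoly M δ (potPoly M δ) (linFlow t (invL hδ g)))‖
      ≤ invLConst hδ ^ 3 * (3 * (‖linFlow t (baseState M δ κ)‖ * ‖linFlow t g‖ * ‖linFlow t g‖)
        + ‖linFlow t g‖ * ‖linFlow t g‖ * ‖linFlow t g‖) * ‖invSqrtWeight M δ‖ := by
    rw [linFlow_invL hδ, linFlow_add hδ]
    set a := linFlow t (baseState M δ κ) with ha
    set b := linFlow t g with hb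
    refine norm_le_of_ae_le ?_
    have hu : invL hδ a =ᵐ[mu M δ] fun x =>
        κ * Real.cos (freq M δ 0 * t) * (modePoly M δ 0).eval (Real.sin x ^ 2) := by
      rw [ha, invL_linFlow_baseState hδ, eigenmode_eq]
      filter_upwards [Lp.coeFn_smul (κ * Real.cos (freq M δ 0 * t)) (polyL2 M δ (modePoly M δ 0)),
        coeFn_polyL2 (M := M) (δ := δ) (modePoly M δ 0)] with x h1 h2
      rw [h1, Pi.smul_apply, h2, smul_eq_mul]
    have hadd : invL hδ (a + b) =ᵐ[mu M δ] fun x => invL hδ a x + invL hδ b x := by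
      rw [map_add]
      exact Lp.coeFn_add _ _
    filter_upwards [abs_triple_le hδ a b b, abs_triple_le hδ b b b, hu, hadd,
      coeFn_cubic hδ (a + b), coeFn_cubic hδ a, coeFn_mulPoly (potPoly M δ) (invL hδ b),
      Lp.coeFn_add (cubic (invL hδ (a + b)) - cubic (invL hδ a))
        ((3 * κ ^ 2) • (Real.cos (freq M δ 0 * t) ^ 2 • mulPoly M δ (potPoly M δ) (invL hδ b))),
      Lp.coeFn_sub (cubic (invL hδ (a + b))) (cubic (invL hδ a)),
      Lp.coeFn_smul (3 * κ ^ 2)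
        (Real.cos (freq M δ 0 * t) ^ 2 • mulPoly M δ (potPoly M δ) (invL hδ b)),
      Lp.coeFn_smul (Real.cos (freq M δ 0 * t) ^ 2) (mulPoly M δ (potPoly M δ) (invL hδ b))]
      with x h1 h2 h3 h4 h5 h6 h7 h8 h9 h10 h11
    rw [h8, Pi.add_apply, h9, Pi.sub_apply, h5, h6, h10, Pi.smul_apply, h11, Pi.smul_apply, h7, h4,
      potPoly, eval_mul, ← nlWeight_eq, eval_pow, smul_eq_mul, smul_eq_mul]
    set v := invL hδ b x
    set u := invL hδ a x
    have e : -(nlWeight M δ x * (u + v) ^ 3) - -(nlWeight M δ x * u ^ 3)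
        + 3 * κ ^ 2 * (Real.cos (freq M δ 0 * t) ^ 2
          * (nlWeight M δ x * (modePoly M δ 0).eval (Real.sin x ^ 2) ^ 2 * v))
        = -(3 * (nlWeight M δ x * (u * v * v)) + nlWeight M δ x * (v * v * v)) := by
      have : κ ^ 2 * (Real.cos (freq M δ 0 * t) ^ 2 * (modePoly M δ 0).eval (Real.sin x ^ 2) ^ 2)
          = u ^ 2 := by
        rw [h3]
        ring
      linear_combination 3 * nlWeight M δ x * v * this
    rw [e, abs_neg]
    refine (abs_add_le _ _).trans ?_
    rw [abs_mul, abs_of_pos (by norm_num : (0 : ℝ) < 3)]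
    refine (add_le_add (mul_le_mul_of_nonneg_left h1 (by norm_num)) h2).trans (le_of_eq ?_)
    ring
  refine key.trans ?_
  have h1 := norm_linFlow_le hδ t (baseState M δ κ)
  have h2 := norm_linFlow_le hδ t g
  have hK := invLConst_nonneg hδ
  calc _ ≤ invLConst hδ ^ 3 * (3 * (‖baseState M δ κ‖ * ‖g‖ * ‖g‖) + ‖g‖ * ‖g‖ * ‖g‖)
        * ‖invSqrtWeight M δ‖ := by gcongr
    _ = _ := by ring

theorem avgCubic_remainder (hδ : Admissible M δ) (κ : ℝ) (g : L2 M δ) :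
    ‖avgCubic (invL hδ (baseState M δ κ + g)) - avgCubic (invL hδ (baseState M δ κ))
        - ((-(3 * κ ^ 2)) • (avgPot hδ ∘L invL hδ)) g‖
      ≤ invLConst hδ ^ 3 * (3 * ‖baseState M δ κ‖ + ‖g‖) * ‖invSqrtWeight M δ‖ * ‖g‖ ^ 2 := by
  have hpi := Real.pi_pos
  have e : avgCubic (invL hδ (baseState M δ κ + g)) - avgCubic (invL hδ (baseState M δ κ))
      - ((-(3 * κ ^ 2)) • (avgPot hδ ∘L invL hδ)) g
      = (1 / (2 * Real.pi)) • ∫ t in (0 : ℝ)..(2 * Real.pi),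
        linFlow (-t) (cubic (invL hδ (linFlow t (baseState M δ κ + g)))
          - cubic (invL hδ (linFlow t (baseState M δ κ)))
          + (3 * κ ^ 2) • (Real.cos (freq M δ 0 * t) ^ 2
            • mulPoly M δ (potPoly M δ) (linFlow t (invL hδ g)))) := by
    have i1 := (continuous_integrand hδ (baseState M δ κ + g)).intervalIntegrable
      (μ := volume) 0 (2 * Real.pi)
    have i2 := (continuous_integrand hδ (baseState M δ κ)).intervalIntegrable
      (μ := volume) 0 (2 * Real.pi)
    have i3 := (continuous_avgPot_integrand hδ (invL hδ g)).intervalIntegrable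
      (μ := volume) 0 (2 * Real.pi)
    simp only [linFlow_invL hδ] at i1 i2
    simp only [avgCubic, linFlow_add hδ, linFlow_sub hδ, linFlow_smul hδ, linFlow_invL hδ] at *
    have i4 : IntervalIntegrable (fun t => (3 * κ ^ 2) • Real.cos (freq M δ 0 * t) ^ 2
        • linFlow (-t) (mulPoly M δ (potPoly M δ) (invL hδ (linFlow t g)))) volume 0
        (2 * Real.pi) := i3.smul (3 * κ ^ 2)
    rw [intervalIntegral.integral_add (i1.sub i2) i4, intervalIntegral.integral_sub i1 i2,
      intervalIntegral.integral_smul]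
    have h := integral_avgPot hδ (invL hδ g)
    simp only [linFlow_smul hδ, linFlow_invL hδ] at h
    rw [h, smul_add, smul_sub, smul_comm (3 * κ ^ 2), smul_smul (1 / (2 * Real.pi)),
      one_div_mul_cancel (by positivity), one_smul]
    change _ - (-(3 * κ ^ 2)) • avgPot hδ (invL hδ g) = _
    rw [neg_smul, sub_neg_eq_add]
  rw [e, norm_smul, Real.norm_of_nonneg (by positivity)]
  have h := intervalIntegral.norm_integral_le_of_norm_le_const (a := 0) (b := 2 * Real.pi)
    (fun t _ => (norm_linFlow_le hδ (-t) _).trans (norm_cubic_remainder_le hδ κ t g))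
  rw [sub_zero, abs_of_pos (by positivity)] at h
  calc _ ≤ 1 / (2 * Real.pi) * (invLConst hδ ^ 3 * (3 * ‖baseState M δ κ‖ + ‖g‖)
        * ‖invSqrtWeight M δ‖ * ‖g‖ ^ 2 * (2 * Real.pi)) := by gcongr
    _ = _ := by field_simp

/-- The variable is g = Lζ, for which the cubic term is defined on all of L². The derivative on
H^{s+2} then follows from the chain rule with the bounded map L. -/
theorem hasFDerivAt_avgCubic (hδ : Admissible M δ) (κ : ℝ) :
    HasFDerivAt (fun g => avgCubic (invL hδ g)) ((-(3 * κ ^ 2)) • (avgPot hδ ∘L invL hδ))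
      (baseState M δ κ) := by
  rw [hasFDerivAt_iff_isLittleO_nhds_zero]
  have hK := invLConst_nonneg hδ
  refine Asymptotics.IsBigO.trans_isLittleO (g := fun g : L2 M δ => ‖g‖ ^ 2) ?_
    (Asymptotics.isLittleO_norm_pow_id (by norm_num))
  refine Asymptotics.IsBigO.of_bound (invLConst hδ ^ 3 * (3 * ‖baseState M δ κ‖ + 1)
    * ‖invSqrtWeight M δ‖) ?_
  filter_upwards [Metric.closedBall_mem_nhds (0 : L2 M δ) one_pos] with g hg
  rw [mem_closedBall_zero_iff] at hg
  refine (avgCubic_remainder hδ κ g).trans ?_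
  rw [Real.norm_of_nonneg (by positivity)]
  gcongr

/-! ### The operator on Sobolev spaces -/

theorem norm_sobolev (s : ℝ) (ζ : Sobolev M δ s) : ‖ζ‖ = ‖Sobolev.toSeq M δ s ζ‖ := rfl

/-- Coefficientwise ω_n² ≤ ω_n^{s+2}, because ω_n ≥ 2 and s ≥ 0. -/
theorem norm_opL_le (hδ : Admissible M δ) {s : ℝ} (hs : 0 ≤ s) (ζ : Sobolev M δ (s + 2)) :
    ‖opL ζ.toDom‖ ≤ ‖ζ‖ := by
  rw [norm_sobolev, ← (modeBasis hδ).repr.norm_map]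
  refine lp.norm_mono (by norm_num) fun n => ?_
  rw [modeBasis_repr, coeff_opL hδ]
  change ‖freq M δ n ^ 2 * coeff n ζ.toL2‖ ≤ ‖freq M δ n ^ (s + 2) * coeff n ζ.toL2‖
  have h := two_le_freq hδ n
  rw [norm_mul, norm_mul]
  gcongr
  rw [Real.norm_of_nonneg (by positivity), Real.norm_of_nonneg (by positivity),
    ← Real.rpow_natCast]
  exact Real.rpow_le_rpow_of_exponent_le (by linarith) (by push_cast; linarith)

/-- The operator `L` on `H^{s+2}`. -/
def sobolevL (hδ : Admissible M δ) {s : ℝ} (hs : 0 ≤ s) : Sobolev M δ (s + 2) →L[ℝ] L2 M δ :=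
  LinearMap.mkContinuous
    { toFun := fun ζ => opL ζ.toDom
      map_add' := fun ζ η => coeff_ext hδ fun n => by
        rw [coeff_add, coeff_opL hδ, coeff_opL hδ, coeff_opL hδ, ← mul_add, ← coeff_add]
        rfl
      map_smul' := fun c ζ => coeff_ext hδ fun n => by
        rw [RingHom.id_apply, coeff_smul, coeff_opL hδ, coeff_opL hδ]
        change freq M δ n ^ 2 * coeff n (c • ζ.toL2) = c * (freq M δ n ^ 2 * coeff n ζ.toL2)
        rw [coeff_smul, mul_left_comm] } 1 fun ζ => by
    rw [one_mul]
    exact norm_opL_le hδ hs ζ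

theorem sobolevL_apply (hδ : Admissible M δ) {s : ℝ} (hs : 0 ≤ s) (ζ : Sobolev M δ (s + 2)) :
    sobolevL hδ hs ζ = opL ζ.toDom := rfl

theorem coeff_sobolevL (hδ : Admissible M δ) {s : ℝ} (hs : 0 ≤ s) (ζ : Sobolev M δ (s + 2)) (n : ℕ) :
    coeff n (sobolevL hδ hs ζ) = freq M δ n ^ 2 * coeff n ζ.toL2 := coeff_opL hδ _ n

theorem invL_sobolevL (hδ : Admissible M δ) {s : ℝ} (hs : 0 ≤ s) (ζ : Sobolev M δ (s + 2)) :
    invL hδ (sobolevL hδ hs ζ) = ζ.toL2 := by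
  refine coeff_ext hδ fun n => ?_
  have h := two_le_freq hδ n
  rw [coeff_invL, coeff_sobolevL]
  field_simp

theorem opM_eq (hδ : Admissible M δ) {s : ℝ} (hs : 0 ≤ s) :
    (opM : Sobolev M δ (s + 2) → L2 M δ)
      = fun ζ => sobolevL hδ hs ζ + avgCubic (invL hδ (sobolevL hδ hs ζ)) := by
  funext ζ
  rw [invL_sobolevL, sobolevL_apply]
  rfl

theorem sobolev_eq_zero (hδ : Admissible M δ) {r : ℝ} {ζ : Sobolev M δ r}
    (h : ∀ n, coeff n ζ.toL2 = 0) : ζ = 0 := by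
  refine Subtype.ext (coeff_ext hδ fun n => ?_)
  refine (h n).trans ?_
  change 0 = coeff n (0 : L2 M δ)
  rw [coeff, inner_zero_right]

theorem smul_eigenmode_mem_sobolev (hδ : Admissible M δ) (κ r : ℝ) :
    κ • eigenmode M δ 0 ∈ sobolevSubmodule M δ r := by
  refine Submodule.smul_mem _ _ ⟨eigenmode_mem_domL hδ 0, ?_⟩
  have e : (fun n => freq M δ n ^ r * coeff n (eigenmode M δ 0))
      = ⇑(lp.single (E := fun _ : ℕ => ℝ) 2 0 (freq M δ 0 ^ r)) := ?_
  · rw [e]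
    exact lp.memℓp _
  funext n
  rw [coeff_eigenmode hδ, lp.coeFn_single]
  rcases eq_or_ne n 0 with rfl | hn
  · simp
  · simp [hn]

/-- The element `κ e_0` of the Sobolev space. -/
def sobolevMode (hδ : Admissible M δ) (κ r : ℝ) : Sobolev M δ r :=
  ⟨κ • eigenmode M δ 0, smul_eigenmode_mem_sobolev hδ κ r⟩

theorem sobolevL_sobolevMode (hδ : Admissible M δ) (κ : ℝ) {s : ℝ} (hs : 0 ≤ s) :
    sobolevL hδ hs (sobolevMode hδ κ (s + 2)) = baseState M δ κ := by
  refine coeff_ext hδ fun n => ?_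
  rw [coeff_sobolevL, baseState, coeff_smul]
  change _ * coeff n (κ • eigenmode M δ 0) = _
  rw [coeff_smul, coeff_eigenmode hδ]
  split_ifs with h
  · subst h
    ring
  · simp

/-- The seminorm of the Sobolev space is a norm. -/
@[reducible] def sobolevNormed (hδ : Admissible M δ) (r : ℝ) :
    NormedAddCommGroup (Sobolev M δ r) :=
  NormedAddCommGroup.ofSeparation fun ζ h => sobolev_eq_zero hδ fun n => by
    have h0 : Sobolev.toSeq M δ r ζ = 0 := norm_eq_zero.1 h
    have h1 : freq M δ n ^ r * coeff n ζ.toL2 = 0 :=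
      congrArg (fun f => f n) (congrArg Subtype.val h0)
    refine (mul_eq_zero.1 h1).resolve_left (Real.rpow_pos_of_pos ?_ r).ne'
    linarith [two_le_freq hδ n]

theorem hasFDerivAt_comp_sobolevL (hδ : Admissible M δ) {s : ℝ} (hs : 0 ≤ s)
    {G : L2 M δ → L2 M δ} {G' : L2 M δ →L[ℝ] L2 M δ} {ξ : Sobolev M δ (s + 2)}
    (hG : HasFDerivAt G G' (sobolevL hδ hs ξ)) :
    HasFDerivAt (fun ζ => G (sobolevL hδ hs ζ)) (G' ∘L sobolevL hδ hs) ξ := by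
  have hL : HasFDerivAt (fun ζ => sobolevL hδ hs ζ) (sobolevL hδ hs) ξ :=
    (sobolevL hδ hs).hasFDerivAt
  let := sobolevNormed hδ (s + 2)
  exact hG.comp _ hL

theorem hasFDerivAt_opM (hδ : Admissible M δ) (κ : ℝ) {s : ℝ} (hs : 0 ≤ s) :
    HasFDerivAt (opM : Sobolev M δ (s + 2) → L2 M δ)
      ((ContinuousLinearMap.id ℝ (L2 M δ) + (-(3 * κ ^ 2)) • (avgPot hδ ∘L invL hδ))
        ∘L sobolevL hδ hs)
      (sobolevMode hδ κ (s + 2)) := by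
  rw [opM_eq hδ hs]
  have h : HasFDerivAt (fun g : L2 M δ => g + avgCubic (invL hδ g))
      (ContinuousLinearMap.id ℝ (L2 M δ) + (-(3 * κ ^ 2)) • (avgPot hδ ∘L invL hδ))
      (baseState M δ κ) := (hasFDerivAt_id _).fun_add (hasFDerivAt_avgCubic hδ κ)
  rw [← sobolevL_sobolevMode hδ κ hs] at h
  exact hasFDerivAt_comp_sobolevL hδ hs h

theorem coeff_fderiv_opM (hδ : Admissible M δ) (κ : ℝ) {s : ℝ} (hs : 0 ≤ s)
    (h : Sobolev M δ (s + 2)) (m : ℕ) :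
    coeff m (fderiv ℝ opM (sobolevMode hδ κ (s + 2)) h)
      = (freq M δ m ^ 2 - 3 * κ ^ 2 * (avgFactor m * potMatrix M δ m m)) * coeff m h.toL2 := by
  have e : fderiv ℝ opM (sobolevMode hδ κ (s + 2)) h
      = sobolevL hδ hs h + (-(3 * κ ^ 2)) • avgPot hδ h.toL2 := by
    rw [(hasFDerivAt_opM hδ κ hs).fderiv, ← invL_sobolevL hδ hs h]
    rfl
  rw [e, coeff_add, coeff_smul, coeff_sobolevL, avgPot, coeff_multiplier]
  ring

/-! ### The interaction coefficients -/

theorem fourierC_eq (M : Model) (δ m : ℕ) : fourierC M δ 0 0 m m = potMatrix M δ m m := by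
  rw [fourierC, potMatrix, ← integral_mu_eval]
  refine integral_congr_ae (Filter.Eventually.of_forall fun x => ?_)
  simp only [nlWeight_eq, eigenfun_eq, potPoly, eval_mul, eval_pow]
  ring

theorem potMatrix_self (M : Model) (δ m : ℕ) : potMatrix M δ m m
    = normConst M δ 0 ^ 2 * (normConst M δ m ^ 2 * betaInt (sinExp M δ) (cosExp M δ)
      (nlPoly M δ * (jacobiPoly m (jacA M δ) (jacB M δ) * jacobiPoly m (jacA M δ) (jacB M δ)))) := by
  rw [potMatrix, ← betaInt_C_mul, ← betaInt_C_mul, potPoly, modePoly_zero, modePoly]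
  congr 1
  simp only [C_pow]
  ring

theorem potMatrix_zero_pos (hδ : Admissible M δ) : 0 < potMatrix M δ 0 0 := by
  have h1 := normConst_ne_zero hδ 0
  rw [potMatrix_self, jacobiPoly_zero, mul_one, mul_one]
  have : 0 < betaInt (sinExp M δ) (cosExp M δ) (nlPoly M δ) := by
    cases M
    · have := betaInt_one_sub_X_pow_mul (sinExp Model.KG δ) (cosExp Model.KG δ) (δ - 1) 1
      rw [mul_one] at this
      rw [nlPoly, this]
      exact betaInt_one_pos _ _
    · have := betaInt_one_sub_X_pow_mul (sinExp Model.WM δ + 2 * (δ - 1)) (cosExp Model.WM δ) 2 1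
      rw [mul_one] at this
      rw [nlPoly, betaInt_X_pow_mul, this]
      exact betaInt_one_pos _ _
  positivity

/-- The nonresonance condition for both models. -/
theorem nonresonance (hδ : Admissible M δ) {m : ℕ} (hm : 1 ≤ m) :
    freq M δ m ^ 2 * potMatrix M δ 0 0 ≠ 2 * freq M δ 0 ^ 2 * potMatrix M δ m m := by
  have hN0 := normConst_ne_zero hδ 0
  have hNm := normConst_sq_mul hδ m
  have hN0' := normConst_sq_mul hδ 0
  rw [potMatrix_self, potMatrix_self]
  intro h
  rw [freq_eq, freq_eq] at h
  have hδ1 := hδ.one_le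
  -- The normalization identities make each squared constant the reciprocal of a squared norm. What
  -- remains is the comparison of integrals of unnormalized Jacobi polynomials, stated with δ = d +
  -- 1.
  obtain ⟨d, rfl⟩ : ∃ d, δ = d + 1 := ⟨δ - 1, by omega⟩
  rw [jacobiPoly_zero, mul_one] at hN0' h
  rw [mul_one] at h
  cases M
  · have k := kg_nonresonance d m (by simp only [Admissible] at hδ; omega) hm
    have k0 := betaInt_kg_sq d 0
    have km := betaInt_kg_sq d m
    rw [jacobiPoly_zero, mul_one] at k0
    have e : ∀ P : ℝ[X], betaInt (sinExp Model.KG (d + 1)) (cosExp Model.KG (d + 1))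
        (nlPoly Model.KG (d + 1) * P) = betaInt 2 (4 * d) P := by
      intro P
      rw [nlPoly, betaInt_one_sub_X_pow_mul, sinExp, cosExp]
      congr 2
      omega
    have e1 := e 1
    rw [mul_one] at e1
    have ec : cosExp Model.KG (d + 1) = 2 * d := by
      simp only [cosExp]
      omega
    have eb : jacB Model.KG (d + 1) = (d : ℝ) - 1 / 2 := by
      simp only [jacB]
      push_cast
      ring
    rw [e, e1, eb] at h
    rw [ec, eb] at hNm
    rw [ec] at hN0'
    simp only [sinExp, jacA] at h hNm hN0'
    rw [k0, km] at h
    simp only [baseFreq] at h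
    apply k
    refine mul_left_cancel₀ (pow_ne_zero 2 hN0) ?_
    push_cast at h ⊢
    generalize momentSum (d - 1 / 2) ((2 * m + d + 1) ^ 2) d = sm at h ⊢
    generalize momentSum (d - 1 / 2) ((2 * 0 + d + 1) ^ 2) d = s0 at h ⊢
    linear_combination -h - 2 * (d + 1) ^ 2 * normConst Model.KG (d + 1) 0 ^ 2 * sm * hNm
      + (2 * m + d + 1) ^ 2 * normConst Model.KG (d + 1) 0 ^ 2 * s0 * hN0'
  · have k := wm_nonresonance d m hm
    have e : ∀ P : ℝ[X], betaInt (sinExp Model.WM (d + 1)) (cosExp Model.WM (d + 1))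
        (nlPoly Model.WM (d + 1) * P) = betaInt (4 * d + 3) 7 P := by
      intro P
      rw [nlPoly, mul_assoc, betaInt_X_pow_mul, betaInt_one_sub_X_pow_mul, sinExp, cosExp]
      congr 2
      omega
    have e1 := e 1
    rw [mul_one] at e1
    have es : sinExp Model.WM (d + 1) = 2 * d + 3 := by
      simp only [sinExp]
      omega
    rw [e, e1] at h
    rw [es] at hNm hN0'
    simp only [cosExp, jacA, jacB, baseFreq] at h hNm hN0'
    push_cast at h hNm hN0'
    refine k.ne ?_
    refine mul_left_cancel₀ (pow_ne_zero 2 (normConst_ne_zero hδ m)) ?_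
    refine mul_left_cancel₀ (pow_ne_zero 2 hN0) ?_
    generalize betaInt (4 * d + 3) 7 (jacobiPoly m (d + 1) 1 * jacobiPoly m (d + 1) 1) = Tm at h ⊢
    generalize betaInt (2 * d + 3) 3 (jacobiPoly m (d + 1) 1 * jacobiPoly m (d + 1) 1) = hh at hNm ⊢
    generalize betaInt (2 * d + 3) 3 1 = h0 at hN0' ⊢
    generalize betaInt (4 * d + 3) 7 1 = T0 at h ⊢
    generalize normConst Model.WM (d + 1) 0 = N0 at *
    generalize normConst Model.WM (d + 1) m = Nm at *
    have h' : (2 * (m : ℝ) + (d + 3)) ^ 2 * (N0 ^ 2 * T0) = 2 * (d + 3) ^ 2 * (Nm ^ 2 * Tm) :=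
      mul_left_cancel₀ (pow_ne_zero 2 hN0) (by linear_combination h)
    linear_combination 2 * (d + 3) ^ 2 * Nm ^ 2 * Tm * hN0'
      - (2 * m + d + 3) ^ 2 * N0 ^ 2 * T0 * hNm - h'

end AdS

end

/-! ### The main theorem -/

theorem mainTheorem5 (M : AdS.Model) (δ : ℕ) (hδ : AdS.Admissible M δ) (s : ℝ) (hs : 0 ≤ s)
    (κ : ℝ) (hκ : κ = AdS.kappa M δ ∨ κ = -AdS.kappa M δ) :
    (∀ ζ : AdS.Sobolev M δ (s + 2),
      (∀ t : ℝ, MemLp (fun x => -(AdS.nlWeight M δ x * AdS.linFlow t ζ.toL2 x ^ 3)) 2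
        (AdS.mu M δ)) ∧
      IntervalIntegrable (fun t => AdS.linFlow (-t) (AdS.cubic (AdS.linFlow t ζ.toL2)))
        volume 0 (2 * Real.pi)) ∧
    ∃ ξ : AdS.Sobolev M δ (s + 2), ξ.toL2 = κ • AdS.eigenmode M δ 0 ∧
      DifferentiableAt ℝ (AdS.opM (M := M) (δ := δ) (r := s + 2)) ξ ∧
      (∀ h : AdS.Sobolev M δ (s + 2),
        AdS.coeff 0 (fderiv ℝ AdS.opM ξ h) = -2 * AdS.freq M δ 0 ^ 2 * AdS.coeff 0 h.toL2 ∧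
        ∀ m : ℕ, 1 ≤ m →
          AdS.coeff m (fderiv ℝ AdS.opM ξ h) =
            AdS.freq M δ 0 ^ 2 * AdS.freq M δ m ^ 2 / AdS.fourierC M δ 0 0 0 0 *
              (AdS.fourierC M δ 0 0 0 0 / AdS.freq M δ 0 ^ 2
                - 2 * (AdS.fourierC M δ 0 0 m m / AdS.freq M δ m ^ 2)) * AdS.coeff m h.toL2) ∧
      (fderiv ℝ (AdS.opM (M := M) (δ := δ) (r := s + 2)) ξ).ker = ⊥ := by
  have hC := AdS.potMatrix_zero_pos hδ
  have hω := fun m => AdS.two_le_freq hδ m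
  -- Only κ² enters the derivative, so the sign of κ is irrelevant.
  have hκ2 : κ ^ 2 = 8 * AdS.freq M δ 0 ^ 2 / (3 * AdS.potMatrix M δ 0 0) := by
    have h : κ ^ 2 = AdS.kappa M δ ^ 2 := by
      rcases hκ with rfl | rfl
      · rfl
      · exact neg_sq _
    rw [h, AdS.kappa, AdS.fourierC_eq, mul_pow, Real.sq_sqrt (by positivity)]
    field_simp
    ring
  -- For m ≥ 1 the average is 1/4, and 3κ²/4 = 2ω_0²/C_{0000}. For m = 0 the average 3/8 gives ω_0²
  -- - 3ω_0².
  have hcoeff : ∀ (h : AdS.Sobolev M δ (s + 2)) (m : ℕ), 1 ≤ m →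
      AdS.coeff m (fderiv ℝ AdS.opM (AdS.sobolevMode hδ κ (s + 2)) h)
        = (AdS.freq M δ m ^ 2 - 2 * AdS.freq M δ 0 ^ 2 * AdS.potMatrix M δ m m
          / AdS.potMatrix M δ 0 0) * AdS.coeff m h.toL2 := by
    intro h m hm
    rw [AdS.coeff_fderiv_opM hδ κ hs, hκ2, AdS.avgFactor, if_neg (by omega)]
    field_simp
    ring
  have hcoeff0 : ∀ h : AdS.Sobolev M δ (s + 2),
      AdS.coeff 0 (fderiv ℝ AdS.opM (AdS.sobolevMode hδ κ (s + 2)) h)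
        = -2 * AdS.freq M δ 0 ^ 2 * AdS.coeff 0 h.toL2 := by
    intro h
    rw [AdS.coeff_fderiv_opM hδ κ hs, hκ2, AdS.avgFactor, if_pos rfl]
    field_simp
    ring
  refine ⟨fun ζ => ?_, AdS.sobolevMode hδ κ (s + 2), rfl,
    (AdS.hasFDerivAt_opM hδ κ hs).differentiableAt, fun h => ⟨hcoeff0 h, fun m hm => ?_⟩, ?_⟩
  -- Every ζ in H^{s+2} is L⁻¹ of an element of L², so the cubic bounds apply along its whole orbit,
  -- and the integrand is continuous in time.
  · rw [← AdS.invL_sobolevL hδ hs ζ]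
    refine ⟨fun t => ?_, (AdS.continuous_integrand hδ _).intervalIntegrable _ _⟩
    rw [AdS.linFlow_invL hδ]
    exact AdS.memLp_cubic hδ _
  · rw [hcoeff h m hm, AdS.fourierC_eq, AdS.fourierC_eq]
    have h0 := hω 0
    have h1 := hω m
    field_simp
  · rw [Submodule.eq_bot_iff]
    intro h hh
    have hz : ∀ m, AdS.coeff m (fderiv ℝ AdS.opM (AdS.sobolevMode hδ κ (s + 2)) h) = 0 := by
      intro m
      have e : fderiv ℝ AdS.opM (AdS.sobolevMode hδ κ (s + 2)) h = 0 := hh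
      rw [e, AdS.coeff, inner_zero_right]
    refine AdS.sobolev_eq_zero hδ fun m => ?_
    rcases Nat.eq_zero_or_pos m with rfl | hm
    · have h0 := hω 0
      refine (mul_eq_zero.1 ((hcoeff0 h).symm.trans (hz 0))).resolve_left ?_
      have : 0 < AdS.freq M δ 0 ^ 2 := by positivity
      linarith
    · refine (mul_eq_zero.1 ((hcoeff h m hm).symm.trans (hz m))).resolve_left fun hr => ?_
      -- A vanishing diagonal entry would be a resonance.
      refine AdS.nonresonance hδ hm ?_
      field_simp at hr
      linarith
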